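/- Let $n\ge 2$, let $e_1,\dots,e_n$ be the standard orthonormal basis of $E=\mathbb{R}^n$, with $(\cdot,\cdot)$ extended bilinearly to $\mathbb{C}^n$, and let $R_+=\{e_p,\,2e_p,\,e_i\pm e_j : 1\le p\le n,\ 1\le i<j\le n\}$ be the positive roots of type $BC_n$, with complex multiplicities $k_s$ (on $e_p$), $k_m$ (on $e_i\pm e_j$) and $k_l$ (on $2e_p$); put $k_{\frac12\alpha}=0$ if $\frac12\alpha$ is not a root. Let $\alpha^\vee=2\alpha/(\alpha,\alpha)$, $\rho(k)=\frac12\sum_{\alpha\in R_+}k_\alpha\alpha$, let $W$ be the Weyl group, $E_+$ the positive Weyl chamber and $Q$ the set of nonnegative integral combinations of positive roots. For $\lambda\in\mathbb{C}^n$ with $(\mu,\mu)\neq 2(\lambda,\mu)$ for all $0\ne\mu\in Q$, let $\Phi(\lambda,k;a)=\sum_{\mu\in Q}\Gamma_\mu a^{\lambda-\rho(k)-\mu}$, $\Gamma_0=1$, be the unique solution of this form on $\exp E_+$ of $L(k)u=((\lambda,\lambda)-(\rho(k),\rho(k)))u$, where $$L(k)=\sum_{j=1}^n\partial_{e_j}^2+\sum_{\alpha\in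 R_+}k_\alpha\frac{1+e^{-\alpha}}{1-e^{-\alpha}}\,\partial_\alpha .$$ Let $$\tilde c(\lambda,k)=\prod_{\alpha\in R_+}\frac{\Gamma\big((\lambda,\alpha^\vee)+\frac12k_{\frac12\alpha}\big)}{\Gamma\big((\lambda,\alpha^\vee)+\frac12k_{\frac12\alpha}+k_\alpha\big)},\qquad c(\lambda,k)=\frac{\tilde c(\lambda,k)}{\tilde c(\rho(k),k)},$$ where $k\mapsto\tilde c(\rho(k),k)$ is understood as a meromorphic function (removable singularities, such as those at $k_m=0$, are removed). The hypergeometric function of type $BC_n$ is $$F(\lambda,k;a)=\sum_{w\in W}c(w\lambda,k)\,\Phi(w\lambda,k;a)$$ for generic $\lambda$ and $a\in \exp E_+$, extended $W$-invariantly and by continuity to all $\lambda\in\mathbb{C}^n$ and all $a\in\exp E$. Write $\lambda_j=(\lambda,2e_j)$ and $a_t=\exp\big(\sum_j 2t_je_j\big)$ for $t\in\mathbb{R}^n$. Put $$\Delta_{m,\mathrm{rat}}(a_t)=\prod_{1\le i<j\le n}4(t_i-t_j)(t_i+t_j),$$ the product of $\alpha(\log a_t)$ over the positive roots $\alpha=e_i\pm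 e_j$. Let $\mathcal{J}_\alpha(z)=2^\alpha\Gamma(\alpha+1)z^{-\alpha}J_\alpha(z)$ be the normalized Bessel function ($J_\alpha$ is the Bessel function of the first kind), and for a matrix $M=(m_{ij})$ let $\mathrm{perm}(M)=\sum_{\sigma\in S_n}\prod_i m_{\sigma(i)i}$. Let $\alpha=k_s+k_l-\frac12$ and assume that $\alpha\ne 0,-1,-2,\dots$, and that $\lambda_j\neq0$ and $t_j\ne0$ for $j=1,\dots,n$. (1) If $k_m=1$, and $\lambda_i^2\ne\lambda_j^2$ and $t_i^2\neq t_j^2$ for all $i\ne j$ (so that the right-hand side is defined), then $$\lim_{\epsilon\downarrow0}F(\epsilon^{-1}\lambda,k;a_{\epsilon t})=\frac{A}{\prod_{1\le i<j\le n}(\lambda_i^2-\lambda_j^2)}\cdot\frac{\det\big(\mathcal{J}_\alpha(\sqrt{-1}\,\lambda_it_j)\big)_{1\le i,j\le n}}{\Delta_{m,\mathrm{rat}}(a_t)},\qquad A=2^{2n(n-1)}\prod_{i=1}^{n-1}\big((\alpha+i)^{n-i}\,i!\big).$$ (2) If $k_m=0$, then $$\lim_{\epsilon\downarrow0}F(\epsilon^{-1}\lambda,k;a_{\epsilon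 t})=\frac1{n!}\,\mathrm{perm}\big(\mathcal{J}_\alpha(\sqrt{-1}\,\lambda_it_j)\big)_{1\le i,j\le n}.$$ -/

import Mathlib

open Filter Topology

noncomputable section

namespace BC

/-- Multiplicity functions `k = (k_s, k_m, k_l)` on the root system of type `BC_n`
(values on the short, middle and long roots). -/
abbrev Mult := ℂ × ℂ × ℂ

/-- The bilinear pairing of an integral vector with a real or complex vector, with respect to the
standard orthonormal basis `e_1, …, e_n` of `ℝ^n`. -/
def pair {n : ℕ} {R : Type*} [CommRing R] (μ : Fin n → ℤ) (v : Fin n → R) : R :=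
  ∑ i, (μ i : R) * v i

/-- The positive middle roots `e_i - e_j`, `e_i + e_j` (`i < j`). -/
def middleRoots (n : ℕ) : Finset (Fin n → ℤ) :=
  ((Finset.univ : Finset (Fin n × Fin n)).filter (fun q => q.1 < q.2)).image
      (fun q => Pi.single q.1 1 - Pi.single q.2 1) ∪
    ((Finset.univ : Finset (Fin n × Fin n)).filter (fun q => q.1 < q.2)).image
      (fun q => Pi.single q.1 1 + Pi.single q.2 1)

/-- The positive roots `e_p`, `2 e_p`, `e_i ± e_j` (`i < j`) of type `BC_n`. -/
def posRoots (n : ℕ) : Finset (Fin n → ℤ) :=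
  Finset.univ.image (fun p : Fin n => (Pi.single p 1 : Fin n → ℤ)) ∪
    Finset.univ.image (fun p : Fin n => (Pi.single p 2 : Fin n → ℤ)) ∪ middleRoots n

/-- The multiplicity `k_α` of a root `α`; short, middle and long roots have squared length
`1`, `2` and `4`. -/
def rootMult {n : ℕ} (k : Mult) (α : Fin n → ℤ) : ℂ :=
  if pair α α = 1 then k.1
  else if pair α α = 2 then k.2.1
  else if pair α α = 4 then k.2.2
  else 0

/-- The multiplicity `k_{α/2}` of half a root `α`, which is `0` if `α/2` is not a root: `α/2` is a
root exactly when `α` is long, and then it is short. -/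
def halfRootMult {n : ℕ} (k : Mult) (α : Fin n → ℤ) : ℂ :=
  if pair α α = 4 then k.1 else 0

/-- `(v, α^∨) = 2 (v, α) / (α, α)`. -/
def corootPair {n : ℕ} (v : Fin n → ℂ) (α : Fin n → ℤ) : ℂ :=
  2 * pair α v / ((pair α α : ℤ) : ℂ)

/-- `ρ(k) = ½ ∑_{α > 0} k_α α`. -/
def rho (n : ℕ) (k : Mult) : Fin n → ℂ :=
  fun i => (1 / 2) * ∑ α ∈ posRoots n, rootMult k α * (α i : ℂ)

/-- The positive Weyl chamber `E_+`; a point `a` of `A = exp E` is represented by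
`x = log a ∈ E = ℝ^n`, so this is also `A_+`. -/
def chamber (n : ℕ) : Set (Fin n → ℝ) :=
  {x | ∀ α ∈ posRoots n, 0 < pair α x}

/-- The cone `Q` of nonnegative integral combinations of positive roots. -/
def rootCone (n : ℕ) : AddSubmonoid (Fin n → ℤ) :=
  AddSubmonoid.closure (posRoots n : Set (Fin n → ℤ))

/-- The operator
`L(k) = ∑_j ∂_{e_j}^2 + ∑_{α > 0} k_α (1 + e^{-α}) / (1 - e^{-α}) ∂_α`. -/
def laplace {n : ℕ} (k : Mult) (u : (Fin n → ℝ) → ℂ) (x : Fin n → ℝ) : ℂ :=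
  ∑ j, lineDeriv ℝ (fun y => lineDeriv ℝ u y (Pi.single j 1)) x (Pi.single j 1) +
    ∑ α ∈ posRoots n,
      rootMult k α * (((1 + Real.exp (-pair α x)) / (1 - Real.exp (-pair α x)) : ℝ) : ℂ) *
        lineDeriv ℝ u x (fun i => (α i : ℝ))

/-- `u` is, on the positive chamber, a solution of
`L(k) u = ((l, l) - (ρ(k), ρ(k))) u` of the form `∑_{μ ∈ Q} Γ_μ a^{l - ρ(k) - μ}`, `Γ_0 = 1`. -/
structure IsHarishChandraSeries {n : ℕ} (k : Mult) (l : Fin n → ℂ)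
    (u : (Fin n → ℝ) → ℂ) : Prop where
  contDiffOn : ContDiffOn ℝ 2 u (chamber n)
  eigen : ∀ x ∈ chamber n,
    laplace k u x = (∑ i, l i ^ 2 - ∑ i, rho n k i ^ 2) * u x
  expansion : ∃ Γ : rootCone n → ℂ, Γ 0 = 1 ∧ ∀ x ∈ chamber n,
    HasSum (fun μ : rootCone n =>
      Γ μ * Complex.exp (∑ i, (l i - rho n k i - ((μ : Fin n → ℤ) i : ℂ)) * (x i : ℂ))) (u x)

/-- The Harish-Chandra series `Φ(l, k; ·)`. It is only used for `l` such that
`(μ, μ) ≠ 2 (l, μ)` for all nonzero `μ ∈ Q`, and on the positive chamber, where it is unique. -/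
def hcSeries {n : ℕ} (k : Mult) (l : Fin n → ℂ) : (Fin n → ℝ) → ℂ :=
  Classical.epsilon (IsHarishChandraSeries k l)

/-- The Weyl group of type `BC_n`: sign changes and permutations. -/
abbrev Weyl (n : ℕ) := (Fin n → ℤˣ) × Equiv.Perm (Fin n)

/-- `(ε, σ) (v_1, …, v_n) = (ε_1 v_{σ(1)}, …, ε_n v_{σ(n)})`. -/
def act {n : ℕ} {R : Type*} [CommRing R] (w : Weyl n) (v : Fin n → R) : Fin n → R :=
  fun i => ((w.1 i : ℤ) : R) * v (w.2 i)

/-- The product of Gamma quotients `c̃(l, k)`. -/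
def cTilde {n : ℕ} (k : Mult) (l : Fin n → ℂ) : ℂ :=
  ∏ α ∈ posRoots n,
    Complex.Gamma (corootPair l α + halfRootMult k α / 2) /
      Complex.Gamma (corootPair l α + halfRootMult k α / 2 + rootMult k α)

/-- No Gamma function in the numerator of `c̃(l, k)` is evaluated at a pole. -/
def NoPole {n : ℕ} (k : Mult) (l : Fin n → ℂ) : Prop :=
  ∀ α ∈ posRoots n, ∀ m : ℕ, corootPair l α + halfRootMult k α / 2 ≠ -(m : ℂ)

/-- The value at `k` of the meromorphic function `k ↦ c̃(ρ(k), k)`; removable singularities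
(for instance at `k_m = 0`) are filled in by continuity. -/
def cTildeRho (n : ℕ) (k : Mult) : ℂ :=
  extendFrom {k' : Mult | NoPole k' (rho n k')} (fun k' => cTilde k' (rho n k')) k

/-- The `c`-function `c(l, k) = c̃(l, k) / c̃(ρ(k), k)`. -/
def cFun {n : ℕ} (k : Mult) (l : Fin n → ℂ) : ℂ :=
  cTilde k l / cTildeRho n k

/-- The spectral parameters `l` for which every term of `∑_w c(w l, k) Φ(w l, k; ·)` is defined. -/
def genericParams (n : ℕ) (k : Mult) : Set (Fin n → ℂ) :=
  {l | ∀ w : Weyl n,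
    (∀ μ ∈ rootCone n, μ ≠ 0 → -2 * pair μ (act w l) + ((pair μ μ : ℤ) : ℂ) ≠ 0) ∧
      NoPole k (act w l)}

/-- The regular elements of `E`: those in some Weyl chamber. -/
def regularElements (n : ℕ) : Set (Fin n → ℝ) :=
  {x | ∃ w : Weyl n, act w x ∈ chamber n}

open Classical in
/-- The element of the positive chamber that is conjugate to the regular element `x`. -/
def toChamber {n : ℕ} (x : Fin n → ℝ) : Fin n → ℝ :=
  if h : ∃ w : Weyl n, act w x ∈ chamber n then act h.choose x else x

/-- `F(l, k; a) = ∑_{w ∈ W} c(w l, k) Φ(w l, k; a)`, `log a = x`, for generic `l` and regular `x`,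
extended from the positive chamber to the other chambers by invariance under the Weyl group. -/
def hypergeometricGeneric {n : ℕ} (k : Mult) (l : Fin n → ℂ) (x : Fin n → ℝ) : ℂ :=
  ∑ w : Weyl n, cFun k (act w l) * hcSeries k (act w l) (toChamber x)

/-- The hypergeometric function `F(l, k; a)` of type `BC_n`, `log a = x`, for all `l` and `x`:
the continuous extension of the function above. -/
def hypergeometric {n : ℕ} (k : Mult) (l : Fin n → ℂ) (x : Fin n → ℝ) : ℂ :=
  extendFrom (genericParams n k ×ˢ regularElements n)
    (fun p => hypergeometricGeneric k p.1 p.2) (l, x)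

/-- The vector `l` with `(l, 2 e_j) = lam_j`. -/
def spectralParam {n : ℕ} (lam : Fin n → ℂ) : Fin n → ℂ := fun j => lam j / 2

/-- `log a_t = ∑_j 2 t_j e_j`. -/
def logPoint {n : ℕ} (t : Fin n → ℝ) : Fin n → ℝ := fun j => 2 * t j

/-- `Δ_{m,rat}(a_t)`, the product of `α(log a_t)` over the positive middle roots. -/
def deltaRat {n : ℕ} (t : Fin n → ℝ) : ℝ :=
  ∏ α ∈ middleRoots n, pair α (logPoint t)

/-- The Bessel function of the first kind `J_α(z)` (principal branch). -/
def besselJ (α z : ℂ) : ℂ :=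
  (z / 2) ^ α *
    ∑' m : ℕ, (-1) ^ m / ((m.factorial : ℂ) * Complex.Gamma (m + α + 1)) * (z / 2) ^ (2 * m)

/-- The normalized Bessel function `2^α Γ(α + 1) z^{-α} J_α(z)`, for `z ≠ 0`. -/
def normBessel (α z : ℂ) : ℂ :=
  2 ^ α * Complex.Gamma (α + 1) * z ^ (-α) * besselJ α z

/-- The matrix of the normalized Bessel functions at `√-1 lam_i t_j`. -/
def besselMatrix {n : ℕ} (α : ℂ) (lam : Fin n → ℂ) (t : Fin n → ℝ) : Matrix (Fin n) (Fin n) ℂ :=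
  Matrix.of fun i j => normBessel α (Complex.I * lam i * (t j : ℂ))

/-- The constant `2^{2n(n-1)} ∏_{i=1}^{n-1} (α + i)^{n-i} i!`. -/
def constA (n : ℕ) (α : ℂ) : ℂ :=
  2 ^ (2 * n * (n - 1)) *
    ∏ i ∈ Finset.Icc 1 (n - 1), ((α + i) ^ (n - i) * (i.factorial : ℂ))

end BC

end

noncomputable section

namespace BC

/-- The power series with coefficients `g` converges absolutely on the open unit disc. -/
def Tame (g : ℕ → ℂ) : Prop :=
  ∀ r : ℝ, 0 ≤ r → r < 1 → Summable fun m => ‖g m‖ * r ^ m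

/-- The sum of the power series with coefficients `g`. -/
def psum (g : ℕ → ℂ) (z : ℂ) : ℂ := ∑' m, g m * z ^ m

/-- Coefficients of the derivative of a power series. -/
def dcoef (g : ℕ → ℂ) (m : ℕ) : ℂ := (m + 1) * g (m + 1)

/-- Coefficients of `z` times a power series. -/
def xcoef (g : ℕ → ℂ) : ℕ → ℂ
  | 0 => 0
  | m + 1 => g m

theorem tame_of_growth {g : ℕ → ℂ} {e : ℕ → ℝ} (he : Tendsto e atTop (𝓝 1))
    (h : ∀ᶠ m in atTop, ‖g (m + 2)‖ ≤ e m * max ‖g (m + 1)‖ ‖g m‖) : Tame g := by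
  intro r hr0 hr1
  obtain ⟨θ, hθ1, hθr⟩ : ∃ θ : ℝ, 1 < θ ∧ θ * r < 1 := by
    have : Tendsto (fun θ : ℝ => θ * r) (𝓝[>] 1) (𝓝 (1 * r)) :=
      ((continuous_id.mul continuous_const).tendsto 1).mono_left nhdsWithin_le_nhds
    have h1 : ∀ᶠ θ in 𝓝[>] (1 : ℝ), θ * r < 1 := this.eventually_lt_const (by simpa using hr1)
    obtain ⟨θ, h2, h3⟩ := (h1.and self_mem_nhdsWithin).exists
    exact ⟨θ, h3, h2⟩
  obtain ⟨M, hM⟩ := eventually_atTop.1 (h.and (he.eventually_le_const hθ1))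
  set K := max ‖g (M + 1)‖ ‖g M‖
  have hK : ∀ j, ‖g (M + j)‖ ≤ K * θ ^ j ∧ ‖g (M + j + 1)‖ ≤ K * θ ^ (j + 1) := by
    have hK0 : 0 ≤ K := le_max_of_le_left (norm_nonneg _)
    intro j
    induction j with
    | zero =>
      refine ⟨by simp [K], ?_⟩
      calc ‖g (M + 0 + 1)‖ ≤ K := by simp [K]
        _ ≤ K * θ ^ (0 + 1) := le_mul_of_one_le_right hK0 (by simpa using hθ1.le)
    | succ j ih =>
      refine ⟨ih.2, ?_⟩
      have h1 := hM (M + j) (by omega)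
      calc ‖g (M + (j + 1) + 1)‖ ≤ e (M + j) * max ‖g (M + j + 1)‖ ‖g (M + j)‖ := h1.1
        _ ≤ θ * (K * θ ^ (j + 1)) := by
          gcongr
          · exact h1.2
          · refine max_le ih.2 (ih.1.trans ?_)
            gcongr
            · exact hθ1.le
            · omega
        _ = K * θ ^ (j + 1 + 1) := by ring
  rw [← summable_nat_add_iff M]
  refine Summable.of_nonneg_of_le (fun j => by positivity) (fun j => ?_)
    ((summable_geometric_of_lt_one (by positivity : 0 ≤ θ * r) hθr).mul_left (K * r ^ M))
  calc ‖g (j + M)‖ * r ^ (j + M) ≤ (K * θ ^ j) * r ^ (j + M) := by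
        gcongr
        rw [add_comm]; exact (hK j).1
    _ = K * r ^ M * (θ * r) ^ j := by rw [mul_pow, pow_add]; ring

theorem Tame.summable_norm {g : ℕ → ℂ} (hg : Tame g) {z : ℂ} (hz : ‖z‖ < 1) :
    Summable fun m => ‖g m * z ^ m‖ := by
  simpa using hg ‖z‖ (norm_nonneg _) hz

theorem Tame.hasSum {g : ℕ → ℂ} (hg : Tame g) {z : ℂ} (hz : ‖z‖ < 1) :
    HasSum (fun m => g m * z ^ m) (psum g z) :=
  (hg.summable_norm hz).of_norm.hasSum

theorem Tame.add {g h : ℕ → ℂ} (hg : Tame g) (hh : Tame h) : Tame (g + h) := by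
  intro r h0 h1
  refine Summable.of_nonneg_of_le (fun m => by positivity) (fun m => ?_)
    ((hg r h0 h1).add (hh r h0 h1))
  rw [← add_mul]
  gcongr
  exact norm_add_le _ _

theorem Tame.smul {g : ℕ → ℂ} (c : ℂ) (hg : Tame g) : Tame (c • g) := by
  intro r h0 h1
  simpa [mul_assoc] using (hg r h0 h1).mul_left ‖c‖

theorem Tame.xcoef {g : ℕ → ℂ} (hg : Tame g) : Tame (xcoef g) := by
  intro r h0 h1
  rw [← summable_nat_add_iff 1]
  refine ((hg r h0 h1).mul_left r).congr fun m => ?_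
  simp only [BC.xcoef]
  ring

theorem Tame.dcoef {g : ℕ → ℂ} (hg : Tame g) : Tame (dcoef g) := by
  intro r h0 h1
  obtain ⟨R, hrR, hR1⟩ := exists_between h1
  have hR0 : 0 < R := h0.trans_lt hrR
  have hq : r / R < 1 := (div_lt_one hR0).2 hrR
  have h2 : Tendsto (fun m : ℕ => ((m : ℝ) + 1) * (r / R) ^ m) atTop (𝓝 0) := by
    have := (tendsto_self_mul_const_pow_of_lt_one (by positivity) hq).add
      (tendsto_pow_atTop_nhds_zero_of_lt_one (by positivity) hq)
    simpa [add_mul] using this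
  obtain ⟨K, hK⟩ := h2.bddAbove_range
  have h3 := ((summable_nat_add_iff 1).2 (hg R hR0.le hR1)).mul_left (K / R)
  refine Summable.of_nonneg_of_le (fun m => by positivity) (fun m => ?_) h3
  have h4 : ((m : ℝ) + 1) * (r / R) ^ m ≤ K := hK ⟨m, rfl⟩
  have h5 : ‖BC.dcoef g m‖ = ((m : ℝ) + 1) * ‖g (m + 1)‖ := by
    rw [BC.dcoef, norm_mul]
    congr 1
    have : ((m : ℂ) + 1) = ((m + 1 : ℕ) : ℂ) := by push_cast; rfl
    rw [this, Complex.norm_natCast]; push_cast; rfl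
  calc ‖BC.dcoef g m‖ * r ^ m = ‖g (m + 1)‖ * R ^ m * (((m : ℝ) + 1) * (r / R) ^ m) := by
        rw [h5, div_pow]; field_simp
    _ ≤ ‖g (m + 1)‖ * R ^ m * K := by gcongr
    _ = K / R * (‖g (m + 1)‖ * R ^ (m + 1)) := by rw [pow_succ]; field_simp

theorem psum_add {g h : ℕ → ℂ} (hg : Tame g) (hh : Tame h) {z : ℂ} (hz : ‖z‖ < 1) :
    psum (g + h) z = psum g z + psum h z := by
  refine ((hg.add hh).hasSum hz).unique ?_
  simpa [add_mul] using (hg.hasSum hz).add (hh.hasSum hz)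

theorem psum_smul {g : ℕ → ℂ} (c z : ℂ) : psum (c • g) z = c * psum g z := by
  simp only [psum, Pi.smul_apply, smul_eq_mul, mul_assoc, tsum_mul_left]

theorem psum_xcoef {g : ℕ → ℂ} (hg : Tame g) {z : ℂ} (hz : ‖z‖ < 1) :
    psum (xcoef g) z = z * psum g z := by
  refine (hg.xcoef.hasSum hz).unique ?_
  rw [← hasSum_nat_add_iff' 1]
  simpa [xcoef, pow_succ, mul_comm, mul_assoc, mul_left_comm] using (hg.hasSum hz).mul_left z

theorem Tame.hasDerivAt {g : ℕ → ℂ} (hg : Tame g) {z : ℂ} (hz : ‖z‖ < 1) :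
    HasDerivAt (psum g) (psum (BC.dcoef g) z) z := by
  obtain ⟨r, hzr, hr1⟩ := exists_between hz
  have hr0 : 0 ≤ r := (norm_nonneg z).trans hzr.le
  have hu : Summable fun m : ℕ => ‖g m‖ * (m * r ^ (m - 1)) := by
    rw [← summable_nat_add_iff 1]
    refine (hg.dcoef r hr0 hr1).congr fun m => ?_
    have : ((m : ℂ) + 1) = ((m + 1 : ℕ) : ℂ) := by push_cast; rfl
    rw [BC.dcoef, norm_mul, this, Complex.norm_natCast]
    simp only [Nat.add_sub_cancel]
    ring
  have key := hasDerivAt_tsum_of_isPreconnected (𝕜 := ℂ)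
    (g := fun (m : ℕ) (y : ℂ) => g m * y ^ m)
    (g' := fun (m : ℕ) (y : ℂ) => g m * (m * y ^ (m - 1))) hu Metric.isOpen_ball
    (convex_ball (0 : ℂ) r).isPreconnected
    (fun m y _ => (hasDerivAt_pow m y).const_mul (g m))
    (fun m y hy => by
      rw [norm_mul, norm_mul, Complex.norm_natCast, norm_pow]
      gcongr
      exact (mem_ball_zero_iff.1 hy).le)
    (Metric.mem_ball_self ((norm_nonneg z).trans_lt hzr)) (hg.hasSum (by simp)).summable
    (mem_ball_zero_iff.2 hzr)
  convert! key using 1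
  refine ((hg.dcoef).hasSum hz).unique ?_
  have hs : Summable fun m : ℕ => g m * (m * z ^ (m - 1)) :=
    Summable.of_norm_bounded hu fun m => by
      rw [norm_mul, norm_mul, Complex.norm_natCast, norm_pow]
      gcongr
  have h1 := (hasSum_nat_add_iff' 1).2 hs.hasSum
  simp only [Finset.range_one, Finset.sum_singleton, Nat.cast_zero, zero_mul, mul_zero,
    sub_zero] at h1
  refine h1.congr_fun fun m => ?_
  simp only [BC.dcoef, Nat.add_sub_cancel]
  push_cast
  ring

theorem Tame.differentiableOn {g : ℕ → ℂ} (hg : Tame g) :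
    DifferentiableOn ℂ (psum g) (Metric.ball 0 1) := fun _ hz =>
  (hg.hasDerivAt (mem_ball_zero_iff.1 hz)).differentiableAt.differentiableWithinAt

theorem Tame.analyticAt {g : ℕ → ℂ} (hg : Tame g) {z : ℂ} (hz : ‖z‖ < 1) :
    AnalyticAt ℂ (psum g) z :=
  hg.differentiableOn.analyticAt (Metric.isOpen_ball.mem_nhds (mem_ball_zero_iff.2 hz))

theorem psum_zero (g : ℕ → ℂ) : psum g 0 = g 0 := by
  rw [psum, tsum_eq_single 0]
  · simp
  · intro m hm; simp [hm]

/-- Coefficients of the Gauss hypergeometric series. -/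
def gaussCoef (A B C : ℂ) (m : ℕ) : ℂ :=
  ∏ j ∈ Finset.range m, ((A + j) * (B + j)) / ((C + j) * (1 + j))

/-- The Gauss hypergeometric function on the unit disc. -/
def gaussF (A B C z : ℂ) : ℂ := psum (gaussCoef A B C) z

theorem gaussCoef_zero (A B C : ℂ) : gaussCoef A B C 0 = 1 := by simp [gaussCoef]

theorem gaussCoef_succ (A B C : ℂ) (m : ℕ) :
    gaussCoef A B C (m + 1) =
      gaussCoef A B C m * (((A + m) * (B + m)) / ((C + m) * (1 + m))) :=
  Finset.prod_range_succ _ _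

theorem tendsto_add_nat_div (a : ℂ) : Tendsto (fun m : ℕ => (a + m) / m) atTop (𝓝 1) := by
  have h : Tendsto (fun m : ℕ => a * (m : ℂ)⁻¹ + 1) atTop (𝓝 (a * 0 + 1)) :=
    (tendsto_const_nhds.mul tendsto_inv_atTop_nhds_zero_nat).add tendsto_const_nhds
  rw [mul_zero, zero_add] at h
  refine h.congr' ?_
  filter_upwards [eventually_ne_atTop 0] with m hm
  have : (m : ℂ) ≠ 0 := by exact_mod_cast hm
  field_simp

theorem tendsto_gauss_ratio (A B C : ℂ) :
    Tendsto (fun m : ℕ => ((A + m) * (B + m)) / ((C + m) * (1 + m))) atTop (𝓝 1) := by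
  have h := ((tendsto_add_nat_div A).mul (tendsto_add_nat_div B)).div
    ((tendsto_add_nat_div C).mul (tendsto_add_nat_div 1)) (by simp)
  simp only [mul_one, div_one] at h
  refine h.congr' ?_
  filter_upwards [eventually_ne_atTop 0] with m hm
  have : (m : ℂ) ≠ 0 := by exact_mod_cast hm
  simp only [Pi.div_apply]
  rw [div_mul_div_comm, div_mul_div_comm, div_div_div_cancel_right₀ (by positivity)]

theorem tame_of_ratio {g : ℕ → ℂ} {e : ℕ → ℂ} (he : Tendsto e atTop (𝓝 1))
    (h : ∀ m, g (m + 1) = g m * e m) : Tame g := by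
  have h1 : Tendsto (fun m => ‖e (m + 1)‖) atTop (𝓝 1) := by
    simpa using ((tendsto_add_atTop_iff_nat 1).2 he).norm
  refine tame_of_growth h1 (Eventually.of_forall fun m => ?_)
  rw [h (m + 1), norm_mul, mul_comm]
  gcongr
  exact le_max_left _ _

theorem tame_gaussCoef (A B C : ℂ) : Tame (gaussCoef A B C) :=
  tame_of_ratio (tendsto_gauss_ratio A B C) (gaussCoef_succ A B C)

/-- The parameter is not a pole of the Gamma function. -/
def NotPole (C : ℂ) : Prop := ∀ m : ℕ, C ≠ -(m : ℂ)

theorem NotPole.add_ne {C : ℂ} (h : NotPole C) (m : ℕ) : C + m ≠ 0 := fun h0 =>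
  h m (eq_neg_of_add_eq_zero_left h0)

theorem NotPole.ne_zero {C : ℂ} (h : NotPole C) : C ≠ 0 := by simpa using h 0

theorem NotPole.add_one {C : ℂ} (h : NotPole C) : NotPole (C + 1) := fun m h0 =>
  h (m + 1) (by push_cast; linear_combination h0)

/-- The derivative of the hypergeometric function. -/
def gaussF' (A B C z : ℂ) : ℂ := psum (dcoef (gaussCoef A B C)) z

/-- The second derivative of the hypergeometric function. -/
def gaussF'' (A B C z : ℂ) : ℂ := psum (dcoef (dcoef (gaussCoef A B C))) z

theorem hasDerivAt_gaussF (A B C : ℂ) {z : ℂ} (hz : ‖z‖ < 1) :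
    HasDerivAt (gaussF A B C) (gaussF' A B C z) z :=
  (tame_gaussCoef A B C).hasDerivAt hz

theorem hasDerivAt_gaussF' (A B C : ℂ) {z : ℂ} (hz : ‖z‖ < 1) :
    HasDerivAt (gaussF' A B C) (gaussF'' A B C z) z :=
  (tame_gaussCoef A B C).dcoef.hasDerivAt hz

theorem gaussF_zero (A B C : ℂ) : gaussF A B C 0 = 1 := by
  rw [gaussF, psum_zero, gaussCoef_zero]

theorem one_add_nat_ne_zero (m : ℕ) : (1 : ℂ) + m ≠ 0 := by
  rw [add_comm]; exact Nat.cast_add_one_ne_zero m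

theorem gaussCoef_succ_mul {A B C : ℂ} (hC : NotPole C) (m : ℕ) :
    (m + 1) * gaussCoef A B C (m + 1) * (C + m) = (A + m) * (B + m) * gaussCoef A B C m := by
  have h1 := hC.add_ne m
  have h2 := one_add_nat_ne_zero m
  rw [gaussCoef_succ]
  field_simp
  ring

theorem gaussF_ode {A B C : ℂ} (hC : NotPole C) {z : ℂ} (hz : ‖z‖ < 1) :
    z * (1 - z) * gaussF'' A B C z + (C - (A + B + 1) * z) * gaussF' A B C z -
      A * B * gaussF A B C z = 0 := by
  set g := gaussCoef A B C with hg
  have t0 : Tame g := tame_gaussCoef A B C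
  have t1 := t0.dcoef
  have t2 := t1.dcoef
  have key : xcoef (dcoef (dcoef g)) + (-1 : ℂ) • xcoef (xcoef (dcoef (dcoef g))) +
      C • dcoef g + (-(A + B + 1)) • xcoef (dcoef g) + (-(A * B)) • g = 0 := by
    funext m
    have h := fun m => gaussCoef_succ_mul (A := A) (B := B) hC m
    simp only [← hg] at h
    rcases m with _ | _ | m
    · have := h 0
      simp [xcoef, dcoef] at this ⊢
      linear_combination this
    · have := h 1
      simp [xcoef, dcoef] at this ⊢
      linear_combination this
    · have := h (m + 2)
      simp [xcoef, dcoef] at this ⊢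
      linear_combination this
  have h1 : psum (xcoef (dcoef (dcoef g)) + (-1 : ℂ) • xcoef (xcoef (dcoef (dcoef g))) +
      C • dcoef g + (-(A + B + 1)) • xcoef (dcoef g) + (-(A * B)) • g) z = 0 := by
    rw [key]; simp [psum]
  rw [psum_add _ (t0.smul _) hz, psum_add _ (t1.xcoef.smul _) hz, psum_add _ (t1.smul _) hz,
    psum_add t2.xcoef (t2.xcoef.xcoef.smul _) hz] at h1
  · simp only [psum_smul, psum_xcoef t2.xcoef hz, psum_xcoef t2 hz, psum_xcoef t1 hz] at h1
    simp only [gaussF, gaussF', gaussF'', ← hg]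
    linear_combination h1
  · exact t2.xcoef.add (t2.xcoef.xcoef.smul _)
  · exact (t2.xcoef.add (t2.xcoef.xcoef.smul _)).add (t1.smul _)
  · exact ((t2.xcoef.add (t2.xcoef.xcoef.smul _)).add (t1.smul _)).add (t1.xcoef.smul _)

theorem gaussCoef_shift {A B C : ℂ} (hC : NotPole C) (m : ℕ) :
    C * gaussCoef A B C m = (C + m) * gaussCoef A B (C + 1) m := by
  induction m with
  | zero => simp [gaussCoef_zero]
  | succ m ih =>
    have h1 := hC.add_ne m
    have h2 := one_add_nat_ne_zero m
    have h3 := hC.add_one.add_ne m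
    rw [gaussCoef_succ, gaussCoef_succ, ← mul_assoc, ih]
    push_cast
    have h4 : C + (m + 1) ≠ 0 := by convert h3 using 1; ring
    rw [show C + 1 + (m : ℂ) = C + (m + 1) by ring]
    field_simp

theorem gaussF_lower {A B C : ℂ} (hC : NotPole C) {z : ℂ} (hz : ‖z‖ < 1) :
    C * gaussF A B C z = C * gaussF A B (C + 1) z + z * gaussF' A B (C + 1) z := by
  have t0 := tame_gaussCoef A B (C + 1)
  rw [gaussF, gaussF, gaussF', ← psum_smul, ← psum_smul, ← psum_xcoef t0.dcoef hz,
    ← psum_add (t0.smul _) t0.dcoef.xcoef hz]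
  congr 1
  funext m
  have := gaussCoef_shift (A := A) (B := B) hC m
  rcases m with _ | m
  · simpa [xcoef] using this
  · simp [xcoef, dcoef] at this ⊢
    linear_combination this

theorem gaussF_raise {A B D : ℂ} (hD : NotPole D) {z : ℂ} (hz : ‖z‖ < 1) :
    D * ((1 - z) * gaussF' A B D z - (A + B - D) * gaussF A B D z) =
      (D - A) * (D - B) * gaussF A B (D + 1) z := by
  have t0 := tame_gaussCoef A B D
  have key : D • (dcoef (gaussCoef A B D) + (-1 : ℂ) • xcoef (dcoef (gaussCoef A B D)) +
      (-(A + B - D)) • gaussCoef A B D) = ((D - A) * (D - B)) • gaussCoef A B (D + 1) := by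
    funext m
    have h1 := gaussCoef_shift (A := A) (B := B) hD m
    have h2 := gaussCoef_succ_mul (A := A) (B := B) hD m
    have h3 := hD.add_ne m
    refine mul_right_cancel₀ h3 ?_
    rcases m with _ | m <;>
    · simp only [xcoef, dcoef, Pi.add_apply, Pi.smul_apply, smul_eq_mul] at h1 h2 ⊢
      push_cast at h1 h2 ⊢
      linear_combination D * h2 + (D - A) * (D - B) * h1
  have h1 := congrArg (fun g => psum g z) key
  simp only [psum_smul] at h1
  rw [psum_add (t0.dcoef.add (t0.dcoef.xcoef.smul _)) (t0.smul _) hz,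
    psum_add t0.dcoef (t0.dcoef.xcoef.smul _) hz, psum_smul, psum_smul,
    psum_xcoef t0.dcoef hz] at h1
  simp only [gaussF, gaussF']
  linear_combination h1

theorem gaussCoef_shift_all {a b c : ℂ} (hc : NotPole c) (m : ℕ) :
    a * b * gaussCoef (a + 1) (b + 1) (c + 1) m = c * ((m + 1) * gaussCoef a b c (m + 1)) := by
  induction m with
  | zero =>
    have h := hc.ne_zero
    simp [gaussCoef_zero, gaussCoef_succ]
    field_simp
  | succ m ih =>
    have h1 := one_add_nat_ne_zero m
    have h2 := one_add_nat_ne_zero (m + 1)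
    have h3 := hc.add_one.add_ne m
    rw [gaussCoef_succ _ _ _ m, ← mul_assoc, ih, gaussCoef_succ _ _ _ (m + 1)]
    push_cast at h2 ⊢
    have h4 : c + (m + 1) ≠ 0 := by convert h3 using 1; ring
    rw [show c + 1 + (m : ℂ) = c + (m + 1) by ring]
    field_simp
    ring

theorem gaussCoef_lower_all {a b c : ℂ} (hc : NotPole c) (m : ℕ) :
    m * gaussCoef (a + 1) (b + 1) (c + 1) m + c * gaussCoef (a + 1) (b + 1) (c + 1) m -
      (match m with
        | 0 => 0
        | k + 1 => (k + a + b + 1) * gaussCoef (a + 1) (b + 1) (c + 1) k) =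
      c * gaussCoef a b c m := by
  induction m with
  | zero => simp [gaussCoef_zero]
  | succ m ih =>
    clear ih
    have h1 := one_add_nat_ne_zero m
    have h3 := hc.add_one.add_ne m
    have h4 : c + (m + 1) ≠ 0 := by convert h3 using 1; ring
    have h5 : ∀ m : ℕ, gaussCoef a b c (m + 1) * ((m : ℂ) + 1) * c = a * b * gaussCoef (a + 1) (b + 1) (c + 1) m := by
      intro m
      linear_combination -gaussCoef_shift_all (a := a) (b := b) hc m
    have h6 : (m : ℂ) + 1 ≠ 0 := by rwa [add_comm]
    rw [← mul_left_inj' h6]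
    have h7 := h5 m
    rw [gaussCoef_succ]
    push_cast
    rw [show c + 1 + (m : ℂ) = c + (m + 1) by ring, show (1 : ℂ) + m = m + 1 by ring]
    field_simp
    linear_combination (-(c + m + 1)) * h7

theorem gaussF_lower_all {a b c : ℂ} (hc : NotPole c) {z : ℂ} (hz : ‖z‖ < 1) :
    z * (1 - z) * gaussF' (a + 1) (b + 1) (c + 1) z +
      (c - (a + b + 1) * z) * gaussF (a + 1) (b + 1) (c + 1) z = c * gaussF a b c z := by
  set g := gaussCoef (a + 1) (b + 1) (c + 1) with hg
  have t0 : Tame g := tame_gaussCoef _ _ _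
  have t1 := t0.dcoef
  have key : xcoef (dcoef g) + (-1 : ℂ) • xcoef (xcoef (dcoef g)) + c • g +
      (-(a + b + 1)) • xcoef g = c • gaussCoef a b c := by
    funext m
    have h := gaussCoef_lower_all (a := a) (b := b) hc m
    simp only [← hg] at h
    rcases m with _ | _ | m <;>
    · simp only [xcoef, dcoef, Pi.add_apply, Pi.smul_apply, smul_eq_mul] at h ⊢
      push_cast at h ⊢
      linear_combination h
  have h1 := congrArg (fun g => psum g z) key
  simp only [psum_smul] at h1
  rw [psum_add ((t1.xcoef.add (t1.xcoef.xcoef.smul _)).add (t0.smul _)) (t0.xcoef.smul _) hz,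
    psum_add (t1.xcoef.add (t1.xcoef.xcoef.smul _)) (t0.smul _) hz,
    psum_add t1.xcoef (t1.xcoef.xcoef.smul _) hz] at h1
  simp only [psum_smul, psum_xcoef t1.xcoef hz, psum_xcoef t1 hz, psum_xcoef t0 hz] at h1
  simp only [gaussF, gaussF', ← hg]
  linear_combination h1

/-- `y`, with derivative `y'`, solves `y'' + p y' + q y = 0` on `I`. -/
structure IsSol (p q : ℝ → ℂ) (I : Set ℝ) (y y' : ℝ → ℂ) : Prop where
  deriv_one : ∀ x ∈ I, HasDerivAt y (y' x) x
  deriv_two : ∀ x ∈ I, HasDerivAt y' (-(p x * y' x) - q x * y x) x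

section Wronskian

variable {p q P : ℝ → ℂ} {I : Set ℝ} {y y' z z' u u' : ℝ → ℂ}

theorem IsSol.exists_wronskian (hI : IsOpen I) (hI' : IsPreconnected I) (hy : IsSol p q I y y')
    (hz : IsSol p q I z z') (hP : ∀ x ∈ I, HasDerivAt P (p x * P x) x) :
    ∃ κ : ℂ, ∀ x ∈ I, P x * (y x * z' x - y' x * z x) = κ := by
  have hd : ∀ x ∈ I, HasDerivAt (fun x => P x * (y x * z' x - y' x * z x)) 0 x := by
    intro x hx
    have h := (hP x hx).mul (((hy.deriv_one x hx).mul (hz.deriv_two x hx)).sub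
      ((hy.deriv_two x hx).mul (hz.deriv_one x hx)))
    simp only [Pi.mul_apply, Pi.sub_apply] at h
    convert! h using 1
    ring
  exact hI.exists_is_const_of_deriv_eq_zero hI'
    (fun x hx => (hd x hx).differentiableAt.differentiableWithinAt)
    fun x hx => (hd x hx).deriv

theorem wronskian_three_term {κ₁₂ κ₁₃ κ₂₃ : ℂ} {x : ℝ}
    (h₁₂ : P x * (y x * z' x - y' x * z x) = κ₁₂) (h₁₃ : P x * (y x * u' x - y' x * u x) = κ₁₃)
    (h₂₃ : P x * (z x * u' x - z' x * u x) = κ₂₃) :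
    y x * κ₂₃ - z x * κ₁₃ + u x * κ₁₂ = 0 := by
  rw [← h₁₂, ← h₁₃, ← h₂₃]
  ring

theorem IsSol.exists_combination (hI : IsOpen I) (hI' : IsPreconnected I) (hy : IsSol p q I y y')
    (hz : IsSol p q I z z') (hu : IsSol p q I u u') (hP : ∀ x ∈ I, HasDerivAt P (p x * P x) x)
    {κ : ℂ} (hκ : κ ≠ 0)
    (h : ∀ x ∈ I, P x * (y x * z' x - y' x * z x) = κ) :
    ∃ a b : ℂ, ∀ x ∈ I, u x = a * y x + b * z x := by
  obtain ⟨κ₁₃, h₁₃⟩ := hy.exists_wronskian hI hI' hu hP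
  obtain ⟨κ₂₃, h₂₃⟩ := hz.exists_wronskian hI hI' hu hP
  refine ⟨-κ₂₃ / κ, κ₁₃ / κ, fun x hx => ?_⟩
  have := wronskian_three_term (h x hx) (h₁₃ x hx) (h₂₃ x hx)
  field_simp
  linear_combination this

theorem IsSol.combination_unique (hI : IsOpen I) (hy : IsSol p q I y y') (hz : IsSol p q I z z')
    {κ : ℂ} (hκ : κ ≠ 0)
    (h : ∀ x ∈ I, P x * (y x * z' x - y' x * z x) = κ) (hne : I.Nonempty) {a b a' b' : ℂ}
    (hab : ∀ x ∈ I, a * y x + b * z x = a' * y x + b' * z x) : a = a' ∧ b = b' := by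
  obtain ⟨x, hx⟩ := hne
  have h1 := hab x hx
  have h2 : a * y' x + b * z' x = a' * y' x + b' * z' x := by
    have e1 := ((hy.deriv_one x hx).const_mul a).add ((hz.deriv_one x hx).const_mul b)
    have e2 := ((hy.deriv_one x hx).const_mul a').add ((hz.deriv_one x hx).const_mul b')
    refine e1.unique (e2.congr_of_eventuallyEq ?_)
    filter_upwards [hI.mem_nhds hx] with t ht using hab t ht
  have h3 := h x hx
  have hW : y x * z' x - y' x * z x ≠ 0 := fun h0 => hκ (by rw [← h3, h0, mul_zero])
  constructor
  · rw [← sub_eq_zero]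
    refine (mul_eq_zero.1 ?_).resolve_right hW
    linear_combination z' x * h1 - z x * h2
  · rw [← sub_eq_zero]
    refine (mul_eq_zero.1 ?_).resolve_right hW
    linear_combination y x * h2 - y' x * h1

theorem IsSol.exists_eq_mul (hI : IsOpen I) (hI' : IsPreconnected I) (hy : IsSol p q I y y')
    (hz : IsSol p q I z z') (hP : ∀ x ∈ I, HasDerivAt P (p x * P x) x)
    {κ : ℂ} (hκ : κ ≠ 0)
    (h : ∀ x ∈ I, P x * (y x * z' x - y' x * z x) = κ) {v v' : ℝ → ℂ} (hu : IsSol p q I u u')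
    (hv : IsSol p q I v v') (hW : ∀ x ∈ I, P x * (u x * v' x - u' x * v x) = 0)
    (hne : ∃ x ∈ I, u x ≠ 0) : ∃ c : ℂ, ∀ x ∈ I, v x = c * u x := by
  obtain ⟨κ₁, h₁⟩ := hu.exists_wronskian hI hI' hy hP
  obtain ⟨κ₂, h₂⟩ := hu.exists_wronskian hI hI' hz hP
  obtain ⟨μ₁, g₁⟩ := hv.exists_wronskian hI hI' hy hP
  obtain ⟨μ₂, g₂⟩ := hv.exists_wronskian hI hI' hz hP
  by_cases hκ₁ : κ₁ = 0
  · by_cases hκ₂ : κ₂ = 0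
    · obtain ⟨x, hx, hx0⟩ := hne
      have := wronskian_three_term (h₁ x hx) (h₂ x hx) (h x hx)
      rw [hκ₁, hκ₂] at this
      simp [hx0, hκ] at this
    · refine ⟨μ₂ / κ₂, fun x hx => ?_⟩
      have := wronskian_three_term (hW x hx) (h₂ x hx) (g₂ x hx)
      field_simp
      linear_combination -this
  · refine ⟨μ₁ / κ₁, fun x hx => ?_⟩
    have := wronskian_three_term (hW x hx) (h₁ x hx) (g₁ x hx)
    field_simp
    linear_combination -this

end Wronskian

theorem eq_zero_of_tendsto_cpow {σ L : ℂ} (hL : L ≠ 0)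
    (h : Tendsto (fun x : ℝ => (x : ℂ) ^ σ) (𝓝[>] 0) (𝓝 L)) : σ = 0 := by
  have h1 : ∀ u : ℝ, Complex.exp (u * σ) = 1 := by
    intro u
    have hc : 0 < Real.exp u := Real.exp_pos u
    have ht : Tendsto (fun x : ℝ => Real.exp u * x) (𝓝[>] 0) (𝓝[>] 0) := by
      refine tendsto_nhdsWithin_iff.2 ⟨?_, ?_⟩
      · have : Tendsto (fun x : ℝ => Real.exp u * x) (𝓝 0) (𝓝 (Real.exp u * 0)) :=
          (continuous_const.mul continuous_id).tendsto 0
        rw [mul_zero] at this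
        exact this.mono_left nhdsWithin_le_nhds
      · filter_upwards [self_mem_nhdsWithin] with x hx using mul_pos hc hx
    have h2 := h.comp ht
    have h3 : Tendsto (fun x : ℝ => ((Real.exp u : ℝ) : ℂ) ^ σ * (x : ℂ) ^ σ) (𝓝[>] 0)
        (𝓝 (((Real.exp u : ℝ) : ℂ) ^ σ * L)) := h.const_mul _
    have h4 := tendsto_nhds_unique (h2.congr' (by
      filter_upwards [self_mem_nhdsWithin] with x hx
      have hx : 0 < x := hx
      simp only [Function.comp]
      rw [Complex.ofReal_mul, Complex.mul_cpow_ofReal_nonneg hc.le hx.le])) h3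
    have h5 : ((Real.exp u : ℝ) : ℂ) ^ σ = 1 := by
      refine mul_right_cancel₀ hL ?_
      rw [one_mul, ← h4]
    rw [Complex.cpow_def_of_ne_zero (by exact_mod_cast hc.ne'), ← Complex.ofReal_log hc.le,
      Real.log_exp] at h5
    exact h5
  have hd : HasDerivAt (fun u : ℝ => Complex.exp (u * σ)) (Complex.exp ((0 : ℝ) * σ) * (1 * σ)) 0 :=
    ((Complex.ofRealCLM.hasDerivAt (x := (0 : ℝ))).mul_const σ).cexp
  have hd' : HasDerivAt (fun u : ℝ => Complex.exp (u * σ)) 0 0 := by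
    simp only [h1]; exact hasDerivAt_const _ _
  simpa using hd.unique hd'

theorem const_eq_zero_of_analyticAt {h : ℂ → ℂ} (hh : AnalyticAt ℂ h 0) {s κ : ℂ}
    (hs : ∀ m : ℕ, s ≠ m) {p : ℝ → ℂ} {p₀ : ℂ} (hp : Tendsto p (𝓝[>] 0) (𝓝 p₀)) (hp₀ : p₀ ≠ 0)
    (heq : ∀ᶠ x : ℝ in 𝓝[>] 0, h x = κ * (x : ℂ) ^ s * p x) : κ = 0 := by
  by_contra hκ
  have hT : Tendsto (fun x : ℝ => (x : ℂ)) (𝓝[>] 0) (𝓝 0) := by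
    have := (Complex.continuous_ofReal.tendsto 0).mono_left (nhdsWithin_le_nhds (s := Set.Ioi 0))
    simpa using this
  have hpne : ∀ᶠ x : ℝ in 𝓝[>] 0, p x ≠ 0 := hp.eventually_ne hp₀
  by_cases h0 : ∀ᶠ z in 𝓝 (0 : ℂ), h z = 0
  · obtain ⟨x, h1, h2, h3, h4⟩ := ((hT.eventually h0).and (heq.and (hpne.and
      (self_mem_nhdsWithin : ∀ᶠ x : ℝ in 𝓝[>] 0, x ∈ Set.Ioi 0)))).exists
    have hx : (x : ℂ) ≠ 0 := by exact_mod_cast (ne_of_gt h4)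
    rw [h1] at h2
    have h5 : (x : ℂ) ^ s ≠ 0 := by simp [Complex.cpow_eq_zero_iff, hx]
    simp [hκ, h3, h5] at h2
  · obtain ⟨m, g, hg, hg0, hgeq⟩ := hh.exists_eventuallyEq_pow_smul_nonzero_iff.2 h0
    refine hs m (sub_eq_zero.1 (eq_zero_of_tendsto_cpow (L := g 0 / (κ * p₀))
      (div_ne_zero hg0 (mul_ne_zero hκ hp₀)) ?_))
    refine ((hg.continuousAt.tendsto.comp hT).div (hp.const_mul κ)
      (mul_ne_zero hκ hp₀)).congr' ?_
    filter_upwards [hT.eventually hgeq, heq, hpne, self_mem_nhdsWithin] with x h1 h2 h3 h4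
    have hx : (x : ℂ) ≠ 0 := by exact_mod_cast (ne_of_gt h4)
    rw [h2] at h1
    simp only [sub_zero, smul_eq_mul] at h1
    simp only [Pi.div_apply, Function.comp]
    rw [Complex.cpow_sub _ _ hx, Complex.cpow_natCast, div_eq_div_iff (mul_ne_zero hκ h3)
      (pow_ne_zero _ hx)]
    linear_combination -h1

/-- First order coefficient of the hypergeometric equation. -/
def hypP (A B D : ℂ) (w : ℝ) : ℂ := (D - (A + B + 1) * w) / (w * (1 - w))

/-- Zeroth order coefficient of the hypergeometric equation. -/
def hypQ (A B : ℂ) (w : ℝ) : ℂ := -(A * B) / (w * (1 - w))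

/-- Integrating factor of the hypergeometric equation. -/
def hypW (A B D : ℂ) (w : ℝ) : ℂ := (w : ℂ) ^ D * ((1 - w : ℝ) : ℂ) ^ (A + B + 1 - D)

theorem hasDerivAt_ofReal_cpow_const' {w : ℝ} (hw : 0 < w) (s : ℂ) :
    HasDerivAt (fun w : ℝ => (w : ℂ) ^ s) ((w : ℂ) ^ s * (s / w)) w := by
  have hw' : (w : ℂ) ≠ 0 := by exact_mod_cast hw.ne'
  have h := (hasDerivAt_id (w : ℂ)).cpow_const (c := s)
    (Or.inl (by simpa using hw) : (id (w : ℂ)) ∈ Complex.slitPlane)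
  have h2 := h.comp_ofReal
  convert! h2 using 1
  rw [Complex.cpow_sub _ _ (by simpa using hw')]
  simp only [id, Complex.cpow_one, mul_one]
  field_simp

theorem hasDerivAt_one_sub_cpow {w : ℝ} (hw : w < 1) (s : ℂ) :
    HasDerivAt (fun w : ℝ => ((1 - w : ℝ) : ℂ) ^ s)
      (-(((1 - w : ℝ) : ℂ) ^ s * (s / ((1 - w : ℝ) : ℂ)))) w := by
  have h := (hasDerivAt_ofReal_cpow_const' (sub_pos.2 hw) s).scomp w
    ((hasDerivAt_id w).const_sub 1)
  convert! h using 1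
  simp

theorem hasDerivAt_hypW (A B D : ℂ) {w : ℝ} (hw : w ∈ Set.Ioo (0 : ℝ) 1) :
    HasDerivAt (hypW A B D) (hypP A B D w * hypW A B D w) w := by
  have h := (hasDerivAt_ofReal_cpow_const' hw.1 D).mul
    (hasDerivAt_one_sub_cpow hw.2 (A + B + 1 - D))
  convert! h using 1
  have h1 : (w : ℂ) ≠ 0 := by exact_mod_cast hw.1.ne'
  have h2 : (1 - w : ℂ) ≠ 0 := by exact_mod_cast (sub_pos.2 hw.2).ne'
  simp only [hypP, hypW]
  push_cast
  field_simp
  ring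

theorem norm_lt_one_of_mem_Ioo {w : ℝ} (hw : w ∈ Set.Ioo (0 : ℝ) 1) : ‖(w : ℂ)‖ < 1 := by
  rw [Complex.norm_real, Real.norm_of_nonneg hw.1.le]; exact hw.2

theorem one_sub_mem_Ioo {w : ℝ} (hw : w ∈ Set.Ioo (0 : ℝ) 1) : 1 - w ∈ Set.Ioo (0 : ℝ) 1 :=
  ⟨sub_pos.2 hw.2, by linarith [hw.1]⟩

theorem isSol_gaussF {A B D : ℂ} (hD : NotPole D) :
    IsSol (hypP A B D) (hypQ A B) (Set.Ioo 0 1) (fun w => gaussF A B D w)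
      (fun w => gaussF' A B D w) where
  deriv_one w hw := (hasDerivAt_gaussF A B D (norm_lt_one_of_mem_Ioo hw)).comp_ofReal
  deriv_two w hw := by
    have h1 : (w : ℂ) ≠ 0 := by exact_mod_cast hw.1.ne'
    have h2 : (1 - w : ℂ) ≠ 0 := by exact_mod_cast (sub_pos.2 hw.2).ne'
    convert! (hasDerivAt_gaussF' A B D (norm_lt_one_of_mem_Ioo hw)).comp_ofReal using 1
    have := gaussF_ode (A := A) (B := B) hD (norm_lt_one_of_mem_Ioo hw)
    simp only [hypP, hypQ]
    field_simp
    linear_combination -this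

theorem isSol_gaussF_one_sub {A B C D : ℂ} (hC : NotPole C) (hD : D = A + B + 1 - C) :
    IsSol (hypP A B D) (hypQ A B) (Set.Ioo 0 1) (fun w => gaussF A B C ((1 - w : ℝ) : ℂ))
      (fun w => -gaussF' A B C ((1 - w : ℝ) : ℂ)) where
  deriv_one w hw := by
    have h := (hasDerivAt_gaussF A B C
      (norm_lt_one_of_mem_Ioo (one_sub_mem_Ioo hw))).comp_ofReal.scomp w
      ((hasDerivAt_id w).const_sub 1)
    convert! h using 1
    simp
  deriv_two w hw := by
    have h := ((hasDerivAt_gaussF' A B C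
      (norm_lt_one_of_mem_Ioo (one_sub_mem_Ioo hw))).comp_ofReal.scomp w
      ((hasDerivAt_id w).const_sub 1)).neg
    convert! h using 1
    have h1 : (w : ℂ) ≠ 0 := by exact_mod_cast hw.1.ne'
    have h2 : (1 - w : ℂ) ≠ 0 := by exact_mod_cast (sub_pos.2 hw.2).ne'
    have := gaussF_ode (A := A) (B := B) hC (norm_lt_one_of_mem_Ioo (one_sub_mem_Ioo hw))
    simp only [hypP, hypQ, neg_smul, one_smul, neg_neg, hD]
    push_cast at this ⊢
    field_simp
    linear_combination -this

theorem IsSol.cpow_mul {A B s : ℂ} {E E' : ℝ → ℂ}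
    (hE : IsSol (hypP (A + s) (B + s) (1 + s)) (hypQ (A + s) (B + s)) (Set.Ioo 0 1) E E') :
    IsSol (hypP A B (1 - s)) (hypQ A B) (Set.Ioo 0 1) (fun w => (w : ℂ) ^ s * E w)
      (fun w => (w : ℂ) ^ s * (E' w + s / w * E w)) where
  deriv_one w hw := by
    convert! (hasDerivAt_ofReal_cpow_const' hw.1 s).mul (hE.deriv_one w hw) using 1
    ring
  deriv_two w hw := by
    have h1 : (w : ℂ) ≠ 0 := by exact_mod_cast hw.1.ne'
    have h2 : (1 - w : ℂ) ≠ 0 := by exact_mod_cast (sub_pos.2 hw.2).ne'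
    have hi : HasDerivAt (fun w : ℝ => s / (w : ℂ)) (-s / (w : ℂ) ^ 2) w := by
      have := ((hasDerivAt_inv h1).const_mul s).comp_ofReal
      convert! this using 1
      field_simp
    have h := (hasDerivAt_ofReal_cpow_const' hw.1 s).mul ((hE.deriv_two w hw).add
      (hi.mul (hE.deriv_one w hw)))
    simp only [Pi.mul_apply, Pi.add_apply] at h
    convert! h using 1
    simp only [hypP, hypQ]
    field_simp
    ring

/-- The property that `F(A, B; C; 1 - w)` is `κ` times the solution which is regular at `w = 0`
plus a multiple of the other local solution. -/
def HasConnCoeff (A B C κ : ℂ) : Prop :=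
  ∃ κ₂ : ℂ, ∀ w ∈ Set.Ioo (0 : ℝ) 1, gaussF A B C ((1 - w : ℝ) : ℂ) =
    κ * gaussF A B (1 - (C - A - B)) w +
      κ₂ * ((w : ℂ) ^ (C - A - B) * gaussF (C - B) (C - A) (1 + (C - A - B)) w)

/-- The number is not an integer. -/
def NotInt (s : ℂ) : Prop := ∀ m : ℤ, s ≠ m

theorem NotInt.notPole {s : ℂ} (h : NotInt s) : NotPole s := fun m hm =>
  h (-(m : ℤ)) (by rw [hm]; push_cast; rfl)

theorem NotInt.neg {s : ℂ} (h : NotInt s) : NotInt (-s) := fun m hm =>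
  h (-m) (by push_cast; linear_combination -hm)

theorem NotInt.one_add {s : ℂ} (h : NotInt s) : NotInt (1 + s) := fun m hm =>
  h (m - 1) (by push_cast; linear_combination hm)

theorem NotInt.one_sub {s : ℂ} (h : NotInt s) : NotInt (1 - s) := by
  simpa [sub_eq_add_neg] using h.neg.one_add

theorem NotInt.ne_zero {s : ℂ} (h : NotInt s) : s ≠ 0 := by simpa using h 0

theorem isSol_second {A B C : ℂ} (hs : NotInt (C - A - B)) :
    IsSol (hypP A B (1 - (C - A - B))) (hypQ A B) (Set.Ioo 0 1)
      (fun w => (w : ℂ) ^ (C - A - B) * gaussF (C - B) (C - A) (1 + (C - A - B)) w)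
      (fun w => (w : ℂ) ^ (C - A - B) * (gaussF' (C - B) (C - A) (1 + (C - A - B)) w +
        (C - A - B) / w * gaussF (C - B) (C - A) (1 + (C - A - B)) w)) := by
  have h := isSol_gaussF (A := A + (C - A - B)) (B := B + (C - A - B)) hs.one_add.notPole
  have h2 := h.cpow_mul
  rwa [show A + (C - A - B) = C - B by ring, show B + (C - A - B) = C - A by ring] at h2

theorem tendsto_ofReal_nhdsGT_zero : Tendsto (fun x : ℝ => (x : ℂ)) (𝓝[>] 0) (𝓝 0) := by
  have := (Complex.continuous_ofReal.tendsto 0).mono_left (nhdsWithin_le_nhds (s := Set.Ioi 0))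
  simpa using this

theorem tendsto_gaussF_zero (A B C : ℂ) :
    Tendsto (fun w : ℝ => gaussF A B C w) (𝓝[>] 0) (𝓝 1) := by
  have := (hasDerivAt_gaussF A B C (z := 0) (by simp)).continuousAt.tendsto.comp
    tendsto_ofReal_nhdsGT_zero
  rwa [gaussF_zero] at this

theorem eventually_Ioo : ∀ᶠ w : ℝ in 𝓝[>] 0, w ∈ Set.Ioo (0 : ℝ) 1 :=
  Ioo_mem_nhdsGT one_pos

theorem wronskian_gauss {A B C : ℂ} (hs : NotInt (C - A - B)) (w : ℝ)
    (hw : w ∈ Set.Ioo (0 : ℝ) 1) :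
    hypW A B (1 - (C - A - B)) w *
      (gaussF A B (1 - (C - A - B)) w *
        ((w : ℂ) ^ (C - A - B) * (gaussF' (C - B) (C - A) (1 + (C - A - B)) w +
        (C - A - B) / w * gaussF (C - B) (C - A) (1 + (C - A - B)) w)) -
        gaussF' A B (1 - (C - A - B)) w *
        ((w : ℂ) ^ (C - A - B) * gaussF (C - B) (C - A) (1 + (C - A - B)) w)) = C - A - B := by
  set s := C - A - B with hsdef
  have hy := isSol_gaussF (A := A) (B := B) hs.one_sub.notPole
  obtain ⟨κ, hκ⟩ := hy.exists_wronskian isOpen_Ioo (convex_Ioo (0 : ℝ) 1).isPreconnected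
    (isSol_second hs) (fun x hx => hasDerivAt_hypW A B _ hx)
  rw [← hsdef] at hκ
  rw [hκ w hw]
  have hc : ∀ A B D : ℂ, Tendsto (fun w : ℝ => gaussF' A B D w) (𝓝[>] 0) (𝓝 (gaussF' A B D 0)) :=
    fun A B D => (hasDerivAt_gaussF' A B D (z := 0) (by simp)).continuousAt.tendsto.comp
      tendsto_ofReal_nhdsGT_zero
  have hpw : Tendsto (fun w : ℝ => ((1 - w : ℝ) : ℂ) ^ (A + B + s)) (𝓝[>] 0) (𝓝 1) := by
    have := (hasDerivAt_one_sub_cpow (w := 0) (by simp) (A + B + s)).continuousAt.tendsto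
    simp only [sub_zero, Complex.ofReal_one, Complex.one_cpow] at this
    exact this.mono_left nhdsWithin_le_nhds
  have hlim := hpw.mul ((((tendsto_gaussF_zero A B (1 - s)).mul
    (tendsto_gaussF_zero (C - B) (C - A) (1 + s))).const_mul s).add
    (tendsto_ofReal_nhdsGT_zero.mul (((tendsto_gaussF_zero A B (1 - s)).mul
      (hc (C - B) (C - A) (1 + s))).sub ((hc A B (1 - s)).mul
      (tendsto_gaussF_zero (C - B) (C - A) (1 + s))))))
  simp only [mul_one, zero_mul, add_zero, one_mul] at hlim
  refine tendsto_nhds_unique (tendsto_const_nhds.congr' ?_) hlim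
  filter_upwards [eventually_Ioo] with w hw
  rw [← hκ w hw]
  have h1 : (w : ℂ) ≠ 0 := by exact_mod_cast hw.1.ne'
  have h2 : (w : ℂ) ^ s ≠ 0 := by simp [Complex.cpow_eq_zero_iff, h1]
  rw [hypW, Complex.cpow_sub _ _ h1, Complex.cpow_one, show A + B + 1 - (1 - s) = A + B + s by ring]
  field_simp
  ring

theorem HasConnCoeff.unique {A B C κ κ' : ℂ} (hs : NotInt (C - A - B))
    (h : HasConnCoeff A B C κ) (h' : HasConnCoeff A B C κ') : κ = κ' := by
  obtain ⟨a, ha⟩ := h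
  obtain ⟨b, hb⟩ := h'
  exact ((isSol_gaussF (A := A) (B := B) hs.one_sub.notPole).combination_unique isOpen_Ioo
    (isSol_second hs) hs.ne_zero (wronskian_gauss hs)
    ⟨1 / 2, by norm_num⟩ (fun x hx => (ha x hx).symm.trans (hb x hx))).1

theorem exists_hasConnCoeff {A B C : ℂ} (hC : NotPole C) (hs : NotInt (C - A - B)) :
    ∃ κ, HasConnCoeff A B C κ := by
  obtain ⟨a, b, h⟩ := (isSol_gaussF (A := A) (B := B) hs.one_sub.notPole).exists_combination
    isOpen_Ioo (convex_Ioo (0 : ℝ) 1).isPreconnected (isSol_second hs)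
    (isSol_gaussF_one_sub hC (by ring)) (fun x hx => hasDerivAt_hypW A B _ hx)
    hs.ne_zero (wronskian_gauss hs)
  exact ⟨a, b, h⟩

theorem HasConnCoeff.lower {A B C κ : ℂ} (hC : NotPole C) (hs : NotInt (C - A - B))
    (h : HasConnCoeff A B (C + 1) κ) :
    HasConnCoeff A B C (κ * ((C - A) * (C - B) / (C * (C - A - B)))) := by
  obtain ⟨κ₂, h⟩ := h
  set s := C - A - B with hsdef
  have hs1 : NotInt (C + 1 - A - B) := by
    have := hs.one_add
    rwa [show (1 : ℂ) + s = C + 1 - A - B by rw [hsdef]; ring] at this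
  have hC0 := hC.ne_zero
  have hs0 := hs.ne_zero
  refine ⟨-κ₂ * (1 + s) / C, fun w hw => ?_⟩
  have hw1 : (w : ℂ) ≠ 0 := by exact_mod_cast hw.1.ne'
  have e1 := (isSol_gaussF_one_sub (A := A) (B := B) hC.add_one rfl).deriv_one w hw
  have e2 := (((isSol_gaussF (A := A) (B := B) hs1.one_sub.notPole).deriv_one w hw).const_mul
    κ).add (((isSol_second hs1).deriv_one w hw).const_mul κ₂)
  have e3 := e1.unique (e2.congr_of_eventuallyEq (by
    filter_upwards [isOpen_Ioo.mem_nhds hw] with t ht using h t ht))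
  have h0 := h w hw
  have h1 := gaussF_lower (A := A) (B := B) hC (norm_lt_one_of_mem_Ioo (one_sub_mem_Ioo hw))
  have hsm : NotPole (-s) := hs.neg.notPole
  have h2 := gaussF_raise (A := A) (B := B) hsm (norm_lt_one_of_mem_Ioo hw)
  have h3 := gaussF_lower_all (a := C - B) (b := C - A) hs.one_add.notPole
    (norm_lt_one_of_mem_Ioo hw)
  simp only [show C + 1 - A - B = 1 + s by rw [hsdef]; ring] at e3 h0
  simp only [show 1 - (1 + s) = -s by ring, show C + 1 - B = C - B + 1 by ring, show C + 1 - A = C - A + 1 by ring,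
    show (1 : ℂ) + (1 + s) = 1 + s + 1 by ring] at e3 h0
  simp only [show -s + 1 = 1 - s by ring] at h2
  rw [Complex.cpow_add _ _ hw1, Complex.cpow_one] at h0 e3
  rw [h0, neg_eq_iff_eq_neg.1 e3] at h1
  push_cast at h1 ⊢
  refine mul_left_cancel₀ hC0 (h1.trans ?_)
  set X := gaussF A B (-s) w
  set X' := gaussF' A B (-s) w
  set Y := gaussF (C - B + 1) (C - A + 1) (1 + s + 1) w
  set Y' := gaussF' (C - B + 1) (C - A + 1) (1 + s + 1) w
  set V := (w : ℂ) ^ s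
  have h2' : C * X - (1 - w) * X' = (C - A) * (C - B) / s * gaussF A B (1 - s) w := by
    field_simp
    rw [hsdef] at h2 ⊢
    linear_combination h2
  have h3' : C * w * Y - (1 - w) * (w * Y' + (1 + s) * Y) =
      -(1 + s) * gaussF (C - B) (C - A) (1 + s) w := by
    rw [hsdef] at h3 ⊢
    linear_combination -h3
  have e4 : κ * ((C - A) * (C - B) / (C * s)) =
    κ * ((C - A) * (C - B) / s) / C := by field_simp
  rw [e4]
  have : (w : ℂ) * ((1 + s) / w) = 1 + s := by field_simp
  calc _ = κ * (C * X - (1 - w) * X') + κ₂ * V * (C * w * Y - (1 - w) * (w * Y' + (w * ((1 + s) / w)) * Y)) := by ring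
    _ = _ := by rw [this, h2', h3']; simp only [← hsdef]; field_simp

theorem norm_add_natCast_le (A : ℂ) (j : ℕ) : ‖A + j‖ ≤ ‖A‖ + j := by
  simpa using norm_add_le A (j : ℂ)

theorem re_add_natCast_le (C : ℂ) (j : ℕ) : C.re + j ≤ ‖C + j‖ := by
  simpa using Complex.re_le_norm (C + j)

theorem norm_gaussCoef_le {A B C : ℂ} {X : ℝ} (hX : X = ‖A‖ * ‖B‖ + ‖A‖ + ‖B‖ + 1)
    (hC : X + 2 ≤ C.re) (m : ℕ) :
    ‖gaussCoef A B C m‖ ≤ X * (X + 1) / ((X + m) * (X + m + 1)) := by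
  have hX1 : 1 ≤ X := by rw [hX]; have := norm_nonneg A; have := norm_nonneg B; nlinarith
  induction m with
  | zero =>
    rw [gaussCoef_zero, norm_one]
    simp only [Nat.cast_zero, add_zero]
    rw [div_self (by positivity)]
  | succ m ih =>
    have hm : (0 : ℝ) ≤ m := Nat.cast_nonneg m
    have h1 := norm_add_natCast_le A m
    have h2 := norm_add_natCast_le B m
    have h3 : X + 2 + m ≤ ‖C + m‖ := by linarith [re_add_natCast_le C m]
    have h4 : ‖(1 : ℂ) + m‖ = 1 + m := by
      rw [show (1 : ℂ) + m = ((1 + m : ℕ) : ℂ) by push_cast; rfl, Complex.norm_natCast]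
      push_cast; rfl
    have h5 : ‖A + m‖ * ‖B + m‖ ≤ (X + m) * (1 + m) := by
      calc ‖A + m‖ * ‖B + m‖ ≤ (‖A‖ + m) * (‖B‖ + m) := by gcongr
        _ ≤ (X + m) * (1 + m) := by
          rw [hX]; have := norm_nonneg A; have := norm_nonneg B
          nlinarith [mul_nonneg (norm_nonneg A) (norm_nonneg B), mul_nonneg hm (norm_nonneg A),
            mul_nonneg hm (mul_nonneg (norm_nonneg A) (norm_nonneg B))]
    rw [gaussCoef_succ, norm_mul, norm_div, norm_mul, norm_mul, h4]
    calc ‖gaussCoef A B C m‖ * (‖A + m‖ * ‖B + m‖ / (‖C + m‖ * (1 + m)))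
        ≤ X * (X + 1) / ((X + m) * (X + m + 1)) * ((X + m) * (1 + m) / ((X + 2 + m) * (1 + m))) := by
          gcongr
      _ = X * (X + 1) / ((X + (m + 1 : ℕ)) * (X + (m + 1 : ℕ) + 1)) := by
          push_cast
          have : X + m ≠ 0 := by positivity
          have : (1 : ℝ) + m ≠ 0 := by positivity
          have : X + m + 1 ≠ 0 := by positivity
          have : X + 2 + m ≠ 0 := by positivity
          have : X + (m + 1) ≠ 0 := by positivity
          have : X + (m + 1) + 1 ≠ 0 := by positivity
          field_simp
          ring

theorem summable_gauss_majorant {X : ℝ} (hX : 1 ≤ X) :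
    Summable fun m : ℕ => X * (X + 1) / ((X + m) * (X + m + 1)) := by
  have h := ((summable_nat_add_iff 1).2 (Real.summable_one_div_nat_pow.2 one_lt_two)).mul_left
    (X * (X + 1))
  refine Summable.of_nonneg_of_le (fun m => by positivity) (fun m => ?_) h
  rw [mul_one_div]
  push_cast
  gcongr
  have hm : (0 : ℝ) ≤ m := Nat.cast_nonneg m
  nlinarith

theorem tendsto_gaussF_one {A B C : ℂ} {X : ℝ} (hX : X = ‖A‖ * ‖B‖ + ‖A‖ + ‖B‖ + 1)
    (hC : X + 2 ≤ C.re) :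
    Tendsto (fun w : ℝ => gaussF A B C ((1 - w : ℝ) : ℂ)) (𝓝[>] 0)
      (𝓝 (∑' m, gaussCoef A B C m)) := by
  have hX1 : 1 ≤ X := by rw [hX]; have := norm_nonneg A; have := norm_nonneg B; nlinarith
  refine tendsto_tsum_of_dominated_convergence (summable_gauss_majorant hX1) (fun m => ?_) ?_
  · have : ContinuousAt (fun w : ℝ => gaussCoef A B C m * ((1 - w : ℝ) : ℂ) ^ m) 0 := by fun_prop
    have h := this.tendsto
    simp only [sub_zero, Complex.ofReal_one, one_pow, mul_one] at h
    exact h.mono_left nhdsWithin_le_nhds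
  · filter_upwards [eventually_Ioo] with w hw m
    rw [norm_mul, norm_pow]
    refine (mul_le_of_le_one_right (norm_nonneg _) ?_).trans (norm_gaussCoef_le hX hC m)
    exact pow_le_one₀ (norm_nonneg _) (norm_lt_one_of_mem_Ioo (one_sub_mem_Ioo hw)).le

theorem tendsto_gaussF_one_nat (A B C : ℂ) :
    Tendsto (fun N : ℕ => ∑' m, gaussCoef A B (C + N) m) atTop (𝓝 1) := by
  set X := ‖A‖ * ‖B‖ + ‖A‖ + ‖B‖ + 1 with hX
  have hX1 : 1 ≤ X := by rw [hX]; have := norm_nonneg A; have := norm_nonneg B; nlinarith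
  have h1 : ∑' m, (0 : ℂ) ^ m = 1 := by
    rw [tsum_eq_single 0]
    · simp
    · intro m hm; simp [hm]
  rw [← h1]
  refine tendsto_tsum_of_dominated_convergence (summable_gauss_majorant hX1) (fun m => ?_) ?_
  · have h2 : ∀ j : ℕ, Tendsto (fun N : ℕ => ((A + j) * (B + j)) / ((C + N + j) * (1 + j)))
        atTop (𝓝 0) := by
      intro j
      have h3 : Tendsto (fun N : ℕ => ((C + j) + N : ℂ)⁻¹) atTop (𝓝 0) :=
        tendsto_inv₀_cobounded.comp
          ((tendsto_const_add_cobounded (C + j)).comp tendsto_natCast_atTop_cobounded)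
      have h4 := h3.const_mul ((A + j) * (B + j) / (1 + j))
      rw [mul_zero] at h4
      refine h4.congr fun N => ?_
      rw [show C + N + j = C + j + N by ring, div_mul_eq_div_div_swap, div_eq_mul_inv _ (C + j + _)]
    have h5 := tendsto_finsetProd (Finset.range m) fun j _ => h2 j
    simpa [gaussCoef] using h5
  · obtain ⟨N₀, hN₀⟩ := exists_nat_ge (X + 2 - C.re)
    filter_upwards [eventually_ge_atTop N₀] with N hN m
    refine norm_gaussCoef_le hX ?_ m
    have : (N₀ : ℝ) ≤ N := by exact_mod_cast hN
    simp only [Complex.add_re, Complex.natCast_re]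
    linarith

theorem hasConnCoeff_of_re {A B C κ : ℂ} {X : ℝ} (hX : X = ‖A‖ * ‖B‖ + ‖A‖ + ‖B‖ + 1)
    (hC : X + 2 ≤ C.re) (hs : 0 < (C - A - B).re) (h : HasConnCoeff A B C κ) :
    κ = ∑' m, gaussCoef A B C m := by
  obtain ⟨κ₂, h⟩ := h
  have h1 := tendsto_gaussF_one hX hC
  have hpw : Tendsto (fun w : ℝ => (w : ℂ) ^ (C - A - B)) (𝓝[>] 0) (𝓝 0) := by
    rw [tendsto_zero_iff_norm_tendsto_zero]
    have h2 : Tendsto (fun w : ℝ => w ^ (C - A - B).re) (𝓝[>] 0) (𝓝 (0 ^ (C - A - B).re)) :=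
      (Real.continuousAt_rpow_const _ _ (Or.inr hs.le)).tendsto.mono_left nhdsWithin_le_nhds
    rw [Real.zero_rpow hs.ne'] at h2
    refine h2.congr' ?_
    filter_upwards [self_mem_nhdsWithin] with w hw
    rw [Complex.norm_cpow_eq_rpow_re_of_pos hw]
  have h3 := ((tendsto_gaussF_zero A B (1 - (C - A - B))).const_mul κ).add
    ((hpw.mul (tendsto_gaussF_zero (C - B) (C - A) (1 + (C - A - B)))).const_mul κ₂)
  simp only [mul_one, mul_zero, add_zero] at h3
  refine tendsto_nhds_unique (h3.congr' ?_) h1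
  filter_upwards [eventually_Ioo] with w hw using (h w hw).symm

theorem NotPole.add_nat {C : ℂ} (h : NotPole C) (N : ℕ) : NotPole (C + N) := by
  induction N with
  | zero => simpa using h
  | succ N ih => simpa [add_assoc] using ih.add_one

theorem NotInt.add_nat {s : ℂ} (h : NotInt s) (N : ℕ) : NotInt (s + N) := fun m hm =>
  h (m - N) (by push_cast; linear_combination hm)

theorem HasConnCoeff.lower_nat {A B C : ℂ} (hC : NotPole C) (hs : NotInt (C - A - B)) (N : ℕ)
    {κ : ℂ} (h : HasConnCoeff A B (C + N) κ) :
    HasConnCoeff A B C (κ * ∏ j ∈ Finset.range N,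
      ((C - A + j) * (C - B + j) / ((C + j) * (C - A - B + j)))) := by
  induction N generalizing κ with
  | zero => simpa using h
  | succ N ih =>
    have h1 : NotInt (C + N - A - B) := by
      rw [show C + N - A - B = C - A - B + N by ring]; exact hs.add_nat N
    have h2 := ih (HasConnCoeff.lower (hC.add_nat N) h1 (by simpa [add_assoc] using h))
    rw [Finset.prod_range_succ]
    convert h2 using 1
    ring

theorem tendsto_prod_Gamma {a b c d : ℂ} (hc : NotPole c) (hd : NotPole d) (h : a + b = c + d) :
    Tendsto (fun N : ℕ => ∏ j ∈ Finset.range (N + 1), ((a + j) * (b + j) / ((c + j) * (d + j))))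
      atTop (𝓝 (Complex.Gamma c * Complex.Gamma d / (Complex.Gamma a * Complex.Gamma b))) := by
  have hzero : ∀ a b : ℂ, ¬ NotPole a →
      Tendsto (fun N : ℕ => ∏ j ∈ Finset.range (N + 1), ((a + j) * (b + j) / ((c + j) * (d + j))))
      atTop (𝓝 (Complex.Gamma c * Complex.Gamma d / (Complex.Gamma a * Complex.Gamma b))) := by
    intro a b ha
    simp only [NotPole, not_forall, not_not] at ha
    obtain ⟨m, hm⟩ := ha
    rw [(Complex.Gamma_eq_zero_iff a).2 ⟨m, hm⟩, zero_mul, div_zero]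
    refine tendsto_const_nhds.congr' ?_
    filter_upwards [eventually_ge_atTop m] with N hN
    exact (Finset.prod_eq_zero (Finset.mem_range.2 (Nat.lt_succ_of_le hN)) (by simp [hm])).symm
  by_cases ha : NotPole a
  · by_cases hb : NotPole b
    · have h1 := ((Complex.GammaSeq_tendsto_Gamma c).mul (Complex.GammaSeq_tendsto_Gamma d)).div
        ((Complex.GammaSeq_tendsto_Gamma a).mul (Complex.GammaSeq_tendsto_Gamma b))
        (mul_ne_zero (Complex.Gamma_ne_zero ha) (Complex.Gamma_ne_zero hb))
      refine h1.congr' ?_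
      filter_upwards [eventually_ne_atTop 0] with N hN
      have hN' : (N : ℂ) ≠ 0 := by exact_mod_cast hN
      have hp : ∀ {x : ℂ}, NotPole x → ∏ j ∈ Finset.range (N + 1), (x + j) ≠ 0 := fun hx =>
        Finset.prod_ne_zero_iff.2 fun j _ => hx.add_ne j
      have h2 : (N : ℂ) ^ a * (N : ℂ) ^ b = (N : ℂ) ^ c * (N : ℂ) ^ d := by
        rw [← Complex.cpow_add _ _ hN', ← Complex.cpow_add _ _ hN', h]
      have h3 : ∀ x : ℂ, (N : ℂ) ^ x ≠ 0 := fun x => by simp [Complex.cpow_eq_zero_iff, hN']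
      have h4 : (N.factorial : ℂ) ≠ 0 := by exact_mod_cast N.factorial_ne_zero
      rw [Finset.prod_div_distrib, Finset.prod_mul_distrib, Finset.prod_mul_distrib]
      simp only [Pi.div_apply, Complex.GammaSeq]
      have ea := hp ha
      have eb := hp hb
      have ec := hp hc
      have ed := hp hd
      have fa := h3 a
      have fb := h3 b
      field_simp
      linear_combination -h2
    · have := hzero b a hb
      simpa only [mul_comm] using this
  · exact hzero a b ha

theorem hasConnCoeff_Gamma {A B C : ℂ} (hC : NotPole C) (hs : NotInt (C - A - B)) :
    HasConnCoeff A B C (Complex.Gamma C * Complex.Gamma (C - A - B) /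
      (Complex.Gamma (C - A) * Complex.Gamma (C - B))) := by
  obtain ⟨κ, hκ⟩ := exists_hasConnCoeff hC hs
  convert hκ using 1
  set X := ‖A‖ * ‖B‖ + ‖A‖ + ‖B‖ + 1 with hX
  have h1 := ((tendsto_add_atTop_iff_nat 1).2 (tendsto_gaussF_one_nat A B C)).mul
    (tendsto_prod_Gamma (a := C - A) (b := C - B) hC hs.notPole (by ring))
  rw [one_mul] at h1
  refine tendsto_nhds_unique h1 (tendsto_const_nhds.congr' ?_)
  obtain ⟨N₀, hN₀⟩ := exists_nat_ge (X + 2 + |C.re| + |A.re| + |B.re|)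
  filter_upwards [eventually_ge_atTop N₀] with N hN
  have hN1 : (N₀ : ℝ) ≤ N := by exact_mod_cast hN
  have hi : NotInt (C + (N + 1 : ℕ) - A - B) := by
    rw [show C + (N + 1 : ℕ) - A - B = C - A - B + (N + 1 : ℕ) by ring]; exact hs.add_nat _
  obtain ⟨κ', hκ'⟩ := exists_hasConnCoeff (hC.add_nat (N + 1)) hi
  have b1 := neg_abs_le C.re
  have b2 := le_abs_self A.re
  have b3 := le_abs_self B.re
  have b4 := abs_nonneg A.re
  have b5 := abs_nonneg B.re
  have b6 := norm_nonneg A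
  have b7 := norm_nonneg B
  have b8 : 0 ≤ X := by positivity
  have h2 := hasConnCoeff_of_re hX (by
    simp only [Complex.add_re, Complex.natCast_re]; push_cast; linarith) (by
    simp only [Complex.add_re, Complex.sub_re, Complex.natCast_re]; push_cast; linarith) hκ'
  rw [← h2]
  exact hκ.unique hs (hκ'.lower_nat hC hs)

theorem gaussF_euler {A B C : ℂ} (hC : NotPole C) (hs : NotInt (C - A - B)) {w : ℝ}
    (hw : w ∈ Set.Ioo (0 : ℝ) 1) :
    (w : ℂ) ^ (C - A - B) * gaussF (C - B) (C - A) C ((1 - w : ℝ) : ℂ) =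
      gaussF A B C ((1 - w : ℝ) : ℂ) := by
  set s := C - A - B with hsdef
  have hu := isSol_gaussF_one_sub (A := A) (B := B) hC rfl
  have hv := (isSol_gaussF_one_sub (A := A + s) (B := B + s) (D := 1 + s) hC
    (by rw [hsdef]; ring)).cpow_mul
  rw [show A + B + 1 - C = 1 - s by rw [hsdef]; ring] at hu
  rw [show A + s = C - B by rw [hsdef]; ring, show B + s = C - A by rw [hsdef]; ring] at hv
  have hP : ∀ x ∈ Set.Ioo (0 : ℝ) 1, HasDerivAt (hypW A B (1 - s))
      (hypP A B (1 - s) x * hypW A B (1 - s) x) x := fun x hx => hasDerivAt_hypW A B _ hx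
  obtain ⟨κ, hκ⟩ := hu.exists_wronskian isOpen_Ioo (convex_Ioo (0 : ℝ) 1).isPreconnected hv hP
  have han : ∀ A B : ℂ, AnalyticAt ℂ (gaussF A B C) 0 := fun A B =>
    (tame_gaussCoef A B C).analyticAt (by simp)
  have han' : ∀ A B : ℂ, AnalyticAt ℂ (gaussF' A B C) 0 := fun A B =>
    (tame_gaussCoef A B C).dcoef.analyticAt (by simp)
  have hκ0 : κ = 0 := by
    refine const_eq_zero_of_analyticAt (h := fun z => (1 - z) * (gaussF' A B C z *
      gaussF (C - B) (C - A) C z - gaussF A B C z * gaussF' (C - B) (C - A) C z) +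
      s * (gaussF A B C z * gaussF (C - B) (C - A) C z)) ?_ (s := -C) (p := fun _ => 1)
      (fun m hm => hC m (by linear_combination -hm)) tendsto_const_nhds one_ne_zero ?_
    · exact ((analyticAt_const.sub analyticAt_id).mul (((han' _ _).mul (han _ _)).sub
        ((han _ _).mul (han' _ _)))).add (analyticAt_const.mul ((han _ _).mul (han _ _)))
    · filter_upwards [eventually_Ioo] with z hz
      have h1 := hκ (1 - z) (one_sub_mem_Ioo hz)
      have hz1 : (z : ℂ) ≠ 0 := by exact_mod_cast hz.1.ne'
      have hw1 : ((1 - z : ℝ) : ℂ) ≠ 0 := by exact_mod_cast (one_sub_mem_Ioo hz).1.ne'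
      have hzC : (z : ℂ) ^ C ≠ 0 := by simp [Complex.cpow_eq_zero_iff, hz1]
      have hws : ((1 - z : ℝ) : ℂ) ^ s ≠ 0 := by
        simp [Complex.cpow_eq_zero_iff, hw1, -Complex.ofReal_sub]
      rw [hypW, Complex.cpow_sub _ _ hw1, Complex.cpow_one,
        show A + B + 1 - (1 - s) = C by rw [hsdef]; ring, sub_sub_cancel] at h1
      rw [Complex.cpow_neg, ← h1]
      have e : (1 : ℂ) - z = ((1 - z : ℝ) : ℂ) := by push_cast; rfl
      rw [e]
      field_simp
      ring
  have hlim : ∀ A B : ℂ, Tendsto (fun w : ℝ => gaussF A B C ((1 - w : ℝ) : ℂ)) (𝓝[<] 1) (𝓝 1) := by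
    intro A B
    have hc : ContinuousAt (fun w : ℝ => gaussF A B C ((1 - w : ℝ) : ℂ)) 1 := by
      refine ContinuousAt.comp (g := gaussF A B C) ?_ (by fun_prop)
      exact (hasDerivAt_gaussF A B C (by simp)).continuousAt
    have := hc.tendsto
    simp only [sub_self, Complex.ofReal_zero, gaussF_zero] at this
    exact this.mono_left nhdsWithin_le_nhds
  have hev : ∀ᶠ w : ℝ in 𝓝[<] 1, w ∈ Set.Ioo (0 : ℝ) 1 := Ioo_mem_nhdsLT one_pos
  obtain ⟨c, hc⟩ := (isSol_gaussF (A := A) (B := B) hs.one_sub.notPole).exists_eq_mul isOpen_Ioo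
    (convex_Ioo (0 : ℝ) 1).isPreconnected (isSol_second hs) hP hs.ne_zero (wronskian_gauss hs)
    hu hv (fun x hx => (hκ x hx).trans hκ0)
    (by
      obtain ⟨w, h1, h2⟩ := (((hlim A B).eventually_ne one_ne_zero).and hev).exists
      exact ⟨w, h2, h1⟩)
  have hpw : Tendsto (fun w : ℝ => (w : ℂ) ^ s) (𝓝[<] 1) (𝓝 1) := by
    have := (hasDerivAt_ofReal_cpow_const' one_pos s).continuousAt.tendsto
    simp only [Complex.ofReal_one, Complex.one_cpow] at this
    exact this.mono_left nhdsWithin_le_nhds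
  have l1 := hpw.mul (hlim (C - B) (C - A))
  have l2 := (hlim A B).const_mul c
  have hc1 : 1 * 1 = c * 1 := tendsto_nhds_unique l1 (l2.congr' (by
    filter_upwards [hev] with w hw using (hc w hw).symm))
  rw [hc w hw, show c = 1 by simpa using hc1.symm, one_mul]

/-- Gauss' connection formula between the points `0` and `1`. -/
theorem gaussF_connection {A B C : ℂ} (hC : NotPole C) (hs : NotInt (C - A - B)) {w : ℝ}
    (hw : w ∈ Set.Ioo (0 : ℝ) 1) :
    gaussF A B C ((1 - w : ℝ) : ℂ) =
      Complex.Gamma C * Complex.Gamma (C - A - B) /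
        (Complex.Gamma (C - A) * Complex.Gamma (C - B)) * gaussF A B (1 - (C - A - B)) w +
      Complex.Gamma C * Complex.Gamma (-(C - A - B)) / (Complex.Gamma A * Complex.Gamma B) *
        ((w : ℂ) ^ (C - A - B) * gaussF (C - B) (C - A) (1 + (C - A - B)) w) := by
  obtain ⟨κ, h⟩ := hasConnCoeff_Gamma hC hs
  have hs' : NotInt (C - (C - B) - (C - A)) := by
    rw [show C - (C - B) - (C - A) = -(C - A - B) by ring]; exact hs.neg
  obtain ⟨κ', h'⟩ := hasConnCoeff_Gamma hC hs'
  rw [show C - (C - B) - (C - A) = -(C - A - B) by ring] at h'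
  simp only [sub_sub_cancel, sub_neg_eq_add, ← sub_eq_add_neg] at h'
  have hu := ((isSol_gaussF (A := A) (B := B) hs.one_sub.notPole).combination_unique isOpen_Ioo
    (isSol_second hs) hs.ne_zero (wronskian_gauss hs) ⟨1 / 2, by norm_num⟩
    (a := κ') (a' := Complex.Gamma C * Complex.Gamma (C - A - B) /
        (Complex.Gamma (C - A) * Complex.Gamma (C - B)))
    (b := Complex.Gamma C * Complex.Gamma (-(C - A - B)) / (Complex.Gamma B * Complex.Gamma A))
    (b' := κ) (fun x hx => ?_)).2
  · rw [h w hw, ← hu, mul_comm (Complex.Gamma A)]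
  · have hx1 : (x : ℂ) ≠ 0 := by exact_mod_cast hx.1.ne'
    have hxs : (x : ℂ) ^ (C - A - B) ≠ 0 := by simp [Complex.cpow_eq_zero_iff, hx1]
    rw [← h x hx, ← gaussF_euler hC hs hx, h' x hx, Complex.cpow_neg]
    field_simp
    ring

/-- The half sum of positive roots in rank one. -/
def rhoOne (ks kl : ℂ) : ℂ := ks / 2 + kl

/-- First order coefficient of the radial part of the Laplacian in rank one. -/
def radP (ks kl : ℂ) (x : ℝ) : ℂ :=
  ks * (((1 + Real.exp (-x)) / (1 - Real.exp (-x)) : ℝ) : ℂ) +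
    2 * kl * (((1 + Real.exp (-(2 * x))) / (1 - Real.exp (-(2 * x))) : ℝ) : ℂ)

/-- Coefficients of the rank one Harish-Chandra series. -/
def hcCoef (ks kl l : ℂ) : ℕ → ℂ
  | 0 => 1
  | 1 => 2 * ks * (rhoOne ks kl - l) / (1 - 2 * l)
  | m + 2 => (2 * ks * (rhoOne ks kl - l + m + 1) * hcCoef ks kl l (m + 1) +
      (2 * rhoOne ks kl + m) * (2 * rhoOne ks kl + m - 2 * l) * hcCoef ks kl l m) /
        ((m + 2) * (m + 2 - 2 * l))

theorem tendsto_quadratic_ratio (A B C D : ℂ) :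
    Tendsto (fun m : ℕ => ((A + m) * (B + m)) / ((C + m) * (D + m))) atTop (𝓝 1) := by
  have h := ((tendsto_add_nat_div A).mul (tendsto_add_nat_div B)).div
    ((tendsto_add_nat_div C).mul (tendsto_add_nat_div D)) (by simp)
  simp only [mul_one, div_one] at h
  refine h.congr' ?_
  filter_upwards [eventually_ne_atTop 0] with m hm
  have : (m : ℂ) ≠ 0 := by exact_mod_cast hm
  simp only [Pi.div_apply]
  rw [div_mul_div_comm, div_mul_div_comm, div_div_div_cancel_right₀ (by positivity)]

theorem tendsto_inv_add_nat (a : ℂ) : Tendsto (fun m : ℕ => (a + m)⁻¹) atTop (𝓝 0) :=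
  tendsto_inv₀_cobounded.comp
    ((tendsto_const_add_cobounded a).comp tendsto_natCast_atTop_cobounded)

theorem tame_hcCoef (ks kl l : ℂ) : Tame (hcCoef ks kl l) := by
  set ρ := rhoOne ks kl with hρ
  have h1 : Tendsto (fun m : ℕ => 2 * ks * (((ρ - l + 1 + m) * (1 + m)) /
      ((2 + m) * (2 - 2 * l + m)) * (1 + (m : ℂ))⁻¹)) atTop (𝓝 0) := by
    simpa using ((tendsto_quadratic_ratio (ρ - l + 1) 1 2 (2 - 2 * l)).mul
      (tendsto_inv_add_nat 1)).const_mul (2 * ks)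
  have h2 := tendsto_quadratic_ratio (2 * ρ) (2 * ρ - 2 * l) 2 (2 - 2 * l)
  have h3 := h1.norm.add h2.norm
  simp only [norm_zero, norm_one, zero_add] at h3
  refine tame_of_growth h3 (Eventually.of_forall fun m => ?_)
  have hm := one_add_nat_ne_zero m
  have e : hcCoef ks kl l (m + 2) = 2 * ks * (((ρ - l + 1 + m) * (1 + m)) /
      ((2 + m) * (2 - 2 * l + m)) * (1 + (m : ℂ))⁻¹) * hcCoef ks kl l (m + 1) +
      ((2 * ρ + m) * (2 * ρ - 2 * l + m)) / ((2 + m) * (2 - 2 * l + m)) * hcCoef ks kl l m := by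
    rw [hcCoef, ← hρ]
    rw [show ((m : ℂ) + 2) * (m + 2 - 2 * l) = (2 + m) * (2 - 2 * l + m) by ring]
    simp only [div_eq_mul_inv]
    generalize ((2 + (m : ℂ)) * (2 - 2 * l + m))⁻¹ = d
    field_simp
    ring
  rw [e]
  refine (norm_add_le _ _).trans ?_
  rw [norm_mul _ (hcCoef ks kl l (m + 1)), norm_mul _ (hcCoef ks kl l m)]
  exact (add_le_add (mul_le_mul_of_nonneg_left (le_max_left _ _) (norm_nonneg _))
    (mul_le_mul_of_nonneg_left (le_max_right _ _) (norm_nonneg _))).trans_eq (add_mul _ _ _).symm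

theorem hcCoef_one (ks kl : ℂ) {l : ℂ} (hl : NotInt (2 * l)) :
    (1 - 2 * l) * hcCoef ks kl l 1 = 2 * ks * (rhoOne ks kl - l) := by
  have : 1 - 2 * l ≠ 0 := hl.one_sub.ne_zero
  rw [hcCoef]
  field_simp

theorem hcCoef_add_two (ks kl : ℂ) {l : ℂ} (hl : NotInt (2 * l)) (m : ℕ) :
    (m + 2) * (m + 2 - 2 * l) * hcCoef ks kl l (m + 2) =
      2 * ks * (rhoOne ks kl - l + m + 1) * hcCoef ks kl l (m + 1) +
      (2 * rhoOne ks kl + m) * (2 * rhoOne ks kl + m - 2 * l) * hcCoef ks kl l m := by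
  have h1 : (m : ℂ) + 2 - 2 * l ≠ 0 := by
    have := hl.neg.add_nat (m + 2) |>.ne_zero
    push_cast at this
    rwa [show (m : ℂ) + 2 - 2 * l = -(2 * l) + (m + 2) by ring]
  have h2 : (m : ℂ) + 2 ≠ 0 := by exact_mod_cast (Nat.succ_ne_zero (m + 1))
  rw [hcCoef]
  field_simp

theorem hcCoef_ode (ks kl : ℂ) {l : ℂ} (hl : NotInt (2 * l)) {q : ℂ} (hq : ‖q‖ < 1) :
    (1 - q ^ 2) * (q ^ 2 * psum (dcoef (dcoef (hcCoef ks kl l))) q +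
      (1 - 2 * (l - rhoOne ks kl)) * (q * psum (dcoef (hcCoef ks kl l)) q) +
      ((l - rhoOne ks kl) ^ 2 + rhoOne ks kl ^ 2 - l ^ 2) * psum (hcCoef ks kl l) q) +
    (2 * rhoOne ks kl * (1 + q ^ 2) + 2 * ks * q) * ((l - rhoOne ks kl) * psum (hcCoef ks kl l) q -
      q * psum (dcoef (hcCoef ks kl l)) q) = 0 := by
  set ρ := rhoOne ks kl with hρ
  set g := hcCoef ks kl l with hg
  have t0 : Tame g := tame_hcCoef ks kl l
  have t1 := t0.dcoef
  have t2 := t1.dcoef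
  set N : ℕ → ℂ := xcoef (xcoef (dcoef (dcoef g))) + (1 - 2 * (l - ρ)) • xcoef (dcoef g) +
    ((l - ρ) ^ 2 + ρ ^ 2 - l ^ 2) • g with hN
  set M : ℕ → ℂ := (l - ρ) • g + (-1 : ℂ) • xcoef (dcoef g) with hM
  have tM : Tame M := (t0.smul _).add (t1.xcoef.smul _)
  have tU : Tame (xcoef (xcoef (dcoef (dcoef g))) + (1 - 2 * (l - ρ)) • xcoef (dcoef g)) :=
    t2.xcoef.xcoef.add (t1.xcoef.smul _)
  have tN : Tame N := tU.add (t0.smul _)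
  have sN : psum N q = q ^ 2 * psum (dcoef (dcoef g)) q +
      (1 - 2 * (l - ρ)) * (q * psum (dcoef g) q) +
      ((l - ρ) ^ 2 + ρ ^ 2 - l ^ 2) * psum g q := by
    rw [hN, psum_add tU (t0.smul _) hq, psum_add t2.xcoef.xcoef (t1.xcoef.smul _) hq, psum_smul,
      psum_smul, psum_xcoef t1 hq, psum_xcoef t2.xcoef hq, psum_xcoef t2 hq]
    ring
  have sM : psum M q = (l - ρ) * psum g q - q * psum (dcoef g) q := by
    rw [hM, psum_add (t0.smul _) (t1.xcoef.smul _) hq, psum_smul, psum_smul, psum_xcoef t1 hq]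
    ring
  have key : N + (-1 : ℂ) • xcoef (xcoef N) + (2 * ρ) • M + (2 * ρ) • xcoef (xcoef M) +
      (2 * ks) • xcoef M = 0 := by
    funext m
    rcases m with _ | _ | _ | _ | m
    · simp [xcoef, hN, hM]; ring
    · have := hcCoef_one ks kl hl
      rw [← hρ, ← hg] at this
      have g0 : g 0 = 1 := by simp [hg, hcCoef]
      simp [xcoef, dcoef, hN, hM, g0]
      linear_combination this
    · have := hcCoef_add_two ks kl hl 0
      rw [← hρ, ← hg] at this
      simp [xcoef, dcoef, hN, hM] at this ⊢
      linear_combination this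
    · have := hcCoef_add_two ks kl hl 1
      rw [← hρ, ← hg] at this
      simp [xcoef, dcoef, hN, hM] at this ⊢
      linear_combination this
    · have := hcCoef_add_two ks kl hl (m + 2)
      rw [← hρ, ← hg] at this
      simp [xcoef, dcoef, hN, hM] at this ⊢
      linear_combination this
  have h1 : psum (N + (-1 : ℂ) • xcoef (xcoef N) + (2 * ρ) • M + (2 * ρ) • xcoef (xcoef M) +
      (2 * ks) • xcoef M) q = 0 := by rw [key]; simp [psum]
  have tA := tN.add (tN.xcoef.xcoef.smul (-1))
  have tB := tA.add (tM.smul (2 * ρ))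
  have tC := tB.add (tM.xcoef.xcoef.smul (2 * ρ))
  rw [psum_add tC (tM.xcoef.smul _) hq, psum_add tB (tM.xcoef.xcoef.smul _) hq,
    psum_add tA (tM.smul _) hq, psum_add tN (tN.xcoef.xcoef.smul _) hq] at h1
  simp only [psum_smul, psum_xcoef tN.xcoef hq, psum_xcoef tN hq, psum_xcoef tM.xcoef hq,
    psum_xcoef tM hq, sN, sM] at h1
  linear_combination h1

/-- The rank one Harish-Chandra series. -/
def hcOne (ks kl l : ℂ) (x : ℝ) : ℂ :=
  (Real.exp (-x) : ℂ) ^ (rhoOne ks kl - l) * psum (hcCoef ks kl l) (Real.exp (-x) : ℂ)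

/-- The derivative of the rank one Harish-Chandra series. -/
def hcOne' (ks kl l : ℂ) (x : ℝ) : ℂ :=
  (Real.exp (-x) : ℂ) ^ (rhoOne ks kl - l) *
    ((l - rhoOne ks kl) * psum (hcCoef ks kl l) (Real.exp (-x) : ℂ) -
      Real.exp (-x) * psum (dcoef (hcCoef ks kl l)) (Real.exp (-x) : ℂ))

theorem hasDerivAt_exp_neg' (x : ℝ) :
    HasDerivAt (fun x : ℝ => Real.exp (-x)) (-Real.exp (-x)) x := by
  simpa using (hasDerivAt_neg x).exp

theorem exp_neg_mem_Ioo {x : ℝ} (hx : 0 < x) : Real.exp (-x) ∈ Set.Ioo (0 : ℝ) 1 :=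
  ⟨Real.exp_pos _, by rw [← Real.exp_zero]; exact Real.exp_lt_exp.2 (by linarith)⟩

theorem hasDerivAt_exp_neg_cpow (s : ℂ) (x : ℝ) :
    HasDerivAt (fun x : ℝ => (Real.exp (-x) : ℂ) ^ s) (-s * (Real.exp (-x) : ℂ) ^ s) x := by
  have h := (hasDerivAt_ofReal_cpow_const' (Real.exp_pos (-x)) s).scomp x (hasDerivAt_exp_neg' x)
  convert! h using 1
  have : (Real.exp (-x) : ℂ) ≠ 0 := by exact_mod_cast (Real.exp_pos _).ne'
  simp only [Complex.real_smul, Complex.ofReal_neg]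
  field_simp

theorem Tame.hasDerivAt_exp_neg {g : ℕ → ℂ} (hg : Tame g) {x : ℝ} (hx : 0 < x) :
    HasDerivAt (fun x : ℝ => psum g (Real.exp (-x) : ℂ))
      (-((Real.exp (-x) : ℂ) * psum (BC.dcoef g) (Real.exp (-x) : ℂ))) x := by
  have h := (hg.hasDerivAt (norm_lt_one_of_mem_Ioo (exp_neg_mem_Ioo hx))).comp_ofReal.scomp x
    (hasDerivAt_exp_neg' x)
  convert! h using 1
  simp

theorem radP_eq (ks kl : ℂ) (x : ℝ) :
    radP ks kl x = ks * ((1 + Real.exp (-x)) / (1 - Real.exp (-x))) +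
      2 * kl * ((1 + (Real.exp (-x) : ℂ) ^ 2) / (1 - (Real.exp (-x) : ℂ) ^ 2)) := by
  have : Real.exp (-(2 * x)) = Real.exp (-x) ^ 2 := by rw [← Real.exp_nat_mul]; congr 1; push_cast; ring
  rw [radP, this]
  push_cast
  rfl

theorem isSol_hcOne (ks kl : ℂ) {l : ℂ} (hl : NotInt (2 * l)) :
    IsSol (radP ks kl) (fun _ => rhoOne ks kl ^ 2 - l ^ 2) (Set.Ioi 0) (hcOne ks kl l)
      (hcOne' ks kl l) where
  deriv_one x hx := by
    have h := (hasDerivAt_exp_neg_cpow (rhoOne ks kl - l) x).mul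
      ((tame_hcCoef ks kl l).hasDerivAt_exp_neg hx)
    convert! h using 1
    rw [hcOne']
    ring
  deriv_two x hx := by
    have hq : HasDerivAt (fun x : ℝ => (Real.exp (-x) : ℂ)) (-(Real.exp (-x) : ℂ)) x := by
      have := (hasDerivAt_exp_neg' x).ofReal_comp
      push_cast at this ⊢
      exact this
    have h := (hasDerivAt_exp_neg_cpow (rhoOne ks kl - l) x).mul
      ((((tame_hcCoef ks kl l).hasDerivAt_exp_neg hx).const_mul (l - rhoOne ks kl)).sub
        (hq.mul ((tame_hcCoef ks kl l).dcoef.hasDerivAt_exp_neg hx)))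
    simp only [Pi.mul_apply, Pi.sub_apply] at h
    convert! h using 1
    have hm := exp_neg_mem_Ioo (show 0 < x from hx)
    have hode := hcCoef_ode ks kl hl (norm_lt_one_of_mem_Ioo hm)
    rw [radP_eq, hcOne, hcOne']
    set q : ℂ := (Real.exp (-x) : ℂ) with hqdef
    have h1 : 1 - q ≠ 0 := by
      rw [hqdef]; exact_mod_cast (sub_pos.2 hm.2).ne'
    have h2 : 1 + q ≠ 0 := by
      rw [hqdef]; exact_mod_cast (add_pos one_pos hm.1).ne'
    have h3 : 1 - q ^ 2 = (1 - q) * (1 + q) := by ring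
    have h4 : ks * ((1 + q) / (1 - q)) + 2 * kl * ((1 + q ^ 2) / (1 - q ^ 2)) =
        (2 * rhoOne ks kl * (1 + q ^ 2) + 2 * ks * q) / ((1 - q) * (1 + q)) := by
      rw [h3, rhoOne]; field_simp; ring
    rw [h4]
    rw [h3] at hode
    field_simp
    linear_combination (-q ^ (rhoOne ks kl - l)) * hode

/-- `tanh (x / 2)`. -/
def tauHalf (x : ℝ) : ℝ := (1 - Real.exp (-x)) / (1 + Real.exp (-x))

/-- `1 / cosh² (x / 2)`. -/
def wHalf (x : ℝ) : ℝ := 1 - tauHalf x ^ 2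

theorem wHalf_eq (x : ℝ) : wHalf x = 4 * Real.exp (-x) / (1 + Real.exp (-x)) ^ 2 := by
  have : 1 + Real.exp (-x) ≠ 0 := by positivity
  rw [wHalf, tauHalf]
  field_simp
  ring

theorem tauHalf_neg (x : ℝ) : tauHalf (-x) = -tauHalf x := by
  have h : Real.exp x = (Real.exp (-x))⁻¹ := by rw [Real.exp_neg, inv_inv]
  have h1 : 1 + Real.exp (-x) ≠ 0 := by positivity
  have h2 := Real.exp_pos (-x)
  rw [tauHalf, tauHalf, neg_neg, h]
  field_simp
  ring

theorem wHalf_neg (x : ℝ) : wHalf (-x) = wHalf x := by rw [wHalf, wHalf, tauHalf_neg, neg_sq]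

theorem wHalf_pos (x : ℝ) : 0 < wHalf x := by rw [wHalf_eq]; positivity

theorem tauHalf_pos {x : ℝ} (hx : 0 < x) : 0 < tauHalf x :=
  div_pos (sub_pos.2 (exp_neg_mem_Ioo hx).2) (by positivity)

theorem wHalf_mem {x : ℝ} (hx : 0 < x) : wHalf x ∈ Set.Ioo (0 : ℝ) 1 :=
  ⟨wHalf_pos x, by rw [wHalf]; have := tauHalf_pos hx; nlinarith⟩

theorem hasDerivAt_tauHalf (x : ℝ) : HasDerivAt tauHalf (wHalf x / 2) x := by
  have h1 : 1 + Real.exp (-x) ≠ 0 := by positivity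
  have h := ((hasDerivAt_exp_neg' x).const_sub 1).div ((hasDerivAt_exp_neg' x).const_add 1) h1
  convert! h using 1
  rw [wHalf_eq]
  field_simp
  ring

theorem hasDerivAt_wHalf (x : ℝ) : HasDerivAt wHalf (-(wHalf x * tauHalf x)) x := by
  have h := ((hasDerivAt_tauHalf x).pow 2).const_sub 1
  convert! h using 1
  simp
  ring

theorem hasDerivAt_wHalf_cpow (A : ℂ) (x : ℝ) :
    HasDerivAt (fun x : ℝ => (wHalf x : ℂ) ^ A) (-(A * tauHalf x * (wHalf x : ℂ) ^ A)) x := by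
  have h := (hasDerivAt_ofReal_cpow_const' (wHalf_pos x) A).scomp x (hasDerivAt_wHalf x)
  convert! h using 1
  have : (wHalf x : ℂ) ≠ 0 := by exact_mod_cast (wHalf_pos x).ne'
  simp only [Complex.real_smul, Complex.ofReal_neg, Complex.ofReal_mul]
  field_simp

theorem radP_eq_tau (ks kl : ℂ) {x : ℝ} (hx : 0 < x) :
    radP ks kl x = (ks + kl * (1 + (tauHalf x : ℂ) ^ 2)) / tauHalf x := by
  have hm := exp_neg_mem_Ioo hx
  rw [radP_eq, tauHalf]
  push_cast
  have e1 : Complex.exp (-(x : ℂ)) = (Real.exp (-x) : ℂ) := by push_cast; rfl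
  rw [e1]
  set q : ℂ := (Real.exp (-x) : ℂ) with hqdef
  have h1 : 1 - q ≠ 0 := by
    rw [hqdef]; exact_mod_cast (sub_pos.2 hm.2).ne'
  have h2 : 1 + q ≠ 0 := by
    rw [hqdef]; exact_mod_cast (add_pos one_pos hm.1).ne'
  have h3 : 1 - q ^ 2 = (1 - q) * (1 + q) := by ring
  rw [h3]
  field_simp
  ring

theorem IsSol.radial {ks kl l : ℂ} {E E' : ℝ → ℂ}
    (hE : IsSol (hypP (rhoOne ks kl + l) (l + ks / 2 + 1 / 2) (1 + 2 * l))
      (hypQ (rhoOne ks kl + l) (l + ks / 2 + 1 / 2)) (Set.Ioo 0 1) E E') :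
    IsSol (radP ks kl) (fun _ => rhoOne ks kl ^ 2 - l ^ 2) (Set.Ioi 0)
      (fun x => (wHalf x : ℂ) ^ (rhoOne ks kl + l) * E (wHalf x))
      (fun x => (wHalf x : ℂ) ^ (rhoOne ks kl + l) * (-(tauHalf x *
        ((rhoOne ks kl + l) * E (wHalf x) + wHalf x * E' (wHalf x))))) where
  deriv_one x hx := by
    have h := (hasDerivAt_wHalf_cpow (rhoOne ks kl + l) x).mul
      ((hE.deriv_one _ (wHalf_mem hx)).scomp x (hasDerivAt_wHalf x))
    convert! h using 1
    simp only [Complex.real_smul, Complex.ofReal_neg, Complex.ofReal_mul, Function.comp]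
    ring
  deriv_two x hx := by
    have h0 := (hE.deriv_one _ (wHalf_mem hx)).scomp x (hasDerivAt_wHalf x)
    have h1 := (hE.deriv_two _ (wHalf_mem hx)).scomp x (hasDerivAt_wHalf x)
    have h2 := (hasDerivAt_wHalf x).ofReal_comp
    have h3 := (hasDerivAt_tauHalf x).ofReal_comp
    have h := (hasDerivAt_wHalf_cpow (rhoOne ks kl + l) x).mul
      (h3.mul ((h0.const_mul (rhoOne ks kl + l)).add (h2.mul h1))).neg
    simp only [Pi.mul_apply, Pi.add_apply, Pi.neg_apply, Function.comp, Complex.real_smul,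
      Complex.ofReal_neg, Complex.ofReal_mul, Complex.ofReal_div] at h
    convert! h using 1
    rw [radP_eq_tau _ _ hx]
    have hw : (wHalf x : ℂ) ≠ 0 := by exact_mod_cast (wHalf_pos x).ne'
    have ht : (tauHalf x : ℂ) ≠ 0 := by exact_mod_cast (tauHalf_pos hx).ne'
    have hwt : (wHalf x : ℂ) = 1 - (tauHalf x : ℂ) ^ 2 := by rw [wHalf]; push_cast; rfl
    have hwt' : 1 - (wHalf x : ℂ) = (tauHalf x : ℂ) ^ 2 := by rw [hwt]; ring
    simp only [hypP, hypQ, hwt']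
    set w : ℂ := (wHalf x : ℂ)
    set τ : ℂ := (tauHalf x : ℂ)
    set Y := w ^ (rhoOne ks kl + l)
    generalize E (wHalf x) = e
    generalize E' (wHalf x) = e'
    rw [rhoOne]
    field_simp
    rw [hwt]
    push_cast
    ring

/-- Integrating factor of the radial equation. -/
def radW (ks kl : ℂ) (x : ℝ) : ℂ :=
  (Real.exp (-x) : ℂ) ^ (-(2 * rhoOne ks kl)) * ((1 - Real.exp (-x) : ℝ) : ℂ) ^ (2 * ks) *
    ((1 - Real.exp (-x) ^ 2 : ℝ) : ℂ) ^ (2 * kl)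

theorem one_sub_sq_pos {q : ℝ} (hq : q ∈ Set.Ioo (0 : ℝ) 1) : 0 < 1 - q ^ 2 := by
  nlinarith [hq.1, hq.2]

theorem ofReal_cpow_ne_zero {w : ℝ} (hw : 0 < w) (s : ℂ) : (w : ℂ) ^ s ≠ 0 := by
  have : (w : ℂ) ≠ 0 := by exact_mod_cast hw.ne'
  simp [Complex.cpow_eq_zero_iff, this]

theorem hasDerivAt_radW (ks kl : ℂ) {x : ℝ} (hx : 0 < x) :
    HasDerivAt (radW ks kl) (radP ks kl x * radW ks kl x) x := by
  have hm := exp_neg_mem_Ioo hx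
  have h0 := hasDerivAt_exp_neg' x
  have h1 := (hasDerivAt_ofReal_cpow_const' (sub_pos.2 hm.2) (2 * ks)).scomp x (h0.const_sub 1)
  have h2 := (hasDerivAt_ofReal_cpow_const' (one_sub_sq_pos hm) (2 * kl)).scomp x
    ((h0.pow 2).const_sub 1)
  have h := ((hasDerivAt_exp_neg_cpow (-(2 * rhoOne ks kl)) x).mul h1).mul h2
  convert! h using 1
  rw [radP_eq, radW]
  simp only [Pi.mul_apply, Function.comp, Complex.real_smul]
  have n1 : ((1 - Real.exp (-x) : ℝ) : ℂ) ≠ 0 := by exact_mod_cast (sub_pos.2 hm.2).ne'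
  have n2 : ((1 - Real.exp (-x) ^ 2 : ℝ) : ℂ) ≠ 0 := by exact_mod_cast (one_sub_sq_pos hm).ne'
  generalize e1 : ((1 - Real.exp (-x) : ℝ) : ℂ) ^ (2 * ks) = X
  generalize e2 : ((1 - Real.exp (-x) ^ 2 : ℝ) : ℂ) ^ (2 * kl) = Y
  push_cast [-Complex.ofReal_exp] at n1 n2 ⊢
  rw [rhoOne]
  field_simp
  ring

theorem radW_ne_zero (ks kl : ℂ) {x : ℝ} (hx : 0 < x) : radW ks kl x ≠ 0 := by
  have hm := exp_neg_mem_Ioo hx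
  exact mul_ne_zero (mul_ne_zero (ofReal_cpow_ne_zero hm.1 _)
    (ofReal_cpow_ne_zero (sub_pos.2 hm.2) _)) (ofReal_cpow_ne_zero (one_sub_sq_pos hm) _)

theorem NotInt.of_eq {s t : ℂ} (h : NotInt s) (e : s = t) : NotInt t := e ▸ h

theorem exp_neg_neg_log {q : ℝ} (hq : 0 < q) : Real.exp (-(-Real.log q)) = q := by
  rw [neg_neg, Real.exp_log hq]

theorem tendsto_neg_log : Tendsto (fun q : ℝ => -Real.log q) (𝓝[>] 0) atTop :=
  tendsto_neg_atBot_atTop.comp Real.tendsto_log_nhdsGT_zero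

theorem wHalf_neg_log {q : ℝ} (hq : 0 < q) : wHalf (-Real.log q) = 4 * q / (1 + q) ^ 2 := by
  rw [wHalf_eq, exp_neg_neg_log hq]

theorem tauHalf_neg_log {q : ℝ} (hq : 0 < q) : tauHalf (-Real.log q) = (1 - q) / (1 + q) := by
  rw [tauHalf, exp_neg_neg_log hq]

theorem wHalf_neg_log_cpow {q : ℝ} (hq : 0 < q) (A : ℂ) :
    (wHalf (-Real.log q) : ℂ) ^ A = ((4 / (1 + q) ^ 2 : ℝ) : ℂ) ^ A * (q : ℂ) ^ A := by
  rw [wHalf_neg_log hq, ← Complex.mul_cpow_ofReal_nonneg (by positivity) hq.le]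
  congr 1
  push_cast
  ring

theorem tendsto_four_div_cpow (A : ℂ) :
    Tendsto (fun q : ℝ => ((4 / (1 + q) ^ 2 : ℝ) : ℂ) ^ A) (𝓝[>] 0) (𝓝 ((4 : ℂ) ^ A)) := by
  have h1 : ContinuousAt (fun q : ℝ => 4 / (1 + q) ^ 2) 0 :=
    ContinuousAt.div (by fun_prop) (by fun_prop) (by norm_num)
  have h2 : ContinuousAt (fun q : ℝ => ((4 / (1 + q) ^ 2 : ℝ) : ℂ) ^ A) 0 := by
    refine ContinuousAt.comp (g := fun x : ℝ => (x : ℂ) ^ A) ?_ h1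
    exact (hasDerivAt_ofReal_cpow_const' (by norm_num) A).continuousAt
  have h3 := h2.tendsto
  rw [show ((4 / (1 + 0) ^ 2 : ℝ) : ℂ) = 4 by norm_num] at h3
  exact h3.mono_left nhdsWithin_le_nhds

theorem hcOne_neg_eq (ks kl : ℂ) {l : ℂ} (hl : NotInt (2 * l)) {x : ℝ} (hx : 0 < x) :
    hcOne ks kl (-l) x = 4 ^ (-(rhoOne ks kl + l)) * ((wHalf x : ℂ) ^ (rhoOne ks kl + l) *
      gaussF (rhoOne ks kl + l) (l + ks / 2 + 1 / 2) (1 + 2 * l) (wHalf x)) := by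
  set A := rhoOne ks kl + l with hA
  set B := l + ks / 2 + 1 / 2 with hB
  set C := ks + kl + 1 / 2 with hC
  have hsl : C - A - B = -(2 * l) := by rw [hC, hA, hB, rhoOne]; ring
  have hs : NotInt (C - A - B) := hl.neg.of_eq hsl.symm
  have hD : 1 - (C - A - B) = 1 + 2 * l := by rw [hsl]; ring
  have y1 := isSol_gaussF (A := A) (B := B) hs.one_sub.notPole
  have y2 := isSol_second hs
  have hW := wronskian_gauss hs
  rw [hD] at y1 y2 hW
  have r1 := y1.radial
  have r2 := y2.radial
  have hI : IsPreconnected (Set.Ioi (0 : ℝ)) := (convex_Ioi 0).isPreconnected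
  have hP : ∀ x ∈ Set.Ioi (0 : ℝ), HasDerivAt (radW ks kl) (radP ks kl x * radW ks kl x) x :=
    fun x hx => hasDerivAt_radW ks kl hx
  obtain ⟨κ₀, hκ₀⟩ := r1.exists_wronskian isOpen_Ioi hI r2 hP
  have hκ₀' : κ₀ ≠ 0 := by
    intro h0
    have e1 := hκ₀ 1 (Set.mem_Ioi.2 one_pos)
    have e2 := hW (wHalf 1) (wHalf_mem one_pos)
    have n1 := radW_ne_zero ks kl one_pos
    have n2 := ofReal_cpow_ne_zero (wHalf_pos 1) (rhoOne ks kl + l)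
    have n3 : (tauHalf 1 : ℂ) ≠ 0 := by exact_mod_cast (tauHalf_pos one_pos).ne'
    have n4 : (wHalf 1 : ℂ) ≠ 0 := by exact_mod_cast (wHalf_pos 1).ne'
    refine hs.ne_zero (e2.symm.trans ?_)
    rw [h0] at e1
    refine mul_eq_zero_of_right _ ?_
    have n5 : radW ks kl 1 * (wHalf 1 : ℂ) ^ (rhoOne ks kl + l) *
      (wHalf 1 : ℂ) ^ (rhoOne ks kl + l) * tauHalf 1 * wHalf 1 ≠ 0 :=
      mul_ne_zero (mul_ne_zero (mul_ne_zero (mul_ne_zero n1 n2) n2) n3) n4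
    refine (mul_eq_zero.1 ?_).resolve_left n5
    linear_combination -e1
  have hφ := isSol_hcOne ks kl (hl.neg.of_eq (show -(2 * l) = 2 * (-l) by ring))
  simp only [neg_sq] at hφ
  obtain ⟨κ, hκ⟩ := r1.exists_wronskian isOpen_Ioi hI hφ hP
  set v := psum (hcCoef ks kl (-l)) with hv
  set v' := psum (dcoef (hcCoef ks kl (-l))) with hv'
  have hκ0 : κ = 0 := by
    have aW : AnalyticAt ℂ (fun q : ℂ => 4 * q / (1 + q) ^ 2) 0 :=
      (analyticAt_const.mul analyticAt_id).div ((analyticAt_const.add analyticAt_id).pow 2)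
        (by simp)
    have aT : AnalyticAt ℂ (fun q : ℂ => (1 - q) / (1 + q)) 0 :=
      (analyticAt_const.sub analyticAt_id).div (analyticAt_const.add analyticAt_id) (by simp)
    have aE : AnalyticAt ℂ (fun q : ℂ => gaussF A B (1 + 2 * l) (4 * q / (1 + q) ^ 2)) 0 :=
      ((tame_gaussCoef A B (1 + 2 * l)).analyticAt (z := 0) (by simp)).comp_of_eq aW (by simp)
    have aE' : AnalyticAt ℂ (fun q : ℂ => gaussF' A B (1 + 2 * l) (4 * q / (1 + q) ^ 2)) 0 :=
      ((tame_gaussCoef A B (1 + 2 * l)).dcoef.analyticAt (z := 0) (by simp)).comp_of_eq aW (by simp)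
    have av : AnalyticAt ℂ v 0 := (tame_hcCoef ks kl (-l)).analyticAt (by simp)
    have av' : AnalyticAt ℂ v' 0 := (tame_hcCoef ks kl (-l)).dcoef.analyticAt (by simp)
    refine const_eq_zero_of_analyticAt (h := fun q =>
      gaussF A B (1 + 2 * l) (4 * q / (1 + q) ^ 2) * (-A * v q - q * v' q) +
      (1 - q) / (1 + q) * (A * gaussF A B (1 + 2 * l) (4 * q / (1 + q) ^ 2) +
        4 * q / (1 + q) ^ 2 * gaussF' A B (1 + 2 * l) (4 * q / (1 + q) ^ 2)) * v q) ?_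
      (s := -(2 * l)) (p := fun q => (((4 / (1 + q) ^ 2 : ℝ) : ℂ) ^ A *
        ((1 - q : ℝ) : ℂ) ^ (2 * ks) * ((1 - q ^ 2 : ℝ) : ℂ) ^ (2 * kl))⁻¹)
      (p₀ := (4 ^ A * 1 * 1)⁻¹) (fun m hm => hl.neg m (by exact_mod_cast hm)) ?_ ?_ ?_
    · exact (aE.mul ((analyticAt_const.mul av).sub (analyticAt_id.mul av'))).add
        ((aT.mul ((analyticAt_const.mul aE).add (aW.mul aE'))).mul av)
    · have c1 : Tendsto (fun q : ℝ => ((1 - q : ℝ) : ℂ) ^ (2 * ks)) (𝓝[>] 0) (𝓝 1) := by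
        have := (hasDerivAt_one_sub_cpow (w := 0) (by simp) (2 * ks)).continuousAt.tendsto
        simp only [sub_zero, Complex.ofReal_one, Complex.one_cpow] at this
        exact this.mono_left nhdsWithin_le_nhds
      have c2 : Tendsto (fun q : ℝ => ((1 - q ^ 2 : ℝ) : ℂ) ^ (2 * kl)) (𝓝[>] 0) (𝓝 1) := by
        have h1 : ContinuousAt (fun q : ℝ => ((1 - q ^ 2 : ℝ) : ℂ) ^ (2 * kl)) 0 := by
          refine ContinuousAt.comp (g := fun q : ℝ => ((1 - q : ℝ) : ℂ) ^ (2 * kl)) ?_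
            (by fun_prop)
          exact (hasDerivAt_one_sub_cpow (by simp) (2 * kl)).continuousAt
        have := h1.tendsto
        norm_num at this
        have h2 := this.mono_left (nhdsWithin_le_nhds (s := Set.Ioi 0))
        exact_mod_cast h2
      refine (((tendsto_four_div_cpow A).mul c1).mul c2).inv₀ ?_
      simp [Complex.cpow_eq_zero_iff]
    · simp [Complex.cpow_eq_zero_iff]
    · filter_upwards [eventually_Ioo] with q hq
      have hx : 0 < -Real.log q := neg_pos.2 (Real.log_neg hq.1 hq.2)
      have h1 := hκ _ hx
      simp only [hcOne, hcOne', radW, exp_neg_neg_log hq.1, wHalf_neg_log_cpow hq.1] at h1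
      rw [wHalf_neg_log hq.1, tauHalf_neg_log hq.1, ← hv, ← hv',
        show rhoOne ks kl - -l = A by rw [hA]; ring, show -l - rhoOne ks kl = -A by rw [hA]; ring,
        ← hA] at h1
      have hq0 : (q : ℂ) ≠ 0 := by exact_mod_cast hq.1.ne'
      have n1 : ((4 / (1 + q) ^ 2 : ℝ) : ℂ) ^ A ≠ 0 :=
        ofReal_cpow_ne_zero (by have := hq.1; positivity) _
      have n2 := ofReal_cpow_ne_zero (sub_pos.2 hq.2) (2 * ks)
      have n3 := ofReal_cpow_ne_zero (one_sub_sq_pos hq) (2 * kl)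
      have e : (q : ℂ) ^ (-(2 * l)) * ((q : ℂ) ^ (-(2 * rhoOne ks kl)) * (q : ℂ) ^ A *
          (q : ℂ) ^ A) = 1 := by
        rw [← Complex.cpow_add _ _ hq0, ← Complex.cpow_add _ _ hq0, ← Complex.cpow_add _ _ hq0,
          show -(2 * l) + (-(2 * rhoOne ks kl) + A + A) = 0 by rw [hA]; ring, Complex.cpow_zero]
      rw [← h1]
      push_cast [-Complex.ofReal_exp] at n1 n2 n3 ⊢
      generalize (4 / (1 + (q : ℂ)) ^ 2) ^ A = X₁ at *
      generalize (1 - (q : ℂ)) ^ (2 * ks) = X₂ at *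
      generalize (1 - (q : ℂ) ^ 2) ^ (2 * kl) = X₃ at *
      generalize (q : ℂ) ^ (-(2 * l)) = Z₁ at *
      generalize (q : ℂ) ^ (-(2 * rhoOne ks kl)) = Z₂ at *
      generalize (q : ℂ) ^ A = Z₃ at *
      generalize gaussF A B (1 + 2 * l) (4 * q / (1 + q) ^ 2) = G at *
      generalize gaussF' A B (1 + 2 * l) (4 * q / (1 + q) ^ 2) = G' at *
      generalize (1 - (q : ℂ)) / (1 + q) = T at *
      generalize 4 * (q : ℂ) / (1 + q) ^ 2 = W at *
      field_simp
      linear_combination (-(G * (-A * v q - q * v' q) + T * v q * (A * G + W * G'))) * e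
  have hE : Tendsto (fun q : ℝ => gaussF A B (1 + 2 * l) (wHalf (-Real.log q))) (𝓝[>] 0)
      (𝓝 1) := by
    have h1 : ContinuousAt (fun q : ℝ => gaussF A B (1 + 2 * l) ((4 * q / (1 + q) ^ 2 : ℝ) : ℂ)) 0 := by
      refine ContinuousAt.comp (g := gaussF A B (1 + 2 * l)) ?_
        (Complex.continuous_ofReal.continuousAt.comp
          (ContinuousAt.div (by fun_prop) (by fun_prop) (by norm_num)))
      refine (hasDerivAt_gaussF A B _ ?_).continuousAt
      simp
    have h2 := h1.tendsto
    simp only [mul_zero, zero_div, Complex.ofReal_zero, gaussF_zero] at h2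
    refine (h2.mono_left nhdsWithin_le_nhds).congr' ?_
    filter_upwards [self_mem_nhdsWithin] with q hq
    rw [wHalf_neg_log hq]
  have hev : ∀ᶠ q : ℝ in 𝓝[>] 0, 0 < -Real.log q := tendsto_neg_log.eventually_gt_atTop 0
  obtain ⟨c, hc⟩ := r1.exists_eq_mul isOpen_Ioi hI r2 hP hκ₀' hκ₀ r1 hφ
    (fun x hx => (hκ x hx).trans hκ0) (by
      obtain ⟨q, h1, h2⟩ := ((hE.eventually_ne one_ne_zero).and hev).exists
      exact ⟨_, h2, mul_ne_zero (ofReal_cpow_ne_zero (wHalf_pos _) _) h1⟩)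
  have hvlim : Tendsto (fun q : ℝ => v q) (𝓝[>] 0) (𝓝 1) := by
    have := ((tame_hcCoef ks kl (-l)).hasDerivAt (z := 0) (by simp)).continuousAt.tendsto.comp
      tendsto_ofReal_nhdsGT_zero
    rwa [psum_zero, hcCoef] at this
  have hlim := ((tendsto_four_div_cpow A).mul hE).const_mul c
  have hc1 : (1 : ℂ) = c * (4 ^ A * 1) := by
    refine tendsto_nhds_unique hvlim (hlim.congr' ?_)
    filter_upwards [hev, self_mem_nhdsWithin] with q h1 hq
    have h2 := hc _ h1
    have hq0 : (q : ℂ) ^ A ≠ 0 := ofReal_cpow_ne_zero hq A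
    simp only [hcOne, exp_neg_neg_log hq, wHalf_neg_log_cpow hq] at h2
    rw [show rhoOne ks kl - -l = A by rw [hA]; ring, ← hA, ← hv] at h2
    refine mul_left_cancel₀ hq0 ?_
    linear_combination -h2
  rw [hc x hx, Complex.cpow_neg]
  have : (4 : ℂ) ^ A ≠ 0 := by simp [Complex.cpow_eq_zero_iff]
  have hc2 : c = (4 ^ A)⁻¹ := by field_simp; linear_combination -hc1
  rw [hc2]

/-- The rank one hypergeometric function. -/
def hypOne (ks kl l : ℂ) (x : ℝ) : ℂ :=
  (wHalf x : ℂ) ^ (rhoOne ks kl + l) *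
    gaussF (rhoOne ks kl + l) (l + ks / 2 + 1 / 2) (ks + kl + 1 / 2) ((tauHalf x : ℂ) ^ 2)

/-- The rank one `c`-function. -/
def cOne (ks kl l : ℂ) : ℂ :=
  4 ^ (rhoOne ks kl - l) * (Complex.Gamma (ks + kl + 1 / 2) * Complex.Gamma (2 * l) /
    (Complex.Gamma (rhoOne ks kl + l) * Complex.Gamma (l + ks / 2 + 1 / 2)))

theorem hypOne_neg (ks kl l : ℂ) (x : ℝ) : hypOne ks kl l (-x) = hypOne ks kl l x := by
  rw [hypOne, hypOne, wHalf_neg, tauHalf_neg]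
  push_cast
  rw [neg_sq]

theorem hypOne_eq {ks kl l : ℂ} (hC : NotPole (ks + kl + 1 / 2)) (hl : NotInt (2 * l)) {x : ℝ}
    (hx : 0 < x) :
    hypOne ks kl l x = cOne ks kl l * hcOne ks kl l x + cOne ks kl (-l) * hcOne ks kl (-l) x := by
  set A := rhoOne ks kl + l with hA
  set B := l + ks / 2 + 1 / 2 with hB
  set C := ks + kl + 1 / 2 with hC'
  have hsl : C - A - B = -(2 * l) := by rw [hC', hA, hB, rhoOne]; ring
  have hs : NotInt (C - A - B) := hl.neg.of_eq hsl.symm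
  have h1 := gaussF_connection hC hs (wHalf_mem hx)
  have h2 := hcOne_neg_eq ks kl hl hx
  have h3 := hcOne_neg_eq ks kl (hl.neg.of_eq (show -(2 * l) = 2 * (-l) by ring)) hx
  rw [hsl] at h1
  rw [neg_neg] at h3
  have e0 : ((1 - wHalf x : ℝ) : ℂ) = (tauHalf x : ℂ) ^ 2 := by rw [wHalf]; push_cast; ring
  have hw : (wHalf x : ℂ) ≠ 0 := by exact_mod_cast (wHalf_pos x).ne'
  have n1 : (4 : ℂ) ^ (rhoOne ks kl - l) ≠ 0 := by simp [Complex.cpow_eq_zero_iff]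
  have n2 : (4 : ℂ) ^ (rhoOne ks kl + l) ≠ 0 := by simp [Complex.cpow_eq_zero_iff]
  rw [hypOne, cOne, cOne, h2, h3, ← e0, ← hA, ← hB, ← hC', h1, hA, hB, hC']
  rw [show ks + kl + 1 / 2 - (rhoOne ks kl + l) = -l + ks / 2 + 1 / 2 by rw [rhoOne]; ring,
    show ks + kl + 1 / 2 - (l + ks / 2 + 1 / 2) = rhoOne ks kl - l by rw [rhoOne]; ring,
    show (1 : ℂ) - -(2 * l) = 1 + 2 * l by ring, show 1 + -(2 * l) = 1 + 2 * -l by ring,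
    neg_neg, show -(rhoOne ks kl + -l) = -(rhoOne ks kl - l) by ring, Complex.cpow_neg 4,
    Complex.cpow_neg 4, show rhoOne ks kl + -l = rhoOne ks kl - l by ring,
    show rhoOne ks kl - -l = rhoOne ks kl + l by ring, show 2 * -l = -(2 * l) by ring,
    show (wHalf x : ℂ) ^ (rhoOne ks kl - l) = (wHalf x : ℂ) ^ (rhoOne ks kl + l) *
      (wHalf x : ℂ) ^ (-(2 * l)) by rw [← Complex.cpow_add _ _ hw]; congr 1; ring]
  generalize (4 : ℂ) ^ (rhoOne ks kl - l) = X₁ at *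
  generalize (4 : ℂ) ^ (rhoOne ks kl + l) = X₂ at *
  generalize (wHalf x : ℂ) ^ (-(2 * l)) = X₃
  generalize Complex.Gamma (rhoOne ks kl - l) = G₁
  generalize Complex.Gamma (rhoOne ks kl + l) = G₂
  generalize Complex.Gamma (-l + ks / 2 + 1 / 2) = G₃
  generalize Complex.Gamma (l + ks / 2 + 1 / 2) = G₄
  field_simp
  ring

theorem norm_ofReal_add_nat {R : ℝ} (hR : 0 ≤ R) (j : ℕ) : ‖(R : ℂ) + j‖ = R + j := by
  rw [← Complex.ofReal_natCast, ← Complex.ofReal_add, Complex.norm_real,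
    Real.norm_of_nonneg (by positivity)]

theorem norm_gaussCoef_le_of_le {a b c : ℂ} {R : ℝ} (ha : ‖a‖ ≤ R) (hb : ‖b‖ ≤ R) (m : ℕ) :
    ‖gaussCoef a b c m‖ ≤ ‖gaussCoef R R c m‖ := by
  have hR : 0 ≤ R := (norm_nonneg a).trans ha
  simp only [gaussCoef, norm_prod]
  refine Finset.prod_le_prod (fun j _ => norm_nonneg _) fun j _ => ?_
  rw [norm_div, norm_div, norm_mul, norm_mul, norm_mul, norm_ofReal_add_nat hR]
  gcongr
  · exact (norm_add_natCast_le a j).trans (by gcongr)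
  · exact (norm_add_natCast_le b j).trans (by gcongr)

theorem continuousAt_gaussF {X : Type*} [TopologicalSpace X] {a b z : X → ℂ} {c : ℂ} {x : X}
    (ha : ContinuousAt a x) (hb : ContinuousAt b x) (hz : ContinuousAt z x) (h1 : ‖z x‖ < 1) :
    ContinuousAt (fun y => gaussF (a y) (b y) c (z y)) x := by
  obtain ⟨r, hzr, hr1⟩ := exists_between h1
  set R := max ‖a x‖ ‖b x‖ + 1
  have hr0 : 0 ≤ r := (norm_nonneg _).trans hzr.le
  have hS := tame_gaussCoef R R c r hr0 hr1
  refine tendsto_tsum_of_dominated_convergence hS (fun m => ?_) ?_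
  · refine Tendsto.mul ?_ (hz.tendsto.pow m)
    simp only [gaussCoef]
    refine tendsto_finsetProd _ fun j _ => ?_
    exact ((ha.tendsto.add_const _).mul (hb.tendsto.add_const _)).div_const _
  · have e1 : ∀ᶠ y in 𝓝 x, ‖a y‖ ≤ R := (ha.norm.tendsto).eventually_le_const
      (lt_of_le_of_lt (le_max_left _ _) (lt_add_one _))
    have e2 : ∀ᶠ y in 𝓝 x, ‖b y‖ ≤ R := (hb.norm.tendsto).eventually_le_const
      (lt_of_le_of_lt (le_max_right _ _) (lt_add_one _))
    have e3 : ∀ᶠ y in 𝓝 x, ‖z y‖ ≤ r := (hz.norm.tendsto).eventually_le_const hzr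
    filter_upwards [e1, e2, e3] with y h1 h2 h3 m
    rw [norm_mul, norm_pow]
    gcongr
    exact norm_gaussCoef_le_of_le h1 h2 m

theorem tauHalf_sq_lt_one (x : ℝ) : tauHalf x ^ 2 < 1 := by
  have := wHalf_pos x
  rw [wHalf] at this
  linarith

theorem continuous_hypOne (ks kl : ℂ) : Continuous fun p : ℂ × ℝ => hypOne ks kl p.1 p.2 := by
  refine continuous_iff_continuousAt.2 fun p => ?_
  have hw : ContinuousAt (fun p : ℂ × ℝ => (wHalf p.2 : ℂ)) p :=
    Complex.continuous_ofReal.continuousAt.comp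
      ((hasDerivAt_wHalf p.2).continuousAt.comp continuousAt_snd)
  have ht : ContinuousAt (fun p : ℂ × ℝ => (tauHalf p.2 : ℂ)) p :=
    Complex.continuous_ofReal.continuousAt.comp
      ((hasDerivAt_tauHalf p.2).continuousAt.comp continuousAt_snd)
  refine (hw.cpow (by fun_prop) (by simpa using wHalf_pos p.2)).mul
    (continuousAt_gaussF (by fun_prop) (by fun_prop) (ht.pow 2) ?_)
  rw [← Complex.ofReal_pow, Complex.norm_real, Real.norm_of_nonneg (sq_nonneg _)]
  exact tauHalf_sq_lt_one _

/-- The series `∑ u ^ m / ((c)_m m!)`. -/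
def besselSum (c u : ℂ) : ℂ := ∑' m : ℕ, ∏ j ∈ Finset.range m, (u / ((c + j) * (1 + j)))

theorem normBessel_eq {α z : ℂ} (hα : NotPole (α + 1)) (hz : z ≠ 0) :
    normBessel α z = besselSum (α + 1) (-(z / 2) ^ 2) := by
  have h2 : (2 : ℂ) ^ α ≠ 0 := by simp [Complex.cpow_eq_zero_iff]
  have hzα : z ^ α ≠ 0 := by simp [Complex.cpow_eq_zero_iff, hz]
  have hdiv : (z / 2) ^ α = z ^ α / 2 ^ α := by
    have h3 : z / 2 = ((2⁻¹ : ℝ) : ℂ) * z := by push_cast; ring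
    rw [h3, Complex.cpow_def_of_ne_zero (by simp [hz]), Complex.cpow_def_of_ne_zero hz,
      Complex.cpow_def_of_ne_zero two_ne_zero, Complex.log_ofReal_mul (by norm_num) hz,
      ← Complex.exp_sub, Real.log_inv]
    congr 1
    have h4 : Complex.log 2 = (Real.log 2 : ℂ) := by
      rw [Complex.ofReal_log (by norm_num)]; norm_num
    rw [h4]
    push_cast
    ring
  rw [normBessel, besselJ, hdiv, Complex.cpow_neg, besselSum, ← mul_assoc, ← tsum_mul_left]
  congr 1
  funext m
  have e : 2 ^ α * Complex.Gamma (α + 1) * (z ^ α)⁻¹ * (z ^ α / 2 ^ α) =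
      Complex.Gamma (α + 1) := by field_simp
  rw [e]
  induction m with
  | zero =>
    have := Complex.Gamma_ne_zero hα
    simp [this]
  | succ m ih =>
    rw [Finset.prod_range_succ, ← ih]
    have h4 := hα.add_ne m
    have h5 := one_add_nat_ne_zero m
    have h6 : Complex.Gamma ((m + 1 : ℕ) + α + 1) = (α + 1 + m) * Complex.Gamma (m + α + 1) := by
      rw [← show α + 1 + m = m + α + 1 by ring, ← Complex.Gamma_add_one _ h4]
      congr 1
      push_cast
      ring
    have h7 : Complex.Gamma (m + α + 1) ≠ 0 := by
      rw [show (m : ℂ) + α + 1 = α + 1 + m by ring]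
      exact Complex.Gamma_ne_zero (hα.add_nat m)
    have h8 : (m.factorial : ℂ) ≠ 0 := by exact_mod_cast m.factorial_ne_zero
    rw [h6, Nat.factorial_succ]
    push_cast
    rw [show (m : ℂ) + 1 = 1 + m by ring]
    field_simp
    ring

theorem tendsto_gaussF_bessel {ι : Type*} {F : Filter ι} {a b z : ι → ℂ} {c u : ℂ}
    (ha : Tendsto (fun i => a i * z i) F (𝓝 u)) (hb : Tendsto (fun i => b i * z i) F (𝓝 u))
    (hz : Tendsto z F (𝓝 0)) :
    Tendsto (fun i => gaussF (a i) (b i) c (z i ^ 2)) F (𝓝 (besselSum c (u ^ 2))) := by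
  set K := 2 * (‖u‖ + 1) with hK
  have hK0 : 0 ≤ K := by positivity
  have hS := tame_gaussCoef (K : ℂ) (K : ℂ) c (1 / 4) (by norm_num) (by norm_num)
  have hterm : ∀ i m, gaussCoef (a i) (b i) c m * (z i ^ 2) ^ m = ∏ j ∈ Finset.range m,
      (((a i * z i + j * z i) * (b i * z i + j * z i)) / ((c + j) * (1 + j))) := by
    intro i m
    rw [gaussCoef, show (z i ^ 2) ^ m = ∏ _j ∈ Finset.range m, z i ^ 2 by simp,
      ← Finset.prod_mul_distrib]
    refine Finset.prod_congr rfl fun j _ => ?_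
    ring
  refine tendsto_tsum_of_dominated_convergence hS (fun m => ?_) ?_
  · simp only [hterm]
    refine tendsto_finsetProd _ fun j _ => ?_
    have h1 := ((ha.add (hz.const_mul (j : ℂ))).mul (hb.add (hz.const_mul (j : ℂ)))).div_const
      ((c + j) * (1 + j))
    rw [mul_zero, add_zero] at h1
    rwa [sq]
  · have e1 := ha.norm.eventually_le_const (lt_add_one _)
    have e2 := hb.norm.eventually_le_const (lt_add_one _)
    have e3 := hz.norm.eventually_le_const (show ‖(0 : ℂ)‖ < 1 / 2 by simp)
    filter_upwards [e1, e2, e3] with i h1 h2 h3 m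
    have h4 : ∀ (v : ℂ) (j : ℕ), ‖v‖ ≤ ‖u‖ + 1 → ‖v + j * z i‖ ≤ (K + j) / 2 := by
      intro v j hv
      calc ‖v + j * z i‖ ≤ ‖v‖ + j * ‖z i‖ := by simpa using norm_add_le v (j * z i)
        _ ≤ (‖u‖ + 1) + j * (1 / 2) := by gcongr
        _ = (K + j) / 2 := by rw [hK]; ring
    rw [hterm, gaussCoef, norm_prod, norm_prod,
      show (1 / 4 : ℝ) ^ m = ∏ _j ∈ Finset.range m, (1 / 4 : ℝ) by simp, ← Finset.prod_mul_distrib]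
    refine Finset.prod_le_prod (fun j _ => norm_nonneg _) fun j _ => ?_
    rw [norm_div, norm_div, norm_mul, norm_mul _ (K + j : ℂ), norm_ofReal_add_nat hK0]
    calc _ ≤ (K + j) / 2 * ((K + j) / 2) / ‖(c + j) * (1 + j)‖ := by
          gcongr
          · exact h4 _ _ h1
          · exact h4 _ _ h2
      _ = _ := by ring

theorem tendsto_slope_scale {f : ℝ → ℝ} {f' : ℝ} (hf : HasDerivAt f f' 0) (h0 : f 0 = 0) (s : ℝ) :
    Tendsto (fun ε : ℝ => ε⁻¹ * f (s * ε)) (𝓝[>] 0) (𝓝 (f' * s)) := by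
  have h1 : HasDerivAt (fun ε : ℝ => f (s * ε)) (f' * s) 0 := by
    have h2 : HasDerivAt (fun ε : ℝ => s * ε) s 0 := by
      simpa using (hasDerivAt_id (0 : ℝ)).const_mul s
    have hf' : HasDerivAt f f' (s * 0) := by rwa [mul_zero]
    exact hf'.comp (0 : ℝ) h2
  have h2 := h1.tendsto_slope_zero_right
  simpa [h0] using h2

theorem tendsto_hypOne (ks kl lam : ℂ) (t : ℝ) :
    Tendsto (fun ε : ℝ => hypOne ks kl ((ε : ℂ)⁻¹ * lam / 2) (2 * (ε * t))) (𝓝[>] 0)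
      (𝓝 (besselSum (ks + kl + 1 / 2) ((lam * t / 2) ^ 2))) := by
  have hw0 : wHalf 0 = 1 := by simp [wHalf, tauHalf]
  have ht0 : tauHalf 0 = 0 := by simp [tauHalf]
  have hid : Tendsto (fun ε : ℝ => ε) (𝓝[>] 0) (𝓝 0) := nhdsWithin_le_nhds
  have hsc : Tendsto (fun ε : ℝ => 2 * t * ε) (𝓝[>] 0) (𝓝 0) := by
    simpa using hid.const_mul (2 * t)
  have s1 : Tendsto (fun ε : ℝ => ε⁻¹ * tauHalf (2 * t * ε)) (𝓝[>] 0) (𝓝 t) := by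
    have := tendsto_slope_scale (hasDerivAt_tauHalf 0) ht0 (2 * t)
    rw [hw0] at this
    convert this using 2
    ring
  have hlog : HasDerivAt (fun x => Real.log (wHalf x)) 0 0 := by
    have := (hasDerivAt_wHalf 0).log (wHalf_pos 0).ne'
    simpa [ht0] using this
  have s2 : Tendsto (fun ε : ℝ => ε⁻¹ * Real.log (wHalf (2 * t * ε))) (𝓝[>] 0) (𝓝 0) := by
    have := tendsto_slope_scale hlog (by simp [hw0]) (2 * t)
    simpa using this
  have t1 : Tendsto (fun ε : ℝ => tauHalf (2 * t * ε)) (𝓝[>] 0) (𝓝 0) := by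
    have := (hasDerivAt_tauHalf 0).continuousAt.tendsto.comp hsc
    rwa [ht0] at this
  have t2 : Tendsto (fun ε : ℝ => Real.log (wHalf (2 * t * ε))) (𝓝[>] 0) (𝓝 0) := by
    have := hlog.continuousAt.tendsto.comp hsc
    simp only [hw0, Real.log_one] at this
    exact this
  have c1 := (Complex.continuous_ofReal.tendsto _).comp s1
  have c2 := (Complex.continuous_ofReal.tendsto _).comp s2
  have c3 := (Complex.continuous_ofReal.tendsto _).comp t1
  have c4 := (Complex.continuous_ofReal.tendsto _).comp t2
  simp only [Complex.ofReal_zero] at c2 c3 c4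
  have hA : ∀ a : ℂ, Tendsto (fun ε : ℝ => (a + (ε : ℂ)⁻¹ * lam / 2) * (tauHalf (2 * t * ε) : ℂ))
      (𝓝[>] 0) (𝓝 (lam * t / 2)) := by
    intro a
    have h := (c3.const_mul a).add (c1.const_mul (lam / 2))
    rw [mul_zero, zero_add] at h
    convert h using 2
    · simp only [Function.comp, Complex.ofReal_mul, Complex.ofReal_inv]
      ring
    · ring
  have hexp : Tendsto (fun ε : ℝ => (rhoOne ks kl + (ε : ℂ)⁻¹ * lam / 2) *
      (Real.log (wHalf (2 * t * ε)) : ℂ)) (𝓝[>] 0) (𝓝 0) := by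
    have h := (c4.const_mul (rhoOne ks kl)).add (c2.const_mul (lam / 2))
    rw [mul_zero, mul_zero, zero_add] at h
    refine h.congr fun ε => ?_
    simp only [Function.comp, Complex.ofReal_mul, Complex.ofReal_inv]
    ring
  have hF := tendsto_gaussF_bessel (c := ks + kl + 1 / 2) (hA (rhoOne ks kl))
    (hA (ks / 2 + 1 / 2)) c3
  have hE := (Complex.continuous_exp.tendsto 0).comp hexp
  rw [Complex.exp_zero] at hE
  have h := hE.mul hF
  rw [one_mul] at h
  refine h.congr fun ε => ?_
  simp only [Function.comp]
  rw [hypOne, Complex.cpow_def_of_ne_zero (by exact_mod_cast (wHalf_pos _).ne'),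
    ← Complex.ofReal_log (wHalf_pos _).le, mul_comm (Real.log _ : ℂ),
    show 2 * (ε * t) = 2 * t * ε by ring,
    show (ε : ℂ)⁻¹ * lam / 2 + ks / 2 + 1 / 2 = ks / 2 + 1 / 2 + (ε : ℂ)⁻¹ * lam / 2 by ring]

section Pair

variable {n : ℕ} {R : Type*} [CommRing R]

theorem pair_add_left (μ ν : Fin n → ℤ) (v : Fin n → R) : pair (μ + ν) v = pair μ v + pair ν v := by
  simp [pair, add_mul, Finset.sum_add_distrib]

theorem pair_sub_left (μ ν : Fin n → ℤ) (v : Fin n → R) : pair (μ - ν) v = pair μ v - pair ν v := by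
  simp [pair, sub_mul, Finset.sum_sub_distrib]

theorem pair_zero_left (v : Fin n → R) : pair (0 : Fin n → ℤ) v = 0 := by simp [pair]

theorem pair_nsmul_left (m : ℕ) (μ : Fin n → ℤ) (v : Fin n → R) : pair (m • μ) v = m * pair μ v := by
  simp [pair, Finset.mul_sum, mul_assoc]

theorem pair_single (p : Fin n) (c : ℤ) (v : Fin n → R) :
    pair (Pi.single p c) v = c * v p := by
  simp only [pair, Pi.single_apply]
  rw [Finset.sum_eq_single p]
  · simp
  · intro i _ hi; simp [hi]
  · simp

theorem pair_add_right (μ : Fin n → ℤ) (v w : Fin n → R) : pair μ (v + w) = pair μ v + pair μ w := by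
  simp [pair, mul_add, Finset.sum_add_distrib]

theorem pair_smul_right (μ : Fin n → ℤ) (c : R) (v : Fin n → R) : pair μ (c • v) = c * pair μ v := by
  simp only [pair, Pi.smul_apply, smul_eq_mul, Finset.mul_sum]
  exact Finset.sum_congr rfl fun i _ => by ring

theorem pair_self_single (p : Fin n) (c : ℤ) :
    pair (Pi.single p c : Fin n → ℤ) (Pi.single p c : Fin n → ℤ) = c ^ 2 := by
  rw [pair_single]; simp [sq]

theorem pair_self_sub {i j : Fin n} (h : i ≠ j) :
    pair (Pi.single i 1 - Pi.single j 1 : Fin n → ℤ)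
      (Pi.single i 1 - Pi.single j 1 : Fin n → ℤ) = 2 := by
  rw [pair_sub_left, pair_single, pair_single]; simp [h, h.symm]

theorem pair_self_add {i j : Fin n} (h : i ≠ j) :
    pair (Pi.single i 1 + Pi.single j 1 : Fin n → ℤ)
      (Pi.single i 1 + Pi.single j 1 : Fin n → ℤ) = 2 := by
  rw [pair_add_left, pair_single, pair_single]; simp [h, h.symm]

end Pair

theorem mem_middleRoots {n : ℕ} {α : Fin n → ℤ} : α ∈ middleRoots n ↔ ∃ i j : Fin n, i < j ∧
    (α = Pi.single i 1 - Pi.single j 1 ∨ α = Pi.single i 1 + Pi.single j 1) := by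
  simp only [middleRoots, Finset.mem_union, Finset.mem_image, Finset.mem_filter, Finset.mem_univ,
    true_and, Prod.exists]
  constructor
  · rintro (⟨i, j, h, rfl⟩ | ⟨i, j, h, rfl⟩)
    · exact ⟨i, j, h, Or.inl rfl⟩
    · exact ⟨i, j, h, Or.inr rfl⟩
  · rintro ⟨i, j, h, (rfl | rfl)⟩
    · exact Or.inl ⟨i, j, h, rfl⟩
    · exact Or.inr ⟨i, j, h, rfl⟩

theorem mem_posRoots {n : ℕ} {α : Fin n → ℤ} : α ∈ posRoots n ↔ (∃ p, α = Pi.single p 1) ∨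
    (∃ p, α = Pi.single p 2) ∨ α ∈ middleRoots n := by
  simp only [posRoots, Finset.mem_union, Finset.mem_image, Finset.mem_univ, true_and, or_assoc,
    eq_comm]

theorem pair_self_middle {n : ℕ} {α : Fin n → ℤ} (h : α ∈ middleRoots n) : pair α α = 2 := by
  obtain ⟨i, j, hij, (rfl | rfl)⟩ := mem_middleRoots.1 h
  · exact pair_self_sub hij.ne
  · exact pair_self_add hij.ne

@[to_additive]
theorem prod_filter_lt {n : ℕ} {M : Type*} [CommMonoid M] (f : Fin n × Fin n → M) :
    ∏ q ∈ (Finset.univ : Finset (Fin n × Fin n)).filter (fun q => q.1 < q.2), f q =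
      ∏ i, ∏ j ∈ Finset.Ioi i, f (i, j) := by
  rw [Finset.prod_filter, Fintype.prod_prod_type]
  refine Finset.prod_congr rfl fun i _ => ?_
  rw [← Finset.prod_filter]
  refine Finset.prod_congr ?_ fun _ _ => rfl
  ext j
  simp

@[to_additive]
theorem prod_middleRoots {n : ℕ} {M : Type*} [CommMonoid M] (f : (Fin n → ℤ) → M) :
    ∏ α ∈ middleRoots n, f α = ∏ i, ∏ j ∈ Finset.Ioi i,
      (f (Pi.single i 1 - Pi.single j 1) * f (Pi.single i 1 + Pi.single j 1)) := by
  rw [middleRoots, Finset.prod_union, Finset.prod_image, Finset.prod_image, prod_filter_lt,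
    prod_filter_lt, ← Finset.prod_mul_distrib]
  · exact Finset.prod_congr rfl fun i _ => by rw [← Finset.prod_mul_distrib]
  · rintro ⟨i, j⟩ h ⟨i', j'⟩ h' e
    simp only [Finset.coe_filter, Finset.mem_univ, true_and, Set.mem_ofPred_eq] at h h' e
    have e1 := congrFun e i
    have e2 := congrFun e j
    have e3 := congrFun e i'
    have e4 := congrFun e j'
    simp only [Pi.add_apply, Pi.single_apply] at e1 e2 e3 e4
    ext <;> grind
  · rintro ⟨i, j⟩ h ⟨i', j'⟩ h' e
    simp only [Finset.coe_filter, Finset.mem_univ, true_and, Set.mem_ofPred_eq] at h h' e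
    have e1 := congrFun e i
    have e2 := congrFun e j
    simp only [Pi.sub_apply, Pi.single_apply] at e1 e2
    ext <;> grind
  · rw [Finset.disjoint_left]
    intro α h h'
    simp only [Finset.mem_image, Finset.mem_filter, Finset.mem_univ, true_and, Prod.exists] at h h'
    obtain ⟨i, j, hij, rfl⟩ := h
    obtain ⟨i', j', hij', e⟩ := h'
    have e2 := congrFun e j
    simp only [Pi.sub_apply, Pi.add_apply, Pi.single_apply] at e2
    grind

@[to_additive]
theorem prod_posRoots {n : ℕ} {M : Type*} [CommMonoid M] (f : (Fin n → ℤ) → M) :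
    ∏ α ∈ posRoots n, f α = (∏ p, f (Pi.single p 1)) * (∏ p, f (Pi.single p 2)) *
      ∏ α ∈ middleRoots n, f α := by
  rw [posRoots, Finset.prod_union, Finset.prod_union, Finset.prod_image, Finset.prod_image]
  · intro p _ q _ e
    have := congrFun e p
    simp only [Pi.single_apply] at this
    grind
  · intro p _ q _ e
    have := congrFun e p
    simp only [Pi.single_apply] at this
    grind
  · rw [Finset.disjoint_left]
    intro α h h'
    simp only [Finset.mem_image, Finset.mem_univ, true_and] at h h'
    obtain ⟨p, rfl⟩ := h
    obtain ⟨q, e⟩ := h'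
    have := congrFun e q
    simp only [Pi.single_apply] at this
    grind
  · rw [Finset.disjoint_left]
    intro α h h'
    have h2 := pair_self_middle h'
    simp only [Finset.mem_union, Finset.mem_image, Finset.mem_univ, true_and] at h
    rcases h with ⟨p, rfl⟩ | ⟨p, rfl⟩
    · rw [pair_self_single] at h2; norm_num at h2
    · rw [pair_self_single] at h2; norm_num at h2

section RootMult

variable {n : ℕ} (k : Mult)

theorem rootMult_short (p : Fin n) : rootMult k (Pi.single p 1 : Fin n → ℤ) = k.1 := by
  simp [rootMult, pair_self_single]

theorem rootMult_long (p : Fin n) : rootMult k (Pi.single p 2 : Fin n → ℤ) = k.2.2 := by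
  simp [rootMult, pair_self_single]

theorem rootMult_middle {α : Fin n → ℤ} (h : α ∈ middleRoots n) : rootMult k α = k.2.1 := by
  simp [rootMult, pair_self_middle h]

theorem halfRootMult_short (p : Fin n) : halfRootMult k (Pi.single p 1 : Fin n → ℤ) = 0 := by
  simp [halfRootMult, pair_self_single]

theorem halfRootMult_long (p : Fin n) : halfRootMult k (Pi.single p 2 : Fin n → ℤ) = k.1 := by
  simp [halfRootMult, pair_self_single]

theorem halfRootMult_middle {α : Fin n → ℤ} (h : α ∈ middleRoots n) : halfRootMult k α = 0 := by
  simp [halfRootMult, pair_self_middle h]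

theorem corootPair_short (v : Fin n → ℂ) (p : Fin n) :
    corootPair v (Pi.single p 1 : Fin n → ℤ) = 2 * v p := by
  simp [corootPair, pair_single]

theorem corootPair_long (v : Fin n → ℂ) (p : Fin n) :
    corootPair v (Pi.single p 2 : Fin n → ℤ) = v p := by
  simp [corootPair, pair_single]
  ring

theorem corootPair_middle (v : Fin n → ℂ) {α : Fin n → ℤ} (h : α ∈ middleRoots n) :
    corootPair v α = pair α v := by
  rw [corootPair, pair_self_middle h]; push_cast; ring

theorem rho_apply (i : Fin n) :
    rho n k i = rhoOne k.1 k.2.2 + ((n - 1 - (i : ℕ) : ℕ) : ℂ) * k.2.1 := by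
  have hm : ∑ α ∈ middleRoots n, rootMult k α * (α i : ℂ) =
      ∑ α ∈ middleRoots n, k.2.1 * (α i : ℂ) :=
    Finset.sum_congr rfl fun α h => by rw [rootMult_middle k h]
  rw [rho, sum_posRoots, hm, sum_middleRoots]
  simp only [rootMult_short, rootMult_long, Pi.single_apply, Pi.add_apply, Pi.sub_apply]
  have h1 : ∀ c : ℤ, ∀ z : ℂ, ∑ p : Fin n, z * ((if i = p then c else 0 : ℤ) : ℂ) = z * c := by
    intro c z
    rw [Finset.sum_eq_single i]
    · simp
    · intro b _ hb; simp [hb.symm]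
    · simp
  rw [h1, h1]
  have h2 : ∀ a b : Fin n, k.2.1 * (((if i = a then 1 else 0) - (if i = b then 1 else 0) : ℤ) : ℂ) +
      k.2.1 * (((if i = a then 1 else 0) + (if i = b then 1 else 0) : ℤ) : ℂ) =
      if i = a then 2 * k.2.1 else 0 := by
    intro a b
    split_ifs <;> push_cast <;> ring
  simp only [h2]
  rw [Finset.sum_eq_single i]
  · simp only [if_true, Finset.sum_const, Fin.card_Ioi, nsmul_eq_mul, rhoOne]
    push_cast
    ring
  · intro b _ hb; simp [hb.symm]
  · simp

end RootMult

section Chamber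

variable {n : ℕ} {x : Fin n → ℝ}

theorem chamber_pos (hx : x ∈ chamber n) (i : Fin n) : 0 < x i := by
  have := hx _ (mem_posRoots.2 (Or.inl ⟨i, rfl⟩))
  simpa [pair_single] using this

theorem mem_chamber (h1 : ∀ i, 0 < x i) (h2 : ∀ i j, i < j → x j < x i) : x ∈ chamber n := by
  intro α hα
  rcases mem_posRoots.1 hα with ⟨p, rfl⟩ | ⟨p, rfl⟩ | h
  · simpa [pair_single] using h1 p
  · simpa [pair_single] using h1 p
  · obtain ⟨i, j, hij, (rfl | rfl)⟩ := mem_middleRoots.1 h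
    · simpa [pair_sub_left, pair_single] using h2 i j hij
    · have := h1 i; have := h1 j
      simp only [pair_add_left, pair_single, Int.cast_one, one_mul]
      linarith

theorem continuous_pair (α : Fin n → ℤ) : Continuous fun x : Fin n → ℝ => pair α x := by
  unfold pair
  fun_prop

theorem isOpen_chamber (n : ℕ) : IsOpen (chamber n) := by
  have : chamber n = ⋂ α ∈ posRoots n, {x | 0 < pair α x} := by
    ext x; simp [chamber]
  rw [this]
  exact isOpen_biInter_finset fun α _ => isOpen_lt continuous_const (continuous_pair α)

theorem chamber_smul (hx : x ∈ chamber n) {s : ℝ} (hs : 0 < s) : s • x ∈ chamber n := by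
  intro α hα
  rw [pair_smul_right]
  exact mul_pos hs (hx α hα)

theorem chamber_nonempty (n : ℕ) : (chamber n).Nonempty := by
  refine ⟨fun i => (n : ℝ) - i, mem_chamber (fun i => ?_) fun i j h => ?_⟩
  · simp
  · have : ((i : ℕ) : ℝ) < ((j : ℕ) : ℝ) := by exact_mod_cast h
    simpa using this

end Chamber

section Cone

variable {n : ℕ}

theorem posRoot_mem_rootCone {α : Fin n → ℤ} (h : α ∈ posRoots n) : α ∈ rootCone n :=
  AddSubmonoid.subset_closure h

theorem rootCone_bound {x : Fin n → ℝ} (hx : x ∈ chamber n) :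
    ∃ δ : ℝ, 0 < δ ∧ ∀ μ ∈ rootCone n, δ * ∑ i, |(μ i : ℝ)| ≤ pair μ x := by
  obtain ⟨δ, hδ, h⟩ : ∃ δ : ℝ, 0 < δ ∧ ∀ α ∈ posRoots n, δ * ∑ i, |(α i : ℝ)| ≤ pair α x := by
    rcases (posRoots n).eq_empty_or_nonempty with h0 | h0
    · exact ⟨1, one_pos, by simp [h0]⟩
    · set M := ∑ α ∈ posRoots n, ∑ i, |(α i : ℝ)| with hM
      have hM0 : 0 ≤ M := Finset.sum_nonneg fun _ _ => Finset.sum_nonneg fun _ _ => abs_nonneg _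
      obtain ⟨β, hβ, hmin⟩ := (posRoots n).exists_min_image (fun α => pair α x) h0
      refine ⟨pair β x / (M + 1), div_pos (hx β hβ) (by linarith), fun α hα => ?_⟩
      have h1 : ∑ i, |(α i : ℝ)| ≤ M + 1 := by
        have := Finset.single_le_sum (f := fun α : Fin n → ℤ => ∑ i, |(α i : ℝ)|)
          (fun _ _ => Finset.sum_nonneg fun _ _ => abs_nonneg _) hα
        linarith
      calc pair β x / (M + 1) * ∑ i, |(α i : ℝ)| ≤ pair β x / (M + 1) * (M + 1) := by
            have := (hx β hβ).le
            gcongr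
        _ = pair β x := by field_simp
        _ ≤ pair α x := hmin α hα
  refine ⟨δ, hδ, fun μ hμ => ?_⟩
  induction hμ using AddSubmonoid.closure_induction with
  | mem α hα => exact h α hα
  | zero => simp [pair]
  | add μ ν _ _ h1 h2 =>
    rw [pair_add_left]
    refine le_trans ?_ (add_le_add h1 h2)
    rw [← mul_add, ← Finset.sum_add_distrib]
    gcongr
    simp only [Pi.add_apply, Int.cast_add]
    exact abs_add_le _ _

theorem rootCone_pos {x : Fin n → ℝ} (hx : x ∈ chamber n) {μ : Fin n → ℤ} (hμ : μ ∈ rootCone n)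
    (h0 : μ ≠ 0) : 0 < pair μ x := by
  obtain ⟨δ, hδ, h⟩ := rootCone_bound hx
  refine lt_of_lt_of_le (mul_pos hδ ?_) (h μ hμ)
  obtain ⟨i, hi⟩ := Function.ne_iff.1 h0
  refine lt_of_lt_of_le (a := 0) ?_ (Finset.single_le_sum (f := fun i => |(μ i : ℝ)|)
    (fun _ _ => abs_nonneg _) (Finset.mem_univ i))
  exact abs_pos.2 (by exact_mod_cast hi)

theorem rootCone_finite {x : Fin n → ℝ} (hx : x ∈ chamber n) (c : ℝ) :
    {μ : rootCone n | pair (μ : Fin n → ℤ) x ≤ c}.Finite := by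
  obtain ⟨δ, hδ, h⟩ := rootCone_bound hx
  obtain ⟨N, hN⟩ := exists_nat_ge (c / δ)
  have hfin : (Set.Icc (fun _ => -(N : ℤ)) (fun _ => (N : ℤ)) : Set (Fin n → ℤ)).Finite :=
    Set.finite_Icc _ _
  refine (hfin.preimage (f := fun μ : rootCone n => (μ : Fin n → ℤ))
    Subtype.val_injective.injOn).subset ?_
  intro μ hμ
  have h1 : ∀ i, |((μ : Fin n → ℤ) i : ℝ)| ≤ N := by
    intro i
    have h2 := h μ μ.2
    have h3 := Finset.single_le_sum (f := fun i => |((μ : Fin n → ℤ) i : ℝ)|)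
      (fun _ _ => abs_nonneg _) (Finset.mem_univ i)
    have h4 : pair (μ : Fin n → ℤ) x ≤ c := hμ
    refine le_trans ?_ hN
    rw [le_div_iff₀ hδ]
    nlinarith
  constructor <;> intro i
  · have := neg_le_of_abs_le (h1 i)
    exact_mod_cast this
  · have := le_of_abs_le (h1 i)
    exact_mod_cast this

theorem rootCone_add_eq_zero {μ ν : rootCone n} (h : μ + ν = 0) : μ = 0 ∧ ν = 0 := by
  obtain ⟨x, hx⟩ := chamber_nonempty n
  have hv : (μ : Fin n → ℤ) + ν = 0 := congrArg Subtype.val h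
  have h1 : pair (μ : Fin n → ℤ) x + pair (ν : Fin n → ℤ) x = 0 := by
    rw [← pair_add_left, hv, pair_zero_left]
  have key : ∀ κ : rootCone n, κ = 0 ∨ 0 < pair (κ : Fin n → ℤ) x := by
    intro κ
    by_cases h0 : (κ : Fin n → ℤ) = 0
    · exact Or.inl (Subtype.ext h0)
    · exact Or.inr (rootCone_pos hx κ.2 h0)
  have kz : pair ((0 : rootCone n) : Fin n → ℤ) x = 0 := pair_zero_left x
  rcases key μ with rfl | h2 <;> rcases key ν with rfl | h3
  · exact ⟨rfl, rfl⟩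
  · rw [kz] at h1; linarith
  · rw [kz] at h1; linarith
  · linarith

end Cone

theorem dense_forall_ne {K E ι : Type*} [RCLike K] [NormedAddCommGroup E] [NormedSpace K E]
    [CompleteSpace E] [Countable ι] (f : ι → E →L[K] K) (hf : ∀ i, f i ≠ 0) (c : ι → K) :
    Dense {v | ∀ i, f i v ≠ c i} := by
  have e : {v | ∀ i, f i v ≠ c i} = ⋂ i, f i ⁻¹' {c i}ᶜ := by ext v; simp
  rw [e]
  refine dense_iInter_of_isOpen (fun i => isOpen_compl_singleton.preimage (f i).continuous)
    fun i => ?_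
  refine (dense_compl_singleton (c i)).preimage ((f i).isOpenMap ?_)
  exact LinearMap.surjective (f := (f i : E →ₗ[K] K)) fun h => hf i (by ext v; exact congrArg (fun g => g v) h)

/-- The pairing with an integral vector as a continuous linear map. -/
def pairL {n : ℕ} (K : Type*) [RCLike K] (μ : Fin n → ℤ) : (Fin n → K) →L[K] K :=
  ∑ i, (μ i : K) • ContinuousLinearMap.proj i

theorem pairL_apply {n : ℕ} {K : Type*} [RCLike K] (μ : Fin n → ℤ) (v : Fin n → K) :
    pairL K μ v = pair μ v := by
  simp [pairL, pair]

theorem pairL_ne_zero {n : ℕ} {K : Type*} [RCLike K] {μ : Fin n → ℤ} (h : μ ≠ 0) :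
    pairL K μ ≠ 0 := by
  intro h0
  obtain ⟨i, hi⟩ := Function.ne_iff.1 h
  have h1 : pairL K μ (Pi.single i 1) = 0 := by rw [h0]; rfl
  rw [pairL_apply] at h1
  simp [pair, Pi.single_apply] at h1
  exact hi h1

theorem exists_generic_chamber (n : ℕ) : ∃ h ∈ chamber n, ∀ μ ν : Fin n → ℤ,
    pair μ h = pair ν h → μ = ν := by
  have hd := dense_forall_ne (K := ℝ) (ι := {μ : Fin n → ℤ // μ ≠ 0}) (fun μ => pairL ℝ μ.1)
    (fun μ => pairL_ne_zero μ.2) (fun _ => 0)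
  obtain ⟨h, h1, h2⟩ := hd.inter_open_nonempty _ (isOpen_chamber n) (chamber_nonempty n)
  refine ⟨h, h1, fun μ ν e => ?_⟩
  by_contra hne
  refine h2 ⟨μ - ν, sub_ne_zero.2 hne⟩ ?_
  rw [pairL_apply, pair_sub_left, e, sub_self]

theorem hasDerivAt_of_hasSum_exp {ι : Type*} {c ξ : ι → ℂ} {u : ℝ → ℂ} {δ K : ℝ} (hδ : 0 < δ)
    (h : ∀ s : ℝ, |s| < δ → HasSum (fun i => c i * Complex.exp (ξ i * s)) (u s)) (hK : 0 ≤ K)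
    (hξ : ∀ i, ‖ξ i‖ ≤ K + |(ξ i).re|) :
    ∃ d, HasDerivAt u d 0 ∧ HasSum (fun i => c i * ξ i) d := by
  set η := δ / 2 with hη
  have hη0 : 0 < η := by positivity
  have hηδ : |η| < δ := by rw [abs_of_pos hη0]; linarith
  have hs1 := (h η hηδ).summable.norm
  have hs2 := (h (-η) (by rwa [abs_neg])).summable.norm
  have hu := (hs1.add hs2).mul_left (K + 2 / η)
  have hnorm : ∀ i (s : ℝ), ‖c i * Complex.exp (ξ i * s)‖ = ‖c i‖ * Real.exp ((ξ i).re * s) := by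
    intro i s
    rw [norm_mul, Complex.norm_exp]
    simp
  have hb : ∀ i, ∀ s ∈ Set.Ioo (-(η / 2)) (η / 2), ‖c i * (Complex.exp (ξ i * s) * ξ i)‖ ≤
      (K + 2 / η) * (‖c i * Complex.exp (ξ i * (η : ℝ))‖ +
        ‖c i * Complex.exp (ξ i * ((-η : ℝ) : ℂ))‖) := by
    intro i s hs
    rw [← mul_assoc, norm_mul, hnorm, hnorm, hnorm, ← mul_add]
    set r := (ξ i).re with hr
    have h1 : r * s ≤ |r| * (η / 2) := by
      calc r * s ≤ |r * s| := le_abs_self _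
        _ = |r| * |s| := abs_mul _ _
        _ ≤ |r| * (η / 2) := by gcongr; exact (abs_lt.2 hs).le
    have h2 : |r| ≤ 2 / η * Real.exp (|r| * (η / 2)) := by
      have := Real.add_one_le_exp (|r| * (η / 2))
      calc |r| = 2 / η * (|r| * (η / 2)) := by field_simp
        _ ≤ _ := by gcongr; linarith
    have h3 : Real.exp (|r| * η) ≤ Real.exp (r * η) + Real.exp (r * -η) := by
      rcases abs_cases r with ⟨e, _⟩ | ⟨e, _⟩
      · rw [e]; linarith [Real.exp_pos (r * -η)]
      · rw [e, neg_mul, ← mul_neg]; linarith [Real.exp_pos (r * η)]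
    have h4 : (1 : ℝ) ≤ Real.exp (|r| * (η / 2)) := Real.one_le_exp (by positivity)
    have h5 : ‖ξ i‖ ≤ (K + 2 / η) * Real.exp (|r| * (η / 2)) := by
      calc ‖ξ i‖ ≤ K + |r| := hξ i
        _ ≤ K * Real.exp (|r| * (η / 2)) + 2 / η * Real.exp (|r| * (η / 2)) := by
          gcongr
          exact le_mul_of_one_le_right hK h4
        _ = _ := by ring
    calc ‖c i‖ * Real.exp (r * s) * ‖ξ i‖
        ≤ ‖c i‖ * Real.exp (|r| * (η / 2)) * ((K + 2 / η) * Real.exp (|r| * (η / 2))) := by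
          gcongr
      _ = (K + 2 / η) * (‖c i‖ * Real.exp (|r| * η)) := by
          rw [show |r| * η = |r| * (η / 2) + |r| * (η / 2) by ring, Real.exp_add]; ring
      _ ≤ _ := by gcongr
  have hmem : (0 : ℝ) ∈ Set.Ioo (-(η / 2)) (η / 2) := ⟨by linarith, by linarith⟩
  have key := hasDerivAt_tsum_of_isPreconnected (𝕜 := ℝ)
    (g := fun i (s : ℝ) => c i * Complex.exp (ξ i * s))
    (g' := fun i (s : ℝ) => c i * (Complex.exp (ξ i * s) * ξ i)) hu isOpen_Ioo
    (convex_Ioo (-(η / 2)) (η / 2)).isPreconnected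
    (fun i s _ => by
      have h1 : HasDerivAt (fun s : ℝ => ξ i * (s : ℂ)) (ξ i) s := by
        simpa using (Complex.ofRealCLM.hasDerivAt (x := s)).const_mul (ξ i)
      exact h1.cexp.const_mul (c i)) hb hmem (h 0 (by simpa using hδ)).summable hmem
  have hs : Summable fun i => c i * ξ i := by
    refine Summable.of_norm_bounded hu fun i => ?_
    simpa using hb i 0 hmem
  refine ⟨_, key.congr_of_eventuallyEq ?_, ?_⟩
  · filter_upwards [isOpen_Ioo.mem_nhds hmem] with s hs
    refine (h s ?_).tsum_eq.symm
    rw [abs_lt]; constructor <;> linarith [hs.1, hs.2]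
  · simpa using hs.hasSum

section Series

variable {n : ℕ} {Γ : rootCone n → ℂ} {a : Fin n → ℂ} {U : (Fin n → ℝ) → ℂ}

theorem hasSum_lineDeriv (h : ∀ x ∈ chamber n, HasSum (fun μ : rootCone n =>
      Γ μ * Complex.exp (∑ i, (a i - ((μ : Fin n → ℤ) i : ℂ)) * (x i : ℂ))) (U x))
    (d : Fin n → ℝ) {x : Fin n → ℝ} (hx : x ∈ chamber n) : HasSum (fun μ : rootCone n =>
      Γ μ * (∑ i, (a i - ((μ : Fin n → ℤ) i : ℂ)) * (d i : ℂ)) *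
        Complex.exp (∑ i, (a i - ((μ : Fin n → ℤ) i : ℂ)) * (x i : ℂ))) (lineDeriv ℝ U x d) := by
  obtain ⟨δ, hδ, hδ'⟩ : ∃ δ : ℝ, 0 < δ ∧ ∀ s : ℝ, |s| < δ → x + s • d ∈ chamber n := by
    have hc : ContinuousAt (fun s : ℝ => x + s • d) 0 := by fun_prop
    have := hc.preimage_mem_nhds ((isOpen_chamber n).mem_nhds (by simpa using hx))
    obtain ⟨δ, hδ, hb⟩ := Metric.mem_nhds_iff.1 this
    exact ⟨δ, hδ, fun s hs => hb (by simpa using hs)⟩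
  obtain ⟨D, h1, h2⟩ := hasDerivAt_of_hasSum_exp (u := fun s => U (x + s • d)) (K := |(∑ i, a i * d i).im|)
    (ξ := fun μ : rootCone n => ∑ i, (a i - ((μ : Fin n → ℤ) i : ℂ)) * (d i : ℂ))
    (c := fun μ : rootCone n => Γ μ * Complex.exp (∑ i, (a i - ((μ : Fin n → ℤ) i : ℂ)) * (x i : ℂ)))
    hδ (fun s hs => by
      refine (h _ (hδ' s hs)).congr_fun fun μ => ?_
      rw [mul_assoc, ← Complex.exp_add, Finset.sum_mul, ← Finset.sum_add_distrib]
      congr 2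
      refine Finset.sum_congr rfl fun i _ => ?_
      simp only [Pi.add_apply, Pi.smul_apply, smul_eq_mul]
      push_cast
      ring) (abs_nonneg _) (fun μ => by
      have e : (∑ i, (a i - ((μ : Fin n → ℤ) i : ℂ)) * (d i : ℂ)).im = (∑ i, a i * d i).im := by
        simp [Complex.im_sum]
      have := Complex.norm_le_abs_re_add_abs_im (∑ i, (a i - ((μ : Fin n → ℤ) i : ℂ)) * (d i : ℂ))
      rw [e] at this
      linarith)
  rw [lineDeriv, h1.deriv]
  refine h2.congr_fun fun μ => ?_
  ring

/-- The symbol of the operator `laplace k`. -/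
def symbol (k : Mult) (a : Fin n → ℂ) (x : Fin n → ℝ) (μ : Fin n → ℤ) : ℂ :=
  ∑ j, (a j - μ j) ^ 2 + ∑ α ∈ posRoots n,
    rootMult k α * (((1 + Real.exp (-pair α x)) / (1 - Real.exp (-pair α x)) : ℝ) : ℂ) *
      ∑ i, (a i - μ i) * (α i : ℂ)

theorem sum_mul_single (v : Fin n → ℂ) (j : Fin n) :
    ∑ i, v i * (((Pi.single j 1 : Fin n → ℝ) i : ℝ) : ℂ) = v j := by
  rw [Finset.sum_eq_single j]
  · simp
  · intro b _ hb; simp [hb]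
  · simp

theorem hasSum_laplace (k : Mult) (h : ∀ x ∈ chamber n, HasSum (fun μ : rootCone n =>
      Γ μ * Complex.exp (∑ i, (a i - ((μ : Fin n → ℤ) i : ℂ)) * (x i : ℂ))) (U x))
    {x : Fin n → ℝ} (hx : x ∈ chamber n) : HasSum (fun μ : rootCone n =>
      Γ μ * symbol k a x μ *
        Complex.exp (∑ i, (a i - ((μ : Fin n → ℤ) i : ℂ)) * (x i : ℂ))) (laplace k U x) := by
  have h2 : ∀ j : Fin n, HasSum (fun μ : rootCone n => Γ μ * (a j - ((μ : Fin n → ℤ) j : ℂ)) ^ 2 *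
      Complex.exp (∑ i, (a i - ((μ : Fin n → ℤ) i : ℂ)) * (x i : ℂ)))
      (lineDeriv ℝ (fun y => lineDeriv ℝ U y (Pi.single j 1)) x (Pi.single j 1)) := by
    intro j
    refine (hasSum_lineDeriv (fun y hy => hasSum_lineDeriv h (Pi.single j 1) hy)
      (Pi.single j 1) hx).congr_fun fun μ => ?_
    rw [sum_mul_single]
    ring
  have h3 : ∀ α : Fin n → ℤ, HasSum (fun μ : rootCone n => (rootMult k α *
      (((1 + Real.exp (-pair α x)) / (1 - Real.exp (-pair α x)) : ℝ) : ℂ)) * (Γ μ *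
        (∑ i, (a i - ((μ : Fin n → ℤ) i : ℂ)) * (α i : ℂ)) *
      Complex.exp (∑ i, (a i - ((μ : Fin n → ℤ) i : ℂ)) * (x i : ℂ))))
      (rootMult k α * (((1 + Real.exp (-pair α x)) / (1 - Real.exp (-pair α x)) : ℝ) : ℂ) *
        lineDeriv ℝ U x (fun i => (α i : ℝ))) := by
    intro α
    refine ((hasSum_lineDeriv h (fun i => (α i : ℝ)) hx).mul_left _).congr_fun fun μ => ?_
    simp only [Complex.ofReal_intCast]
  refine ((hasSum_sum fun j _ => h2 j).add
    (hasSum_sum (s := posRoots n) fun α _ => h3 α)).congr_fun fun μ => ?_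
  simp only [symbol, mul_add, add_mul, Finset.mul_sum, Finset.sum_mul]
  congr 1
  refine Finset.sum_congr rfl fun α _ => Finset.sum_congr rfl fun i _ => ?_
  ring

end Series

theorem cothHalf_bound {c s : ℝ} (hc : 0 < c) (hs : 1 ≤ s) :
    |(1 + Real.exp (-(s * c))) / (1 - Real.exp (-(s * c)))| ≤ 2 / (1 - Real.exp (-c)) := by
  have h1 : Real.exp (-(s * c)) ≤ Real.exp (-c) := Real.exp_le_exp.2 (by nlinarith)
  have h2 : Real.exp (-c) < 1 := by rw [Real.exp_lt_one_iff]; linarith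
  rw [abs_of_nonneg (div_nonneg (by positivity) (by linarith))]
  exact div_le_div₀ (by norm_num) (by linarith) (by linarith) (by linarith)

theorem tendsto_cothHalf {c : ℝ} (hc : 0 < c) :
    Tendsto (fun s : ℝ => (((1 + Real.exp (-(s * c))) / (1 - Real.exp (-(s * c))) : ℝ) : ℂ))
      atTop (𝓝 1) := by
  have h : Tendsto (fun s : ℝ => Real.exp (-(s * c))) atTop (𝓝 0) :=
    Real.tendsto_exp_neg_atTop_nhds_zero.comp (tendsto_id.atTop_mul_const hc)
  have h2 := (h.const_add 1).div (h.const_sub 1) (by norm_num)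
  have h3 := (Complex.continuous_ofReal.tendsto _).comp h2
  rw [sub_zero, add_zero, div_one, Complex.ofReal_one] at h3
  exact h3

section Unique

variable {n : ℕ} {k : Mult} {l : Fin n → ℂ}

theorem sum_rootMult_mul (v : Fin n → ℂ) :
    ∑ α ∈ posRoots n, rootMult k α * ∑ i, v i * (α i : ℂ) = 2 * ∑ i, v i * rho n k i := by
  simp only [rho, Finset.mul_sum]
  rw [Finset.sum_comm]
  refine Finset.sum_congr rfl fun i _ => Finset.sum_congr rfl fun α _ => ?_
  ring

/-- The exponential `a^{l - ρ(k) - μ}` at the point with logarithm `x`. -/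
def monom (a : Fin n → ℂ) (μ : Fin n → ℤ) (x : Fin n → ℝ) : ℂ :=
  Complex.exp (∑ i, (a i - (μ i : ℂ)) * (x i : ℂ))

theorem monom_eq (a : Fin n → ℂ) (μ : Fin n → ℤ) (x : Fin n → ℝ) :
    monom a μ x = Complex.exp (∑ i, a i * (x i : ℂ)) * Complex.exp (-(pair μ x : ℝ)) := by
  rw [monom, ← Complex.exp_add]
  congr 1
  simp only [pair]
  push_cast
  rw [← sub_eq_add_neg, ← Finset.sum_sub_distrib]
  exact Finset.sum_congr rfl fun i _ => by ring

theorem norm_monom_mul_inv (a : Fin n → ℂ) (μ ν : Fin n → ℤ) (h : Fin n → ℝ) (s : ℝ) :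
    ‖monom a μ (s • h) * (monom a ν (s • h))⁻¹‖ = Real.exp (-(s * (pair μ h - pair ν h))) := by
  rw [monom_eq, monom_eq, mul_inv, mul_mul_mul_comm, mul_inv_cancel₀ (Complex.exp_ne_zero _),
    one_mul, ← Complex.exp_neg, ← Complex.exp_add, Complex.norm_exp]
  congr 1
  simp only [pair_smul_right]
  simp
  ring

theorem symbol_bound (a : Fin n → ℂ) {h : Fin n → ℝ} (hh : h ∈ chamber n) (μ : Fin n → ℤ) {s : ℝ}
    (hs : 1 ≤ s) : ‖symbol k a (s • h) μ‖ ≤ ∑ j, ‖(a j - μ j) ^ 2‖ +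
      ∑ α ∈ posRoots n, ‖rootMult k α‖ * (2 / (1 - Real.exp (-pair α h))) *
        ‖∑ i, (a i - μ i) * (α i : ℂ)‖ := by
  rw [symbol]
  refine (norm_add_le _ _).trans (add_le_add (norm_sum_le _ _) ((norm_sum_le _ _).trans ?_))
  refine Finset.sum_le_sum fun α hα => ?_
  rw [norm_mul, norm_mul, Complex.norm_real, Real.norm_eq_abs, pair_smul_right]
  gcongr
  exact cothHalf_bound (hh α hα) hs

theorem tendsto_symbol (l : Fin n → ℂ) {h : Fin n → ℝ} (hh : h ∈ chamber n) (μ : Fin n → ℤ) :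
    Tendsto (fun s : ℝ => symbol k (fun i => l i - rho n k i) (s • h) μ) atTop
      (𝓝 (∑ i, l i ^ 2 - ∑ i, rho n k i ^ 2 + (-2 * pair μ l + ((pair μ μ : ℤ) : ℂ)))) := by
  have h1 : Tendsto (fun s : ℝ => symbol k (fun i => l i - rho n k i) (s • h) μ) atTop
      (𝓝 (∑ j, (l j - rho n k j - μ j) ^ 2 + ∑ α ∈ posRoots n, rootMult k α * 1 *
        ∑ i, (l i - rho n k i - μ i) * (α i : ℂ))) := by
    refine tendsto_const_nhds.add (tendsto_finsetSum _ fun α hα => ?_)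
    simp only [pair_smul_right]
    exact ((tendsto_cothHalf (hh α hα)).const_mul _).mul_const _
  convert! h1 using 2
  simp only [mul_one]
  rw [sum_rootMult_mul]
  simp only [pair]
  push_cast
  simp only [Finset.mul_sum, ← Finset.sum_sub_distrib, ← Finset.sum_add_distrib]
  exact Finset.sum_congr rfl fun i _ => by ring

theorem coeff_eq_zero_of_symbol {D : rootCone n → ℂ} {U : (Fin n → ℝ) → ℂ}
    (hl : ∀ μ ∈ rootCone n, μ ≠ 0 → -2 * pair μ l + ((pair μ μ : ℤ) : ℂ) ≠ 0) (h0 : D 0 = 0)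
    (hU : ∀ x ∈ chamber n, HasSum (fun μ : rootCone n =>
      D μ * monom (fun i => l i - rho n k i) μ x) (U x))
    (hz : ∀ x ∈ chamber n, HasSum (fun ν : rootCone n =>
      D ν * (symbol k (fun i => l i - rho n k i) x ν - (∑ i, l i ^ 2 - ∑ i, rho n k i ^ 2)) *
        monom (fun i => l i - rho n k i) ν x) 0) (μ : rootCone n) : D μ = 0 := by
  set a : Fin n → ℂ := fun i => l i - rho n k i with ha
  set E : ℂ := ∑ i, l i ^ 2 - ∑ i, rho n k i ^ 2 with hEdef
  obtain ⟨h, hh, hgen⟩ := exists_generic_chamber n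
  by_contra hμ
  obtain ⟨μ₀, hμ₀, hmin⟩ : ∃ μ₀ : rootCone n, D μ₀ ≠ 0 ∧
      ∀ ν : rootCone n, D ν ≠ 0 → pair (μ₀ : Fin n → ℤ) h ≤ pair (ν : Fin n → ℤ) h := by
    have hfin : {ν : rootCone n | D ν ≠ 0 ∧ pair (ν : Fin n → ℤ) h ≤ pair (μ : Fin n → ℤ) h}.Finite :=
      (rootCone_finite hh _).subset fun ν hν => hν.2
    obtain ⟨μ₀, h1, h2⟩ := hfin.toFinset.exists_min_image (fun ν => pair (ν : Fin n → ℤ) h)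
      ⟨μ, by simpa using hμ⟩
    rw [Set.Finite.mem_toFinset] at h1
    refine ⟨μ₀, h1.1, fun ν hν => ?_⟩
    rcases le_total (pair (ν : Fin n → ℤ) h) (pair (μ : Fin n → ℤ) h) with h3 | h3
    · exact h2 ν (by simpa using ⟨hν, h3⟩)
    · exact h1.2.trans h3
  have hμ₀0 : (μ₀ : Fin n → ℤ) ≠ 0 := fun e => hμ₀ (by rw [show μ₀ = 0 from Subtype.ext e, h0])
  set B : rootCone n → ℝ := fun ν => ∑ j, ‖(a j - ((ν : Fin n → ℤ) j : ℂ)) ^ 2‖ +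
      ∑ α ∈ posRoots n, ‖rootMult k α‖ * (2 / (1 - Real.exp (-pair α h))) *
        ‖∑ i, (a i - ((ν : Fin n → ℤ) i : ℂ)) * (α i : ℂ)‖ + ‖E‖ with hB
  have hsum : Summable fun ν : rootCone n => B ν * ‖D ν * monom a ν h‖ := by
    have s1 : ∀ j : Fin n, Summable fun ν : rootCone n =>
        ‖(a j - ((ν : Fin n → ℤ) j : ℂ)) ^ 2‖ * ‖D ν * monom a ν h‖ := by
      intro j
      have := (hasSum_lineDeriv (fun y hy => hasSum_lineDeriv hU (Pi.single j 1) hy)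
        (Pi.single j 1) hh).summable.norm
      refine this.congr fun ν => ?_
      rw [sum_mul_single, ← norm_mul]
      congr 1
      simp only [monom]
      ring
    have s2 : ∀ α : Fin n → ℤ, Summable fun ν : rootCone n =>
        ‖∑ i, (a i - ((ν : Fin n → ℤ) i : ℂ)) * (α i : ℂ)‖ * ‖D ν * monom a ν h‖ := by
      intro α
      have := (hasSum_lineDeriv hU (fun i => (α i : ℝ)) hh).summable.norm
      refine this.congr fun ν => ?_
      rw [← norm_mul]
      congr 1
      simp only [monom, Complex.ofReal_intCast]
      ring
    have s3 : Summable fun ν : rootCone n => ‖E‖ * ‖D ν * monom a ν h‖ :=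
      (hU h hh).summable.norm.mul_left _
    refine (((summable_sum fun j (_ : j ∈ Finset.univ) => s1 j).add
      (summable_sum (s := posRoots n) fun α _ =>
        (s2 α).mul_left (‖rootMult k α‖ * (2 / (1 - Real.exp (-pair α h)))))).add s3).congr
        fun ν => ?_
    simp only [hB, add_mul, Finset.sum_mul, mul_assoc]
  set T : ℝ → rootCone n → ℂ := fun s ν =>
    D ν * (symbol k a (s • h) ν - E) * (monom a ν (s • h) * (monom a μ₀ (s • h))⁻¹) with hT
  set S : ℂ := -2 * pair (μ₀ : Fin n → ℤ) l + ((pair (μ₀ : Fin n → ℤ) (μ₀ : Fin n → ℤ) : ℤ) : ℂ)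
  classical
  have hlim : Tendsto (fun s => ∑' ν, T s ν) atTop
      (𝓝 (∑' ν, if ν = μ₀ then D μ₀ * S else 0)) := by
    refine tendsto_tsum_of_dominated_convergence
      (bound := fun ν => B ν * ‖D ν * monom a ν h‖ * ‖(monom a μ₀ h)⁻¹‖) (hsum.mul_right _) ?_ ?_
    · intro ν
      have hsy := ((tendsto_symbol (k := k) l hh ν).sub_const E).const_mul (D ν)
      by_cases hν : ν = μ₀
      · subst hν
        simp only [if_true]
        rw [add_sub_cancel_left] at hsy
        refine hsy.congr fun s => ?_
        simp only [hT]
        rw [monom, mul_inv_cancel₀ (Complex.exp_ne_zero _), mul_one]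
      · simp only [hν, if_false]
        by_cases hD : D ν = 0
        · simp [hT, hD]
        have hlt : 0 < pair (ν : Fin n → ℤ) h - pair (μ₀ : Fin n → ℤ) h := by
          refine sub_pos.2 (lt_of_le_of_ne (hmin ν hD) fun e => hν (Subtype.ext (hgen _ _ e).symm))
        have he : Tendsto (fun s : ℝ => monom a ν (s • h) * (monom a μ₀ (s • h))⁻¹) atTop (𝓝 0) := by
          rw [tendsto_zero_iff_norm_tendsto_zero]
          simp only [norm_monom_mul_inv]
          exact Real.tendsto_exp_neg_atTop_nhds_zero.comp (tendsto_id.atTop_mul_const hlt)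
        simpa using hsy.mul he
    · filter_upwards [eventually_ge_atTop (1 : ℝ)] with s hs ν
      by_cases hD : D ν = 0
      · simp [hT, hD]
      have hle := sub_nonneg.2 (hmin ν hD)
      simp only [hT]
      have h1 := norm_monom_mul_inv a ν μ₀ h 1
      rw [one_smul, one_mul] at h1
      rw [norm_mul, norm_mul, norm_monom_mul_inv, norm_mul, mul_assoc (B ν), mul_assoc ‖D ν‖ ‖monom a ν h‖, ← norm_mul (monom a ν h), h1, mul_comm ‖D ν‖, mul_assoc]
      have h2 : ‖symbol k a (s • h) ν - E‖ ≤ B ν :=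
        (norm_sub_le _ _).trans (by simpa only [hB, add_le_add_iff_right] using symbol_bound a hh ν hs)
      have h3 : Real.exp (-(s * (pair (ν : Fin n → ℤ) h - pair (μ₀ : Fin n → ℤ) h))) ≤
          Real.exp (-(pair (ν : Fin n → ℤ) h - pair (μ₀ : Fin n → ℤ) h)) :=
        Real.exp_le_exp.2 (by nlinarith)
      have h4 : 0 ≤ B ν := (norm_nonneg _).trans h2
      gcongr
  have hT0 : ∀ᶠ s in atTop, ∑' ν, T s ν = 0 := by
    filter_upwards [eventually_gt_atTop (0 : ℝ)] with s hs
    have h1 := (hz _ (chamber_smul hh hs)).mul_right ((monom a μ₀ (s • h))⁻¹)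
    rw [zero_mul] at h1
    rw [← h1.tsum_eq]
    exact tsum_congr fun ν => by simp only [hT]; ring
  have h5 := tendsto_nhds_unique hlim (tendsto_const_nhds.congr' (hT0.mono fun s hs => hs.symm))
  rw [tsum_ite_eq] at h5
  exact mul_ne_zero hμ₀ (hl μ₀ μ₀.2 hμ₀0) h5

theorem IsHarishChandraSeries.unique
    (hl : ∀ μ ∈ rootCone n, μ ≠ 0 → -2 * pair μ l + ((pair μ μ : ℤ) : ℂ) ≠ 0)
    {u v : (Fin n → ℝ) → ℂ} (hu : IsHarishChandraSeries k l u) (hv : IsHarishChandraSeries k l v)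
    {x : Fin n → ℝ} (hx : x ∈ chamber n) : u x = v x := by
  obtain ⟨Γ₁, h1, hs1⟩ := hu.expansion
  obtain ⟨Γ₂, h2, hs2⟩ := hv.expansion
  have hU : ∀ x ∈ chamber n, HasSum (fun μ : rootCone n =>
      (Γ₁ μ - Γ₂ μ) * monom (fun i => l i - rho n k i) μ x) (u x - v x) := by
    intro x hx
    refine ((hs1 x hx).sub (hs2 x hx)).congr_fun fun μ => ?_
    rw [monom]
    ring
  have key := coeff_eq_zero_of_symbol (k := k) hl (by rw [h1, h2, sub_self]) hU fun x hx => by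
    have e1 := (hasSum_laplace k hs1 hx).sub
      ((hs1 x hx).mul_left (∑ i, l i ^ 2 - ∑ i, rho n k i ^ 2))
    have e2 := (hasSum_laplace k hs2 hx).sub
      ((hs2 x hx).mul_left (∑ i, l i ^ 2 - ∑ i, rho n k i ^ 2))
    rw [hu.eigen x hx, sub_self] at e1
    rw [hv.eigen x hx, sub_self] at e2
    have e3 := e1.sub e2
    rw [sub_zero] at e3
    refine e3.congr_fun fun μ => ?_
    rw [monom]
    ring
  have h3 := hU x hx
  simp only [key, zero_mul] at h3
  exact sub_eq_zero.1 (h3.unique hasSum_zero)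

theorem hcSeries_eq
    (hl : ∀ μ ∈ rootCone n, μ ≠ 0 → -2 * pair μ l + ((pair μ μ : ℤ) : ℂ) ≠ 0)
    {u : (Fin n → ℝ) → ℂ} (hu : IsHarishChandraSeries k l u)
    {x : Fin n → ℝ} (hx : x ∈ chamber n) : hcSeries k l x = u x :=
  (Classical.epsilon_spec (p := IsHarishChandraSeries k l) ⟨u, hu⟩).unique hl hu hx

end Unique

theorem hasSum_mul_fiber {ι : Type*} [Add ι] {A B : ι → ℂ} {a b : ℂ} (hA : HasSum A a)
    (hB : HasSum B b) :
    HasSum (fun μ => ∑' p : {p : ι × ι // p.1 + p.2 = μ}, A p.1.1 * B p.1.2) (a * b) := by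
  have s := hA.mul hB (summable_mul_of_summable_norm hA.summable.norm hB.summable.norm)
  rw [← (Equiv.sigmaFiberEquiv fun p : ι × ι => p.1 + p.2).hasSum_iff] at s
  exact s.sigma fun μ => (s.summable.sigma_factor μ).hasSum

section QSeries

variable {n : ℕ}

/-- Sums of normalized series in the exponentials `a^{-μ}`, `μ ∈ Q`. -/
def IsQSeries (f : (Fin n → ℝ) → ℂ) : Prop :=
  ∃ Γ : rootCone n → ℂ, Γ 0 = 1 ∧ ∀ x ∈ chamber n,
    HasSum (fun μ : rootCone n => Γ μ * Complex.exp (-(pair (μ : Fin n → ℤ) x : ℝ))) (f x)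

theorem isQSeries_of_root {α : Fin n → ℤ} (hα : α ∈ posRoots n) {γ : ℕ → ℂ} (h0 : γ 0 = 1)
    {f : (Fin n → ℝ) → ℂ}
    (h : ∀ x ∈ chamber n, HasSum (fun m => γ m * (Real.exp (-pair α x) : ℂ) ^ m) (f x)) :
    IsQSeries f := by
  set r : rootCone n := ⟨α, posRoot_mem_rootCone hα⟩ with hr
  have hinj : Function.Injective fun m : ℕ => m • r := by
    obtain ⟨x, hx⟩ := chamber_nonempty n
    intro m m' e
    have e1 : pair (m • α) x = pair (m' • α) x :=
      congrArg (fun ν : rootCone n => pair (ν : Fin n → ℤ) x) e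
    rw [pair_nsmul_left, pair_nsmul_left] at e1
    exact_mod_cast mul_right_cancel₀ (hx α hα).ne' e1
  refine ⟨Function.extend (fun m : ℕ => m • r) γ 0, ?_, fun x hx => ?_⟩
  · have := hinj.extend_apply γ 0 0
    simpa [h0] using this
  · rw [← hinj.hasSum_iff]
    · refine (h x hx).congr_fun fun m => ?_
      simp only [Function.comp_apply, hinj.extend_apply]
      have e : pair ((m • r : rootCone n) : Fin n → ℤ) x = m * pair α x := by
        rw [← pair_nsmul_left]; rfl
      rw [e]
      congr 1
      push_cast
      rw [← Complex.exp_nat_mul]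
      congr 1
      ring
    · intro μ hμ
      rw [Function.extend_apply' _ _ _ hμ]
      simp

theorem isQSeries_one : IsQSeries (fun _ : Fin n → ℝ => (1 : ℂ)) := by
  classical
  refine ⟨Pi.single 0 1, by simp, fun x _ => ?_⟩
  have h := hasSum_single (f := fun μ : rootCone n => (Pi.single 0 1 : rootCone n → ℂ) μ *
    Complex.exp (-(pair (μ : Fin n → ℤ) x : ℝ))) 0 fun μ hμ => by simp [hμ]
  simpa [pair_zero_left] using h

theorem IsQSeries.mul {f g : (Fin n → ℝ) → ℂ} (hf : IsQSeries f) (hg : IsQSeries g) :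
    IsQSeries (fun x => f x * g x) := by
  obtain ⟨Γ₁, h1, hs1⟩ := hf
  obtain ⟨Γ₂, h2, hs2⟩ := hg
  refine ⟨fun μ => ∑' p : {p : rootCone n × rootCone n // p.1 + p.2 = μ},
    Γ₁ p.1.1 * Γ₂ p.1.2, ?_, fun x hx => ?_⟩
  · beta_reduce
    rw [tsum_eq_single ⟨(0, 0), by simp⟩]
    · simp [h1, h2]
    · rintro ⟨⟨μ, ν⟩, e⟩ hne
      obtain ⟨rfl, rfl⟩ := rootCone_add_eq_zero e
      exact absurd rfl hne
  · refine (hasSum_mul_fiber (hs1 x hx) (hs2 x hx)).congr_fun fun μ => ?_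
    rw [← tsum_mul_right]
    refine tsum_congr ?_
    rintro ⟨⟨κ, ν⟩, rfl⟩
    have e : pair ((κ + ν : rootCone n) : Fin n → ℤ) x =
      pair (κ : Fin n → ℤ) x + pair (ν : Fin n → ℤ) x := pair_add_left _ _ _
    rw [e]
    push_cast
    rw [neg_add, Complex.exp_add]
    ring

theorem IsQSeries.prod {ι : Type*} {s : Finset ι} {f : ι → (Fin n → ℝ) → ℂ}
    (h : ∀ i ∈ s, IsQSeries (f i)) : IsQSeries (fun x => ∏ i ∈ s, f i x) := by
  classical
  induction s using Finset.induction_on with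
  | empty => simpa using isQSeries_one
  | insert i s hi ih =>
    simp only [Finset.prod_insert hi]
    exact (h i (by simp)).mul (ih fun j hj => h j (by simp [hj]))

theorem isQSeries_geometric {α : Fin n → ℤ} (hα : α ∈ posRoots n) :
    IsQSeries (fun x => (1 - (Real.exp (-pair α x) : ℂ))⁻¹) := by
  refine isQSeries_of_root hα (γ := fun _ => 1) rfl fun x hx => ?_
  simp only [one_mul]
  exact hasSum_geometric_of_norm_lt_one
    (norm_lt_one_of_mem_Ioo (exp_neg_mem_Ioo (hx α hα)))

theorem isQSeries_psum {g : ℕ → ℂ} (hg : Tame g) (h0 : g 0 = 1) (j : Fin n) :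
    IsQSeries (fun x => psum g (Real.exp (-x j) : ℂ)) := by
  refine isQSeries_of_root (mem_posRoots.2 (Or.inl ⟨j, rfl⟩)) h0 fun x hx => ?_
  rw [pair_single, Int.cast_one, one_mul]
  exact hg.hasSum (norm_lt_one_of_mem_Ioo (exp_neg_mem_Ioo (chamber_pos hx j)))

end QSeries

section Laplace

variable {n : ℕ}

/-- The contribution of the middle roots to the first order part of `laplace` along `e_j`. -/
def middleCoth (x : Fin n → ℝ) (j : Fin n) : ℂ :=
  ∑ α ∈ middleRoots n,
    (((1 + Real.exp (-pair α x)) / (1 - Real.exp (-pair α x)) : ℝ) : ℂ) * (α j : ℂ)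

theorem lineDeriv_eq_sum {u : (Fin n → ℝ) → ℂ} {x : Fin n → ℝ} (hu : DifferentiableAt ℝ u x)
    (v : Fin n → ℝ) : lineDeriv ℝ u x v = ∑ j, (v j : ℂ) * lineDeriv ℝ u x (Pi.single j 1) := by
  have hv : v = ∑ j, v j • (Pi.single j 1 : Fin n → ℝ) := by
    ext i; simp [Finset.sum_apply, Pi.single_apply]
  simp only [hu.lineDeriv_eq_fderiv]
  conv_lhs => rw [hv, map_sum]
  exact Finset.sum_congr rfl fun j _ => by rw [map_smul, Complex.real_smul]

theorem laplace_eq (k : Mult) {u : (Fin n → ℝ) → ℂ} {x : Fin n → ℝ} (hx : x ∈ chamber n)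
    (hu : DifferentiableAt ℝ u x) {u1 u2 : Fin n → (Fin n → ℝ) → ℂ}
    (h1 : ∀ j, ∀ y ∈ chamber n, HasLineDerivAt ℝ u (u1 j y) y (Pi.single j 1))
    (h2 : ∀ j, HasLineDerivAt ℝ (u1 j) (u2 j x) x (Pi.single j 1)) :
    laplace k u x =
      ∑ j, (u2 j x + (radP k.1 k.2.2 (x j) + k.2.1 * middleCoth x j) * u1 j x) := by
  have e1 : ∀ j, lineDeriv ℝ u x (Pi.single j 1) = u1 j x := fun j => (h1 j x hx).lineDeriv
  have e2 : ∀ j, lineDeriv ℝ (fun y => lineDeriv ℝ u y (Pi.single j 1)) x (Pi.single j 1) =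
      u2 j x := by
    intro j
    refine ((h2 j).congr_of_eventuallyEq ?_).lineDeriv
    filter_upwards [(isOpen_chamber n).mem_nhds hx] with y hy
    exact (h1 j y hy).lineDeriv
  have hm : ∀ α ∈ middleRoots n, rootMult k α * (((1 + Real.exp (-pair α x)) /
      (1 - Real.exp (-pair α x)) : ℝ) : ℂ) * ∑ j, ((α j : ℝ) : ℂ) * u1 j x =
      ∑ j, k.2.1 * ((((1 + Real.exp (-pair α x)) /
      (1 - Real.exp (-pair α x)) : ℝ) : ℂ) * (α j : ℂ)) * u1 j x := by
    intro α hα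
    rw [rootMult_middle k hα, Finset.mul_sum]
    exact Finset.sum_congr rfl fun j _ => by rw [Complex.ofReal_intCast]; ring
  rw [laplace]
  have e3 : ∀ v : Fin n → ℝ, lineDeriv ℝ u x v = ∑ j, (v j : ℂ) * u1 j x := fun v => by
    rw [lineDeriv_eq_sum hu]
    exact Finset.sum_congr rfl fun j _ => by rw [e1]
  simp only [e2, e3]
  rw [sum_posRoots, Finset.sum_congr rfl hm, Finset.sum_comm (s := middleRoots n),
    Finset.sum_add_distrib]
  congr 1
  have hs : ∀ (p : Fin n) (c : ℤ), ∑ j, ((((Pi.single p c : Fin n → ℤ) j : ℤ) : ℝ) : ℂ) * u1 j x =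
      c * u1 p x := by
    intro p c
    rw [Finset.sum_eq_single p]
    · simp
    · intro j _ hj; simp [hj]
    · simp
  simp only [hs, rootMult_short, rootMult_long, pair_single]
  rw [← Finset.sum_add_distrib, ← Finset.sum_add_distrib]
  refine Finset.sum_congr rfl fun j _ => ?_
  rw [radP, middleCoth, Finset.mul_sum, add_mul, Finset.sum_mul]
  congr 1
  push_cast
  ring_nf

end Laplace

section Slices

variable {n : ℕ}

theorem hasLineDerivAt_mul_prod_erase {f : ℝ → ℂ} {d : ℂ} (y : Fin n → ℝ → ℂ) {x : Fin n → ℝ}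
    {j : Fin n} (hf : HasDerivAt f d (x j)) :
    HasLineDerivAt ℝ (fun x : Fin n → ℝ => f (x j) * ∏ i ∈ Finset.univ.erase j, y i (x i))
      (d * ∏ i ∈ Finset.univ.erase j, y i (x i)) x (Pi.single j 1) := by
  have h1 : HasDerivAt (fun t : ℝ => f (x j + t)) d 0 := by
    refine HasDerivAt.comp_const_add (x j) 0 ?_
    rwa [add_zero]
  refine (h1.mul_const (∏ i ∈ Finset.univ.erase j, y i (x i))).congr_of_eventuallyEq
    (Eventually.of_forall fun t => ?_)
  simp only [Pi.add_apply, Pi.smul_apply, Pi.single_eq_same, smul_eq_mul, mul_one]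
  congr 1
  refine Finset.prod_congr rfl fun i hi => ?_
  rw [Pi.single_eq_of_ne (Finset.ne_of_mem_erase hi), mul_zero, add_zero]

theorem det_updateRow_eq_sum (M : Matrix (Fin n) (Fin n) ℂ) (j : Fin n) (b : Fin n → ℂ) :
    (M.updateRow j b).det = ∑ m, b m * M.adjugate m j := by
  rw [← Matrix.cramer_transpose_apply, Matrix.cramer_eq_adjugate_mulVec, ← Matrix.adjugate_transpose]
  simp [Matrix.mulVec, dotProduct, mul_comm]

theorem hasLineDerivAt_det_updateRow (row : ℝ → Fin n → ℂ) {r : ℝ → Fin n → ℂ} {d : Fin n → ℂ}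
    {x : Fin n → ℝ} {j : Fin n} (hr : ∀ m, HasDerivAt (fun s => r s m) (d m) (x j)) :
    HasLineDerivAt ℝ (fun x : Fin n → ℝ => ((Matrix.of fun i => row (x i)).updateRow j (r (x j))).det)
      ((Matrix.of fun i => row (x i)).updateRow j d).det x (Pi.single j 1) := by
  rw [det_updateRow_eq_sum]
  have h1 : ∀ m, HasDerivAt (fun t : ℝ => r (x j + t) m) (d m) 0 := fun m => by
    refine HasDerivAt.comp_const_add (f := fun s => r s m) (x j) 0 ?_
    rw [add_zero]
    exact hr m
  refine (HasDerivAt.fun_sum fun m (_ : m ∈ Finset.univ) =>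
    (h1 m).mul_const ((Matrix.of fun i => row (x i)).adjugate m j)).congr_of_eventuallyEq
    (Eventually.of_forall fun t => ?_)
  beta_reduce
  rw [← det_updateRow_eq_sum]
  congr 1
  ext i m
  by_cases hi : i = j
  · subst hi
    simp
  · simp [Matrix.updateRow_ne hi, Pi.single_eq_of_ne hi]

end Slices

section Vandermonde

variable {n : ℕ}

/-- The variable `-2 cosh s`. -/
def vCosh (s : ℝ) : ℂ := ((-2 * Real.cosh s : ℝ) : ℂ)

/-- The powers of `-2 cosh s`. -/
def vRow (n : ℕ) (s : ℝ) (m : Fin n) : ℂ := vCosh s ^ (m : ℕ)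

/-- The derivatives of the powers of `-2 cosh s`. -/
def vRow' (n : ℕ) (s : ℝ) (m : Fin n) : ℂ :=
  (m : ℕ) * vCosh s ^ ((m : ℕ) - 1) * ((-2 * Real.sinh s : ℝ) : ℂ)

/-- The second derivatives of the powers of `-2 cosh s`. -/
def vRow'' (n : ℕ) (s : ℝ) (m : Fin n) : ℂ :=
  (m : ℕ) * ((((m : ℕ) - 1 : ℕ) : ℂ) * vCosh s ^ ((m : ℕ) - 1 - 1) * ((-2 * Real.sinh s : ℝ) : ℂ)) *
    ((-2 * Real.sinh s : ℝ) : ℂ) + (m : ℕ) * vCosh s ^ ((m : ℕ) - 1) * vCosh s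

theorem hasDerivAt_vCosh (s : ℝ) : HasDerivAt vCosh ((-2 * Real.sinh s : ℝ) : ℂ) s :=
  ((Real.hasDerivAt_cosh s).const_mul (-2)).ofReal_comp

theorem hasDerivAt_vRow (s : ℝ) (m : Fin n) : HasDerivAt (fun s => vRow n s m) (vRow' n s m) s :=
  (hasDerivAt_vCosh s).pow (m : ℕ)

theorem hasDerivAt_vRow' (s : ℝ) (m : Fin n) :
    HasDerivAt (fun s => vRow' n s m) (vRow'' n s m) s := by
  have h1 := ((hasDerivAt_vCosh s).pow ((m : ℕ) - 1)).const_mul ((m : ℕ) : ℂ)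
  have h2 : HasDerivAt (fun s : ℝ => ((-2 * Real.sinh s : ℝ) : ℂ)) (vCosh s) s :=
    ((Real.hasDerivAt_sinh s).const_mul (-2)).ofReal_comp
  exact h1.mul h2

theorem vRow_ode (ks kl : ℂ) {s : ℝ} (hs : 0 < s) (m : Fin n) :
    vRow'' n s m + radP ks kl s * vRow' n s m =
      (m : ℕ) * ((m : ℕ) + 2 * rhoOne ks kl) * vCosh s ^ (m : ℕ) -
      2 * ks * (m : ℕ) * vCosh s ^ ((m : ℕ) - 1) -
      4 * (m : ℕ) * (((m : ℕ) - 1 : ℕ) : ℂ) * vCosh s ^ ((m : ℕ) - 1 - 1) := by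
  have hm := exp_neg_mem_Ioo hs
  have h1 : radP ks kl s * ((-2 * Real.sinh s : ℝ) : ℂ) =
      2 * rhoOne ks kl * vCosh s - 2 * ks := by
    rw [radP_eq, vCosh, rhoOne, Real.cosh_eq, Real.sinh_eq, ← inv_inv (Real.exp s), ← Real.exp_neg]
    set q : ℂ := (Real.exp (-s) : ℂ) with hq
    have hq0 : q ≠ 0 := by rw [hq]; exact_mod_cast hm.1.ne'
    have hq1 : 1 - q ≠ 0 := by rw [hq]; exact_mod_cast (sub_pos.2 hm.2).ne'
    have hq2 : 1 - q ^ 2 ≠ 0 := by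
      rw [hq]; exact_mod_cast (one_sub_sq_pos hm).ne'
    simp only [Complex.ofReal_mul, Complex.ofReal_div, Complex.ofReal_sub, Complex.ofReal_add,
      Complex.ofReal_inv, Complex.ofReal_neg, Complex.ofReal_ofNat, ← hq]
    have hq3 : 1 + q ≠ 0 := fun h => hq2 (by linear_combination (1 - q) * h)
    have e2 : (1 : ℂ) - q ^ 2 = (1 - q) * (1 + q) := by ring
    rw [e2]
    field_simp
    ring
  have h2 : ((-2 * Real.sinh s : ℝ) : ℂ) ^ 2 = vCosh s ^ 2 - 4 := by
    have := Real.cosh_sq s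
    rw [vCosh, ← Complex.ofReal_pow, ← Complex.ofReal_pow]
    have e : (-2 * Real.sinh s) ^ 2 = (-2 * Real.cosh s) ^ 2 - 4 := by linear_combination -4 * this
    rw [e]; push_cast; ring
  rw [vRow'', vRow']
  generalize ((-2 * Real.sinh s : ℝ) : ℂ) = w at h1 h2
  generalize vCosh s = v at h1 h2
  rcases hm' : (m : ℕ) with _ | _ | p
  · simp
  · simp
    linear_combination h1
  · simp only [Nat.add_sub_cancel, Nat.cast_add, Nat.cast_one]
    linear_combination (p + 1 + 1) * (p + 1) * v ^ p * h2 + (p + 1 + 1) * v ^ (p + 1) * h1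

/-- The Vandermonde determinant in the variables `-2 cosh x_i`. -/
def vdet (x : Fin n → ℝ) : ℂ := (Matrix.of fun i => vRow n (x i)).det

theorem vdet_eq (x : Fin n → ℝ) : vdet x = ∏ i, ∏ j ∈ Finset.Ioi i, (vCosh (x j) - vCosh (x i)) :=
  Matrix.det_vandermonde fun i => vCosh (x i)

theorem sum_adjugate_mul_pow (x : Fin n → ℝ) (m : Fin n) {m' : ℕ} (hm' : m' < n) :
    ∑ j, vCosh (x j) ^ m' * (Matrix.of fun i => vRow n (x i)).adjugate m j =
      if m' = m then vdet x else 0 := by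
  have h := congrFun (congrFun (Matrix.adjugate_mul (Matrix.of fun i => vRow n (x i))) m) ⟨m', hm'⟩
  rw [Matrix.mul_apply] at h
  simp only [Matrix.smul_apply, Matrix.one_apply, smul_eq_mul, mul_ite, mul_one, mul_zero] at h
  rw [show (if m' = m then vdet x else 0) =
    if m = ⟨m', hm'⟩ then (Matrix.of fun i => vRow n (x i)).det else 0 by
      simp only [Fin.ext_iff, eq_comm]; rfl, ← h]
  exact Finset.sum_congr rfl fun j _ => mul_comm _ _

theorem sum_det_updateRow (ks kl : ℂ) {x : Fin n → ℝ} (hx : x ∈ chamber n) :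
    ∑ j, (((Matrix.of fun i => vRow n (x i)).updateRow j (vRow'' n (x j))).det +
      radP ks kl (x j) * ((Matrix.of fun i => vRow n (x i)).updateRow j (vRow' n (x j))).det) =
      (∑ m : Fin n, ((m : ℕ) : ℂ) * ((m : ℕ) + 2 * rhoOne ks kl)) * vdet x := by
  simp only [det_updateRow_eq_sum, Finset.mul_sum, ← Finset.sum_add_distrib]
  rw [Finset.sum_comm, Finset.sum_mul]
  refine Finset.sum_congr rfl fun m _ => ?_
  set A := (Matrix.of fun i => vRow n (x i)).adjugate with hA
  have h1 := sum_adjugate_mul_pow x m m.2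
  have h2 := sum_adjugate_mul_pow x m (show (m : ℕ) - 1 < n by omega)
  have h3 := sum_adjugate_mul_pow x m (show (m : ℕ) - 1 - 1 < n by omega)
  rw [if_pos rfl] at h1
  calc _ = ∑ j, ((m : ℕ) * ((m : ℕ) + 2 * rhoOne ks kl) * (vCosh (x j) ^ (m : ℕ) * A m j) -
      2 * ks * (m : ℕ) * (vCosh (x j) ^ ((m : ℕ) - 1) * A m j) -
      4 * (m : ℕ) * (((m : ℕ) - 1 : ℕ) : ℂ) * (vCosh (x j) ^ ((m : ℕ) - 1 - 1) * A m j)) := by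
        refine Finset.sum_congr rfl fun j _ => ?_
        rw [← mul_assoc, ← add_mul, vRow_ode ks kl (chamber_pos hx j)]
        ring
    _ = _ := by
        rw [Finset.sum_sub_distrib, Finset.sum_sub_distrib, ← Finset.mul_sum, ← Finset.mul_sum,
          ← Finset.mul_sum, h1, h2, h3]
        rcases hm : (m : ℕ) with _ | _ | p
        · simp
        · simp
        · rw [if_neg (by omega), if_neg (by omega)]
          ring

theorem vdet_eq_prod (x : Fin n → ℝ) :
    vdet x = ∏ α ∈ middleRoots n, ((2 * Real.sinh (pair α x / 2) : ℝ) : ℂ) := by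
  rw [vdet_eq, prod_middleRoots]
  refine Finset.prod_congr rfl fun i _ => Finset.prod_congr rfl fun j _ => ?_
  simp only [pair_sub_left, pair_add_left, pair_single, vCosh]
  rw [← Complex.ofReal_mul, ← Complex.ofReal_sub]
  congr 1
  have e1 : x i = (x i - x j) / 2 + (x i + x j) / 2 := by ring
  have e2 : x j = (x i + x j) / 2 - (x i - x j) / 2 := by ring
  conv_lhs => rw [e2]
  conv_lhs => enter [2]; rw [e1]
  rw [Real.cosh_add, Real.cosh_sub]
  push_cast
  ring_nf

theorem cosh_div_sinh {y : ℝ} (hy : 0 < y) :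
    Real.cosh (y / 2) / Real.sinh (y / 2) = (1 + Real.exp (-y)) / (1 - Real.exp (-y)) := by
  have h : Real.exp (-y) = Real.exp (-(y / 2)) * Real.exp (-(y / 2)) := by
    rw [← Real.exp_add]; ring_nf
  have hm := exp_neg_mem_Ioo hy
  have hm2 := exp_neg_mem_Ioo (half_pos hy)
  rw [Real.cosh_eq, Real.sinh_eq, ← inv_inv (Real.exp (y / 2)), ← Real.exp_neg]
  rw [h] at hm ⊢
  set q := Real.exp (-(y / 2))
  have h1 := hm2.1
  have h2 : 1 - q * q ≠ 0 := (sub_pos.2 hm.2).ne'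
  have h3 : (q⁻¹ - q) ≠ 0 := by
    intro h0
    apply h2
    field_simp at h0
    linarith
  field_simp

theorem sinh_pair_pos {x : Fin n → ℝ} (hx : x ∈ chamber n) {α : Fin n → ℤ} (hα : α ∈ middleRoots n) :
    0 < Real.sinh (pair α x / 2) :=
  Real.sinh_pos_iff.2 (half_pos (hx α (mem_posRoots.2 (Or.inr (Or.inr hα)))))

theorem vdet_ne_zero {x : Fin n → ℝ} (hx : x ∈ chamber n) : vdet x ≠ 0 := by
  rw [vdet_eq_prod, Finset.prod_ne_zero_iff]
  intro α hα
  exact_mod_cast (mul_pos two_pos (sinh_pair_pos hx hα)).ne'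

theorem hasLineDerivAt_vdet (x : Fin n → ℝ) (j : Fin n) : HasLineDerivAt ℝ vdet
    ((Matrix.of fun i => vRow n (x i)).updateRow j (vRow' n (x j))).det x (Pi.single j 1) := by
  have h := hasLineDerivAt_det_updateRow (vRow n) (r := vRow n) (x := x) (j := j)
    fun m => hasDerivAt_vRow (x j) m
  convert! h using 1
  funext y
  rw [vdet]
  congr 1
  ext i m
  by_cases hi : i = j
  · subst hi; simp
  · simp [Matrix.updateRow_ne hi]

theorem middleCoth_mul_vdet {x : Fin n → ℝ} (hx : x ∈ chamber n) (j : Fin n) :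
    middleCoth x j * vdet x =
      2 * ((Matrix.of fun i => vRow n (x i)).updateRow j (vRow' n (x j))).det := by
  have h1 : ∀ α ∈ middleRoots n, HasDerivAt
      (fun t : ℝ => ((2 * Real.sinh (pair α (x + t • Pi.single j 1) / 2) : ℝ) : ℂ))
      (((Real.cosh (pair α x / 2) * α j : ℝ)) : ℂ) 0 := by
    intro α _
    have h0 : HasDerivAt (fun t : ℝ => pair α (x + t • Pi.single j 1) / 2) ((α j : ℝ) / 2) 0 := by
      have e : (fun t : ℝ => pair α (x + t • Pi.single j 1) / 2) =
          fun t => pair α x / 2 + t * ((α j : ℝ) / 2) := by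
        funext t
        rw [pair_add_right, pair_smul_right]
        have : pair α (Pi.single j 1 : Fin n → ℝ) = α j := by simp [pair, Pi.single_apply]
        rw [this]; ring
      rw [e]
      simpa using ((hasDerivAt_id (0 : ℝ)).mul_const ((α j : ℝ) / 2)).const_add (pair α x / 2)
    have h2 := (h0.sinh.const_mul 2).ofReal_comp
    convert! h2 using 1
    simp
    ring
  have h2 := HasDerivAt.fun_finsetProd h1
  have h3 : HasDerivAt (fun t : ℝ => vdet (x + t • Pi.single j 1)) _ 0 :=
    h2.congr_of_eventuallyEq (Eventually.of_forall fun t => vdet_eq_prod _)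
  have h4 := (hasLineDerivAt_vdet x j : HasDerivAt _ _ _).unique h3
  rw [h4, middleCoth, Finset.sum_mul, Finset.mul_sum]
  refine Finset.sum_congr rfl fun α hα => ?_
  rw [vdet_eq_prod, ← Finset.mul_prod_erase _ _ hα]
  have hs := sinh_pair_pos hx hα
  have hs' : (Complex.ofReal (Real.sinh (pair α x / 2))) ≠ 0 := by exact_mod_cast hs.ne'
  rw [← cosh_div_sinh (hx α (mem_posRoots.2 (Or.inr (Or.inr hα))))]
  simp only [zero_smul, add_zero, smul_eq_mul]
  simp only [Complex.ofReal_mul, Complex.ofReal_div, Complex.ofReal_intCast, Complex.ofReal_ofNat]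
  field_simp

end Vandermonde

section Smooth

variable {n : ℕ}

theorem ofReal_exp_neg_cpow (s : ℂ) (x : ℝ) :
    (Real.exp (-x) : ℂ) ^ s = Complex.exp (-s * x) := by
  rw [Complex.cpow_def_of_ne_zero (by exact_mod_cast (Real.exp_pos _).ne'),
    ← Complex.ofReal_log (Real.exp_pos _).le, Real.log_exp]
  push_cast
  ring_nf

theorem contDiffAt_hcOne (ks kl l : ℂ) {x : ℝ} (hx : 0 < x) : ContDiffAt ℝ 2 (hcOne ks kl l) x := by
  have h1 : ContDiffAt ℝ 2 (fun x : ℝ => (Real.exp (-x) : ℂ)) x :=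
    (Complex.ofRealCLM.contDiff.comp (Real.contDiff_exp.comp contDiff_neg)).contDiffAt
  have h2 : ContDiffAt ℝ 2 (fun x : ℝ => Complex.exp (-(rhoOne ks kl - l) * x)) x :=
    (Complex.contDiff_exp (𝕜 := ℝ)).contDiffAt.comp x
      (contDiffAt_const.mul Complex.ofRealCLM.contDiff.contDiffAt)
  have h3 : ContDiffAt ℝ 2 (psum (hcCoef ks kl l)) (Real.exp (-x) : ℂ) :=
    ((tame_hcCoef ks kl l).analyticAt
      (norm_lt_one_of_mem_Ioo (exp_neg_mem_Ioo hx))).contDiffAt.restrict_scalars ℝ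
  refine (h2.mul (h3.comp x h1)).congr_of_eventuallyEq (Eventually.of_forall fun y => ?_)
  simp only [hcOne, ofReal_exp_neg_cpow, Function.comp_apply]

theorem contDiffOn_prod_hcOne (ks kl : ℂ) (l : Fin n → ℂ) :
    ContDiffOn ℝ 2 (fun x : Fin n → ℝ => ∏ j, hcOne ks kl (l j) (x j)) (chamber n) := by
  intro x hx
  refine ContDiffAt.contDiffWithinAt (contDiffAt_prod fun j _ => ?_)
  exact (contDiffAt_hcOne ks kl (l j) (chamber_pos hx j)).comp x
    (contDiff_apply ℝ ℝ j).contDiffAt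

theorem contDiff_vdet : ContDiff ℝ 2 (vdet (n := n)) := by
  have : (vdet (n := n)) = fun x => ∏ α ∈ middleRoots n, ((2 * Real.sinh (pair α x / 2) : ℝ) : ℂ) :=
    funext vdet_eq_prod
  rw [this]
  refine contDiff_prod fun α _ => Complex.ofRealCLM.contDiff.comp ?_
  have hp : ContDiff ℝ 2 fun x : Fin n → ℝ => pair α x := by
    unfold pair
    exact ContDiff.sum fun i _ => contDiff_const.mul (contDiff_apply ℝ ℝ i)
  exact contDiff_const.mul (Real.contDiff_sinh.comp (hp.div_const 2))

end Smooth

section Existence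

variable {n : ℕ} {ks kl : ℂ} {l : Fin n → ℂ}

theorem prod_hcOne_eq (x : Fin n → ℝ) :
    ∏ j, hcOne ks kl (l j) (x j) = Complex.exp (∑ i, (l i - rhoOne ks kl) * (x i : ℂ)) *
      ∏ j, psum (hcCoef ks kl (l j)) (Real.exp (-x j) : ℂ) := by
  rw [Complex.exp_sum, ← Finset.prod_mul_distrib]
  refine Finset.prod_congr rfl fun j _ => ?_
  rw [hcOne, ofReal_exp_neg_cpow, neg_sub]

theorem isQSeries_prod_psum (l : Fin n → ℂ) :
    IsQSeries fun x : Fin n → ℝ => ∏ j, psum (hcCoef ks kl (l j)) (Real.exp (-x j) : ℂ) :=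
  IsQSeries.prod fun j _ => isQSeries_psum (tame_hcCoef ks kl (l j)) (by rw [hcCoef]) j

theorem vdet_eq_exp_mul (x : Fin n → ℝ) :
    vdet x = Complex.exp (∑ i : Fin n, ((n - 1 - (i : ℕ) : ℕ) : ℂ) * (x i : ℂ)) *
      ∏ α ∈ middleRoots n, (1 - (Real.exp (-pair α x) : ℂ)) := by
  have h1 : ∀ α : Fin n → ℤ, ((2 * Real.sinh (pair α x / 2) : ℝ) : ℂ) =
      Complex.exp ((pair α x / 2 : ℝ)) * (1 - (Real.exp (-pair α x) : ℂ)) := by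
    intro α
    rw [← Complex.ofReal_exp, ← Complex.ofReal_one, ← Complex.ofReal_sub, ← Complex.ofReal_mul,
      Real.sinh_eq, mul_sub, mul_one, ← Real.exp_add]
    congr 1
    ring_nf
  rw [vdet_eq_prod, Finset.prod_congr rfl fun α _ => h1 α, Finset.prod_mul_distrib,
    ← Complex.exp_sum, sum_middleRoots]
  congr 2
  refine Finset.sum_congr rfl fun i _ => ?_
  have h2 : ∀ j : Fin n, (((pair (Pi.single i 1 - Pi.single j 1) x / 2 : ℝ) : ℂ) +
      ((pair (Pi.single i 1 + Pi.single j 1) x / 2 : ℝ) : ℂ)) = x i := by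
    intro j
    simp only [pair_sub_left, pair_add_left, pair_single]
    push_cast
    ring
  simp only [h2, Finset.sum_const, Fin.card_Ioi, nsmul_eq_mul]

theorem expansion_of_isQSeries {k : Mult} {u f : (Fin n → ℝ) → ℂ} (hf : IsQSeries f)
    (h : ∀ x ∈ chamber n, u x = Complex.exp (∑ i, (l i - rho n k i) * (x i : ℂ)) * f x) :
    ∃ Γ : rootCone n → ℂ, Γ 0 = 1 ∧ ∀ x ∈ chamber n, HasSum (fun μ : rootCone n =>
      Γ μ * Complex.exp (∑ i, (l i - rho n k i - ((μ : Fin n → ℤ) i : ℂ)) * (x i : ℂ))) (u x) := by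
  obtain ⟨Γ, h0, hs⟩ := hf
  refine ⟨Γ, h0, fun x hx => ?_⟩
  rw [h x hx]
  refine ((hs x hx).mul_left _).congr_fun fun μ => ?_
  have := monom_eq (fun i => l i - rho n k i) μ x
  rw [monom] at this
  rw [this]
  ring

theorem hasLineDerivAt_prod_hcOne (hl : ∀ j, NotInt (2 * l j)) {x : Fin n → ℝ} (hx : x ∈ chamber n)
    (j : Fin n) : HasLineDerivAt ℝ (fun x : Fin n → ℝ => ∏ j, hcOne ks kl (l j) (x j))
      (hcOne' ks kl (l j) (x j) * ∏ i ∈ Finset.univ.erase j, hcOne ks kl (l i) (x i)) x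
      (Pi.single j 1) := by
  have h := hasLineDerivAt_mul_prod_erase (fun i => hcOne ks kl (l i))
    ((isSol_hcOne ks kl (hl j)).deriv_one (x j) (chamber_pos hx j))
  simpa only [Finset.mul_prod_erase _ (fun i : Fin n => hcOne ks kl (l i) _) (Finset.mem_univ j)] using h

theorem hasLineDerivAt_prod_hcOne' (hl : ∀ j, NotInt (2 * l j)) {x : Fin n → ℝ} (hx : x ∈ chamber n)
    (j : Fin n) : HasLineDerivAt ℝ (fun x : Fin n → ℝ => hcOne' ks kl (l j) (x j) *
        ∏ i ∈ Finset.univ.erase j, hcOne ks kl (l i) (x i))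
      ((-(radP ks kl (x j) * hcOne' ks kl (l j) (x j)) -
        (rhoOne ks kl ^ 2 - l j ^ 2) * hcOne ks kl (l j) (x j)) *
        ∏ i ∈ Finset.univ.erase j, hcOne ks kl (l i) (x i)) x (Pi.single j 1) :=
  hasLineDerivAt_mul_prod_erase (fun i => hcOne ks kl (l i))
    ((isSol_hcOne ks kl (hl j)).deriv_two (x j) (chamber_pos hx j))

theorem isHarishChandraSeries_zero (hl : ∀ j, NotInt (2 * l j)) :
    IsHarishChandraSeries (ks, 0, kl) l (fun x => ∏ j, hcOne ks kl (l j) (x j)) where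
  contDiffOn := contDiffOn_prod_hcOne ks kl l
  eigen x hx := by
    have hd := ((contDiffOn_prod_hcOne ks kl l).contDiffAt
      ((isOpen_chamber n).mem_nhds hx)).differentiableAt (by norm_num)
    rw [laplace_eq (ks, 0, kl) hx hd (u2 := fun j x =>
      (-(radP ks kl (x j) * hcOne' ks kl (l j) (x j)) -
        (rhoOne ks kl ^ 2 - l j ^ 2) * hcOne ks kl (l j) (x j)) *
        ∏ i ∈ Finset.univ.erase j, hcOne ks kl (l i) (x i)) (fun j y hy => hasLineDerivAt_prod_hcOne hl hy j)
      (fun j => hasLineDerivAt_prod_hcOne' hl hx j)]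
    simp only [rho_apply, mul_zero, add_zero, zero_mul]
    rw [← Finset.sum_sub_distrib, Finset.sum_mul]
    refine Finset.sum_congr rfl fun j _ => ?_
    rw [← Finset.mul_prod_erase _ _ (Finset.mem_univ j)]
    ring
  expansion := expansion_of_isQSeries (isQSeries_prod_psum (ks := ks) (kl := kl) l) fun x _ => by
    simp only [rho_apply, mul_zero, add_zero]
    exact prod_hcOne_eq x

theorem sum_rho_sq : ∑ i, rho n (ks, 1, kl) i ^ 2 = n * rhoOne ks kl ^ 2 +
    ∑ m : Fin n, ((m : ℕ) : ℂ) * ((m : ℕ) + 2 * rhoOne ks kl) := by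
  have h1 : ∀ i : Fin n, rho n (ks, 1, kl) i ^ 2 =
      rhoOne ks kl ^ 2 + ((Fin.rev i : ℕ) : ℂ) * ((Fin.rev i : ℕ) + 2 * rhoOne ks kl) := by
    intro i
    rw [rho_apply, Fin.val_rev, show n - ((i : ℕ) + 1) = n - 1 - i by omega]
    ring
  simp only [h1]
  rw [Finset.sum_add_distrib, Finset.sum_const, Finset.card_univ, Fintype.card_fin, nsmul_eq_mul]
  congr 1
  exact Equiv.sum_comp Fin.revPerm fun m : Fin n => ((m : ℕ) : ℂ) * ((m : ℕ) + 2 * rhoOne ks kl)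

theorem contDiffOn_prod_hcOne_div (ks kl : ℂ) (l : Fin n → ℂ) :
    ContDiffOn ℝ 2 (fun x => (∏ j, hcOne ks kl (l j) (x j)) / vdet x) (chamber n) := by
  simp only [div_eq_mul_inv]
  exact (contDiffOn_prod_hcOne ks kl l).mul (contDiff_vdet.contDiffOn.inv fun x hx => vdet_ne_zero hx)

theorem isHarishChandraSeries_one (hl : ∀ j, NotInt (2 * l j)) :
    IsHarishChandraSeries (ks, 1, kl) l (fun x => (∏ j, hcOne ks kl (l j) (x j)) / vdet x) where
  contDiffOn := contDiffOn_prod_hcOne_div ks kl l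
  eigen x hx := by
    have hd := ((contDiffOn_prod_hcOne_div ks kl l).contDiffAt
      ((isOpen_chamber n).mem_nhds hx)).differentiableAt (by norm_num)
    have z : ∀ (j : Fin n) (y : Fin n → ℝ), y + (0 : ℝ) • (Pi.single j 1 : Fin n → ℝ) = y := by simp
    have hV0 := vdet_ne_zero hx
    set G : (Fin n → ℝ) → ℂ := fun x => ∏ j, hcOne ks kl (l j) (x j) with hG
    set G1 : Fin n → (Fin n → ℝ) → ℂ := fun j x => hcOne' ks kl (l j) (x j) *
        ∏ i ∈ Finset.univ.erase j, hcOne ks kl (l i) (x i) with hG1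
    set G2 : Fin n → (Fin n → ℝ) → ℂ := fun j x => (-(radP ks kl (x j) * hcOne' ks kl (l j) (x j)) -
        (rhoOne ks kl ^ 2 - l j ^ 2) * hcOne ks kl (l j) (x j)) *
        ∏ i ∈ Finset.univ.erase j, hcOne ks kl (l i) (x i) with hG2
    set V1 : Fin n → (Fin n → ℝ) → ℂ := fun j x =>
        ((Matrix.of fun i => vRow n (x i)).updateRow j (vRow' n (x j))).det with hV1
    set V2 : Fin n → (Fin n → ℝ) → ℂ := fun j x =>
        ((Matrix.of fun i => vRow n (x i)).updateRow j (vRow'' n (x j))).det with hV2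
    have hL := laplace_eq (ks, 1, kl) (u := fun x => G x / vdet x) hx hd
      (u1 := fun j x => (G1 j x * vdet x - G x * V1 j x) / vdet x ^ 2)
      (u2 := fun j x => ((G2 j x * vdet x + G1 j x * V1 j x - (G1 j x * V1 j x + G x * V2 j x)) *
        vdet x ^ 2 - (G1 j x * vdet x - G x * V1 j x) * (2 * vdet x ^ 1 * V1 j x)) /
        (vdet x ^ 2) ^ 2)
      (fun j y hy => by
        have h1 : HasDerivAt _ _ _ := hasLineDerivAt_prod_hcOne (ks := ks) (kl := kl) hl hy j
        have h2 : HasDerivAt _ _ _ := hasLineDerivAt_vdet y j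
        have h3 := h1.fun_div h2 (by rw [z]; exact vdet_ne_zero hy)
        rw [z] at h3
        exact h3)
      (fun j => by
        have h1 : HasDerivAt _ _ _ := hasLineDerivAt_prod_hcOne (ks := ks) (kl := kl) hl hx j
        have h2 : HasDerivAt _ _ _ := hasLineDerivAt_vdet x j
        have h3 : HasDerivAt _ _ _ := hasLineDerivAt_prod_hcOne' (ks := ks) (kl := kl) hl hx j
        have h4 : HasDerivAt _ _ _ := hasLineDerivAt_det_updateRow (vRow n) (r := vRow' n)
          fun m => hasDerivAt_vRow' (x j) m
        have h5 := ((h3.fun_mul h2).fun_sub (h1.fun_mul h4)).fun_div (h2.fun_pow 2)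
          (by rw [z]; exact pow_ne_zero 2 (vdet_ne_zero hx))
        rw [z] at h5
        exact h5)
    have hterm : ∀ j, ((G2 j x * vdet x + G1 j x * V1 j x - (G1 j x * V1 j x + G x * V2 j x)) *
        vdet x ^ 2 - (G1 j x * vdet x - G x * V1 j x) * (2 * vdet x ^ 1 * V1 j x)) /
        (vdet x ^ 2) ^ 2 + (radP ks kl (x j) + 1 * middleCoth x j) *
        ((G1 j x * vdet x - G x * V1 j x) / vdet x ^ 2) =
        (l j ^ 2 - rhoOne ks kl ^ 2) * (G x / vdet x) -
          G x / vdet x ^ 2 * (V2 j x + radP ks kl (x j) * V1 j x) := by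
      intro j
      have e1 : G2 j x = -(radP ks kl (x j) * G1 j x) - (rhoOne ks kl ^ 2 - l j ^ 2) * G x := by
        simp only [hG2, hG1, hG]
        rw [← Finset.mul_prod_erase _ _ (Finset.mem_univ j)]
        ring
      have e2 : middleCoth x j = 2 * V1 j x / vdet x := by
        rw [eq_div_iff hV0]
        exact middleCoth_mul_vdet hx j
      rw [e1, e2]
      field_simp
      ring
    have hsum : ∑ j, (V2 j x + radP ks kl (x j) * V1 j x) =
      (∑ m : Fin n, ((m : ℕ) : ℂ) * ((m : ℕ) + 2 * rhoOne ks kl)) * vdet x :=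
      sum_det_updateRow ks kl hx
    refine hL.trans ((Finset.sum_congr rfl fun j _ => hterm j).trans ?_)
    rw [Finset.sum_sub_distrib, ← Finset.mul_sum, hsum, sum_rho_sq, ← Finset.sum_mul,
      Finset.sum_sub_distrib, Finset.sum_const, Finset.card_univ, Fintype.card_fin, nsmul_eq_mul]
    field_simp
    ring
  expansion := by
    refine expansion_of_isQSeries (l := l) ((isQSeries_prod_psum (ks := ks) (kl := kl) l).mul
      (IsQSeries.prod (s := middleRoots n) fun α hα =>
        isQSeries_geometric (mem_posRoots.2 (Or.inr (Or.inr hα))))) fun x _ => ?_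
    rw [prod_hcOne_eq, vdet_eq_exp_mul, mul_div_mul_comm, ← Complex.exp_sub, Finset.prod_inv_distrib,
      ← div_eq_mul_inv, ← Finset.sum_sub_distrib]
    congr 2
    refine Finset.sum_congr rfl fun i _ => ?_
    rw [rho_apply]
    ring

end Existence

theorem NotPole.gamma_ne_zero {s : ℂ} (h : NotPole s) : Complex.Gamma s ≠ 0 :=
  Complex.Gamma_ne_zero h

section NoPole

variable {n : ℕ} {k : Mult} {l : Fin n → ℂ}

theorem NoPole.short (h : NoPole k l) (p : Fin n) : NotPole (2 * l p) := fun m => by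
  have := h _ (mem_posRoots.2 (Or.inl ⟨p, rfl⟩)) m
  rwa [corootPair_short, halfRootMult_short, zero_div, add_zero] at this

theorem NoPole.long (h : NoPole k l) (p : Fin n) : NotPole (l p + k.1 / 2) := fun m => by
  have := h _ (mem_posRoots.2 (Or.inr (Or.inl ⟨p, rfl⟩))) m
  rwa [corootPair_long, halfRootMult_long] at this

theorem NoPole.middle (h : NoPole k l) {α : Fin n → ℤ} (hα : α ∈ middleRoots n) :
    NotPole (pair α l) := fun m => by
  have := h _ (mem_posRoots.2 (Or.inr (Or.inr hα))) m
  rwa [corootPair_middle _ hα, halfRootMult_middle _ hα, zero_div, add_zero] at this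

theorem NoPole.sub (h : NoPole k l) {i j : Fin n} (hij : i < j) : NotPole (l i - l j) := by
  have := h.middle (mem_middleRoots.2 ⟨i, j, hij, Or.inl rfl⟩)
  simpa [pair_sub_left, pair_single] using this

theorem NoPole.add (h : NoPole k l) {i j : Fin n} (hij : i < j) : NotPole (l i + l j) := by
  have := h.middle (mem_middleRoots.2 ⟨i, j, hij, Or.inr rfl⟩)
  simpa [pair_add_left, pair_single] using this

end NoPole

/-- The part of `c̃` coming from a short root and its double. -/
def cTildeOne (ks kl l : ℂ) : ℂ :=
  Complex.Gamma (2 * l) * ((√Real.pi : ℝ) : ℂ) * 2 ^ (1 - 2 * l - ks) /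
    (Complex.Gamma (l + ks / 2 + 1 / 2) * Complex.Gamma (rhoOne ks kl + l))

/-- The constant by which the rank one functions `c̃` and `c` differ. -/
def cRatio (ks kl : ℂ) : ℂ :=
  ((√Real.pi : ℝ) : ℂ) * 2 ^ (1 - 2 * rhoOne ks kl - ks) / Complex.Gamma (ks + kl + 1 / 2)

theorem ofReal_sqrt_pi_ne_zero : ((√Real.pi : ℝ) : ℂ) ≠ 0 := by
  exact_mod_cast (Real.sqrt_pos.2 Real.pi_pos).ne'

theorem two_cpow_ne_zero (s : ℂ) : (2 : ℂ) ^ s ≠ 0 := by simp [Complex.cpow_eq_zero_iff]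

theorem cTildeOne_eq_gamma (ks kl : ℂ) {l : ℂ} (h : NotPole (l + ks / 2)) :
    Complex.Gamma (2 * l) / Complex.Gamma (2 * l + ks) *
      (Complex.Gamma (l + ks / 2) / Complex.Gamma (l + ks / 2 + kl)) = cTildeOne ks kl l := by
  have hd := Complex.Gamma_mul_Gamma_add_half (l + ks / 2)
  have h0 := h.gamma_ne_zero
  rw [cTildeOne, rhoOne, show l + ks / 2 + kl = ks / 2 + kl + l by ring]
  rw [show 2 * (l + ks / 2) = 2 * l + ks by ring, show 1 - (2 * l + ks) = 1 - 2 * l - ks by ring] at hd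
  have hs := ofReal_sqrt_pi_ne_zero
  have h2 := two_cpow_ne_zero (1 - 2 * l - ks)
  generalize ((√Real.pi : ℝ) : ℂ) = s at *
  generalize (2 : ℂ) ^ (1 - 2 * l - ks) = P at *
  have e : Complex.Gamma (2 * l + ks) =
      Complex.Gamma (l + ks / 2) * Complex.Gamma (l + ks / 2 + 1 / 2) / (P * s) := by
    rw [hd]; field_simp
  rw [e]
  generalize Complex.Gamma (l + ks / 2) = A at *
  generalize Complex.Gamma (l + ks / 2 + 1 / 2) = B at *
  generalize Complex.Gamma (ks / 2 + kl + l) = C at *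
  rcases eq_or_ne B 0 with rfl | hB
  · simp
  rcases eq_or_ne C 0 with rfl | hC
  · simp
  field_simp

theorem cTildeOne_eq {ks kl : ℂ} (hC : NotPole (ks + kl + 1 / 2)) (l : ℂ) :
    cTildeOne ks kl l = cRatio ks kl * cOne ks kl l := by
  have h0 := hC.gamma_ne_zero
  have h4 : (4 : ℂ) ^ (rhoOne ks kl - l) = 2 ^ (rhoOne ks kl - l) * 2 ^ (rhoOne ks kl - l) := by
    have := Complex.mul_cpow_ofReal_nonneg (zero_le_two (α := ℝ)) (zero_le_two (α := ℝ))
      (rhoOne ks kl - l)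
    norm_num at this
    exact this
  have h2 : (2 : ℂ) ^ (1 - 2 * l - ks) = 2 ^ (1 - 2 * rhoOne ks kl - ks) *
      (2 ^ (rhoOne ks kl - l) * 2 ^ (rhoOne ks kl - l)) := by
    rw [← Complex.cpow_add _ _ two_ne_zero, ← Complex.cpow_add _ _ two_ne_zero]
    ring_nf
  rw [cTildeOne, cRatio, cOne, h4, h2]
  generalize Complex.Gamma (ks + kl + 1 / 2) = X at *
  generalize Complex.Gamma (l + ks / 2 + 1 / 2) = Y
  field_simp

section CTilde

variable {n : ℕ} {k : Mult} {l : Fin n → ℂ}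

theorem cTilde_eq (h : NoPole k l) : cTilde k l = (∏ p, cTildeOne k.1 k.2.2 (l p)) *
    ∏ i, ∏ j ∈ Finset.Ioi i, (Complex.Gamma (l i - l j) / Complex.Gamma (l i - l j + k.2.1) *
      (Complex.Gamma (l i + l j) / Complex.Gamma (l i + l j + k.2.1))) := by
  have hm : ∀ α ∈ middleRoots n, Complex.Gamma (corootPair l α + halfRootMult k α / 2) /
      Complex.Gamma (corootPair l α + halfRootMult k α / 2 + rootMult k α) =
      Complex.Gamma (pair α l) / Complex.Gamma (pair α l + k.2.1) := by
    intro α hα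
    rw [corootPair_middle _ hα, halfRootMult_middle _ hα, rootMult_middle _ hα, zero_div, add_zero]
  rw [cTilde, prod_posRoots, Finset.prod_congr rfl hm, prod_middleRoots, ← Finset.prod_mul_distrib]
  congr 1
  · refine Finset.prod_congr rfl fun p _ => ?_
    rw [corootPair_short, corootPair_long, halfRootMult_short, halfRootMult_long, rootMult_short,
      rootMult_long, zero_div, add_zero, cTildeOne_eq_gamma _ _ (h.long p)]
  · simp only [pair_sub_left, pair_add_left, pair_single, Int.cast_one, one_mul]

theorem cTilde_zero {ks kl : ℂ} (hC : NotPole (ks + kl + 1 / 2)) (h : NoPole (ks, 0, kl) l) :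
    cTilde (ks, 0, kl) l = cRatio ks kl ^ n * ∏ p, cOne ks kl (l p) := by
  rw [cTilde_eq h]
  simp only [cTildeOne_eq hC, Finset.prod_mul_distrib (f := fun _ => cRatio ks kl),
    Finset.prod_const, Finset.card_univ, Fintype.card_fin]
  have h1 : ∏ i : Fin n, ∏ j ∈ Finset.Ioi i, (Complex.Gamma (l i - l j) /
      Complex.Gamma (l i - l j + 0) * (Complex.Gamma (l i + l j) / Complex.Gamma (l i + l j + 0))) = 1 := by
    refine Finset.prod_eq_one fun i _ => Finset.prod_eq_one fun j hj => ?_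
    have hij := Finset.mem_Ioi.1 hj
    rw [add_zero, add_zero, div_self (h.sub hij).gamma_ne_zero, div_self (h.add hij).gamma_ne_zero,
      one_mul]
  rw [h1, mul_one]

theorem cTilde_one {ks kl : ℂ} (hC : NotPole (ks + kl + 1 / 2)) (h : NoPole (ks, 1, kl) l) :
    cTilde (ks, 1, kl) l = cRatio ks kl ^ n * (∏ p, cOne ks kl (l p)) /
      ∏ i, ∏ j ∈ Finset.Ioi i, (l i ^ 2 - l j ^ 2) := by
  rw [cTilde_eq h, div_eq_mul_inv]
  simp only [cTildeOne_eq hC, Finset.prod_mul_distrib (f := fun _ => cRatio ks kl),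
    Finset.prod_const, Finset.card_univ, Fintype.card_fin]
  rw [← Finset.prod_inv_distrib]
  congr 1
  refine Finset.prod_congr rfl fun i _ => ?_
  rw [← Finset.prod_inv_distrib]
  refine Finset.prod_congr rfl fun j hj => ?_
  have hij := Finset.mem_Ioi.1 hj
  have h1 := (h.sub hij).gamma_ne_zero
  have h2 := (h.add hij).gamma_ne_zero
  have h3 := (h.sub hij).ne_zero
  have h4 := (h.add hij).ne_zero
  rw [Complex.Gamma_add_one _ h3, Complex.Gamma_add_one _ h4,
    show l i ^ 2 - l j ^ 2 = (l i - l j) * (l i + l j) by ring]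
  field_simp

end CTilde

section Reindex

theorem prod_fin_Ioi {n : ℕ} {M : Type*} [CommMonoid M] (f : ℕ → ℕ → M) :
    ∏ i : Fin n, ∏ j ∈ Finset.Ioi i, f (n - 1 - i) (n - 1 - j) =
      ∏ a ∈ Finset.range n, ∏ b ∈ Finset.range a, f a b := by
  rw [← Finset.prod_range_reflect, ← Fin.prod_univ_eq_prod_range
    (fun i => ∏ b ∈ Finset.range (n - 1 - i), f (n - 1 - i) b)]
  refine Finset.prod_congr rfl fun i _ => ?_
  refine Finset.prod_bij (fun j _ => n - 1 - (j : ℕ)) ?_ ?_ ?_ ?_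
  · intro j hj
    have := Finset.mem_Ioi.1 hj
    simp only [Finset.mem_range]
    omega
  · intro j _ j' _ e
    ext
    omega
  · intro b hb
    rw [Finset.mem_range] at hb
    refine ⟨⟨n - 1 - b, by omega⟩, ?_, ?_⟩
    · rw [Finset.mem_Ioi, Fin.lt_def]
      simp only
      omega
    · simp only
      omega
  · intro j _
    rfl

theorem prod_range_div_succ {f : ℕ → ℂ} {a : ℕ} (h0 : f 0 ≠ 0) (hf : ∀ b < a, f b ≠ 0) :
    ∏ b ∈ Finset.range a, f b / f (b + 1) = f 0 / f a := by
  induction a with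
  | zero => simp [h0]
  | succ a ih =>
    rw [Finset.prod_range_succ, ih fun b hb => hf b (by omega),
      div_mul_div_cancel₀ (hf a (by omega))]

end Reindex

theorem notPole_nat_add_one (a : ℕ) : NotPole ((a : ℂ) + 1) := fun m h =>
  Nat.cast_add_one_ne_zero (R := ℂ) (a + m) (by push_cast; linear_combination h)

section AtRho

variable {n : ℕ}

/-- The closed form of `c̃(ρ(k), k)`, in which the singularity at `k_m = 0` is removed. -/
def cTildeRhoFormula (n : ℕ) (k : Mult) : ℂ :=
  ∏ a ∈ Finset.range n, ((((√Real.pi : ℝ) : ℂ) *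
    2 ^ (1 - 2 * (rhoOne k.1 k.2.2 + a * k.2.1) - k.1) *
    (Complex.Gamma (k.1 + k.2.2 + 1 / 2 + a * k.2.1))⁻¹) *
      ((a + 1) * Complex.Gamma (k.2.1 + 1) * (Complex.Gamma ((a + 1) * k.2.1 + 1))⁻¹))

theorem rho_of_lt (k : Mult) {a : ℕ} (ha : a < n) :
    rho n k ⟨n - 1 - a, by omega⟩ = rhoOne k.1 k.2.2 + a * k.2.1 := by
  rw [rho_apply]
  congr 3
  simp only
  omega

theorem cTilde_rho (hn : 2 ≤ n) {k : Mult} (h : NoPole k (rho n k)) :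
    cTilde k (rho n k) = cTildeRhoFormula n k := by
  obtain ⟨ks, km, kl⟩ := k
  set R := rhoOne ks kl with hR
  have hsub : ∀ a b : ℕ, a < n → b < a → NotPole (((a - b : ℕ) : ℂ) * km) := by
    intro a b ha hb
    have := h.sub (i := ⟨n - 1 - a, by omega⟩) (j := ⟨n - 1 - b, by omega⟩)
      (by rw [Fin.lt_def]; simp only; omega)
    rw [rho_of_lt _ ha, rho_of_lt _ (hb.trans ha)] at this
    convert! this using 1
    push_cast [hb.le]
    ring
  have hadd : ∀ a b : ℕ, a < n → b < a → NotPole (2 * R + (a + b : ℕ) * km) := by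
    intro a b ha hb
    have := h.add (i := ⟨n - 1 - a, by omega⟩) (j := ⟨n - 1 - b, by omega⟩)
      (by rw [Fin.lt_def]; simp only; omega)
    rw [rho_of_lt _ ha, rho_of_lt _ (hb.trans ha)] at this
    convert! this using 1
    push_cast
    ring
  have hshort : ∀ a : ℕ, a < n → NotPole (2 * R + (a + a : ℕ) * km) := by
    intro a ha
    have := h.short ⟨n - 1 - a, by omega⟩
    rw [rho_of_lt _ ha] at this
    convert! this using 1
    push_cast
    ring
  have hkm : NotPole km := by simpa using hsub 1 0 (by omega) (by omega)
  have hR2 : NotPole (2 * R) := by simpa using hshort 0 (by omega)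
  rw [cTilde_eq h, cTildeRhoFormula]
  simp only [rho_apply, ← hR]
  have e1 := prod_fin_Ioi (n := n) fun a b : ℕ =>
      Complex.Gamma (R + (a : ℂ) * km - (R + (b : ℂ) * km)) /
        Complex.Gamma (R + (a : ℂ) * km - (R + (b : ℂ) * km) + km) *
      (Complex.Gamma (R + (a : ℂ) * km + (R + (b : ℂ) * km)) /
        Complex.Gamma (R + (a : ℂ) * km + (R + (b : ℂ) * km) + km))
  rw [e1, Fin.prod_univ_eq_prod_range (fun i => cTildeOne ks kl (R + ((n - 1 - i : ℕ) : ℂ) * km)),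
    Finset.prod_range_reflect (fun i : ℕ => cTildeOne ks kl (R + (i : ℂ) * km)), ← Finset.prod_mul_distrib]
  refine Finset.prod_congr rfl fun a ha => ?_
  rw [Finset.mem_range] at ha
  have p1 : ∏ b ∈ Finset.range a, Complex.Gamma (R + (a : ℂ) * km - (R + (b : ℂ) * km)) /
      Complex.Gamma (R + (a : ℂ) * km - (R + (b : ℂ) * km) + km) =
      Complex.Gamma km / Complex.Gamma ((a + 1) * km) := by
    rw [← Finset.prod_range_reflect]
    have := prod_range_div_succ (f := fun d : ℕ => Complex.Gamma (((d + 1 : ℕ) : ℂ) * km)) (a := a)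
      (by simpa using hkm.gamma_ne_zero) fun b hb => by
        have := hsub a (a - 1 - b) ha (by omega)
        rw [show a - (a - 1 - b) = b + 1 by omega] at this
        exact this.gamma_ne_zero
    simp only [zero_add, Nat.cast_one, one_mul, Nat.cast_add] at this
    rw [← this]
    refine Finset.prod_congr rfl fun b hb => ?_
    rw [Finset.mem_range] at hb
    have e : ((a - 1 - b : ℕ) : ℂ) = a - 1 - b := by
      rw [Nat.sub_sub, Nat.cast_sub (by omega)]; push_cast; ring
    rw [e]
    congr 2 <;> ring
  have p2 : ∏ b ∈ Finset.range a, Complex.Gamma (R + (a : ℂ) * km + (R + (b : ℂ) * km)) /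
      Complex.Gamma (R + (a : ℂ) * km + (R + (b : ℂ) * km) + km) =
      Complex.Gamma (R + (R + a * km)) / Complex.Gamma (2 * (R + a * km)) := by
    have hR0 : Complex.Gamma (2 * R + (a + 0 : ℕ) * km) ≠ 0 := by
      rcases Nat.eq_zero_or_pos a with rfl | h0
      · simpa using hR2.gamma_ne_zero
      · exact (hadd a 0 ha h0).gamma_ne_zero
    have := prod_range_div_succ (f := fun b : ℕ => Complex.Gamma (2 * R + (a + b : ℕ) * km)) (a := a)
      hR0 fun b hb => (hadd a b ha hb).gamma_ne_zero
    rw [show R + (R + a * km) = 2 * R + (a + 0 : ℕ) * km by push_cast; ring,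
      show 2 * (R + a * km) = 2 * R + (a + a : ℕ) * km by push_cast; ring, ← this]
    refine Finset.prod_congr rfl fun b _ => ?_
    congr 2 <;> push_cast <;> ring
  rw [Finset.prod_mul_distrib, p1, p2, cTildeOne, ← hR]
  have g1 : Complex.Gamma (R + (R + a * km)) ≠ 0 := by
    rw [show R + (R + a * km) = 2 * R + (a + 0 : ℕ) * km by push_cast; ring]
    rcases Nat.eq_zero_or_pos a with rfl | h0
    · simpa using hR2.gamma_ne_zero
    · exact (hadd a 0 ha h0).gamma_ne_zero
  have g2 : Complex.Gamma (2 * (R + a * km)) ≠ 0 := by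
    rw [show 2 * (R + a * km) = 2 * R + (a + a : ℕ) * km by push_cast; ring]
    exact (hshort a ha).gamma_ne_zero
  have hkm0 := hkm.ne_zero
  have ha1 : (a : ℂ) + 1 ≠ 0 := by exact_mod_cast Nat.succ_ne_zero a
  rw [Complex.Gamma_add_one _ hkm0, Complex.Gamma_add_one _ (mul_ne_zero ha1 hkm0)]
  rw [show R + a * km + ks / 2 + 1 / 2 = ks + kl + 1 / 2 + a * km by rw [hR, rhoOne]; ring]
  generalize Complex.Gamma (ks + kl + 1 / 2 + a * km) = X
  generalize Complex.Gamma ((a + 1) * km) = Y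
  rcases eq_or_ne X 0 with rfl | hX
  · simp
  rcases eq_or_ne Y 0 with rfl | hY
  · simp
  field_simp

theorem dense_noPole (n : ℕ) : Dense {k : Mult | NoPole k (rho n k)} := by
  have hd := dense_forall_ne (K := ℂ) (E := Mult) (ι := {v : ℤ × ℤ × ℤ // v ≠ 0} × ℕ)
    (fun v => (v.1.1.1 : ℂ) • ContinuousLinearMap.fst ℂ ℂ (ℂ × ℂ) +
      (v.1.1.2.1 : ℂ) • (ContinuousLinearMap.fst ℂ ℂ ℂ).comp (ContinuousLinearMap.snd ℂ ℂ (ℂ × ℂ)) +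
      (v.1.1.2.2 : ℂ) • (ContinuousLinearMap.snd ℂ ℂ ℂ).comp (ContinuousLinearMap.snd ℂ ℂ (ℂ × ℂ)))
    (fun v h => v.1.2 (by
      have h1 := congrArg (fun g : Mult →L[ℂ] ℂ => g (1, 0, 0)) h
      have h2 := congrArg (fun g : Mult →L[ℂ] ℂ => g (0, 1, 0)) h
      have h3 := congrArg (fun g : Mult →L[ℂ] ℂ => g (0, 0, 1)) h
      simp at h1 h2 h3
      exact Prod.ext h1 (Prod.ext h2 h3))) (fun v => -(v.2 : ℂ))
  refine hd.mono fun k hk => ?_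
  have key : ∀ A B C : ℤ, (A, B, C) ≠ (0 : ℤ × ℤ × ℤ) →
      NotPole (A * k.1 + B * k.2.1 + C * k.2.2) := fun A B C hne m => by
    simpa using hk (⟨(A, B, C), hne⟩, m)
  intro α hα
  rcases mem_posRoots.1 hα with ⟨p, rfl⟩ | ⟨p, rfl⟩ | hα
  · change NotPole _
    rw [corootPair_short, halfRootMult_short, rho_apply, rhoOne]
    convert! key 1 (2 * (n - 1 - p : ℕ)) 2 (by simp) using 1
    push_cast
    ring_nf
  · change NotPole _
    rw [corootPair_long, halfRootMult_long, rho_apply, rhoOne]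
    convert! key 1 (n - 1 - p : ℕ) 1 (by simp) using 1
    push_cast
    ring_nf
  · change NotPole _
    rw [corootPair_middle _ hα, halfRootMult_middle _ hα]
    obtain ⟨i, j, hij, (rfl | rfl)⟩ := mem_middleRoots.1 hα
    · rw [pair_sub_left, pair_single, pair_single, rho_apply, rho_apply, rhoOne]
      convert! key 0 ((n - 1 - i : ℕ) - (n - 1 - j : ℕ)) 0 (by
        simp only [ne_eq, Prod.ext_iff, Prod.fst_zero, Prod.snd_zero, true_and, and_true]
        omega) using 1
      push_cast
      ring_nf
    · rw [pair_add_left, pair_single, pair_single, rho_apply, rho_apply, rhoOne]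
      convert! key 1 ((n - 1 - i : ℕ) + (n - 1 - j : ℕ)) 2 (by simp) using 1
      push_cast
      ring_nf

theorem cTildeRho_eq (hn : 2 ≤ n) {k : Mult} (hk : NotPole (k.2.1 + 1)) :
    cTildeRho n k = cTildeRhoFormula n k := by
  refine extendFrom_eq (dense_noPole n k) ?_
  have hc : ContinuousAt (cTildeRhoFormula n) k := by
    have hG : Continuous fun s : ℂ => (Complex.Gamma s)⁻¹ :=
      Complex.differentiable_one_div_Gamma.continuous
    have hG1 : ContinuousAt (fun k : Mult => Complex.Gamma (k.2.1 + 1)) k :=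
      ContinuousAt.comp (g := Complex.Gamma) (Complex.differentiableAt_Gamma _ hk).continuousAt
        (by fun_prop)
    unfold cTildeRhoFormula rhoOne
    refine tendsto_finsetProd _ fun a _ => ?_
    refine ContinuousAt.mul (ContinuousAt.mul (continuousAt_const.mul ?_) ?_)
      ((continuousAt_const.mul hG1).mul ?_)
    · refine ContinuousAt.const_cpow (by fun_prop) (Or.inl two_ne_zero)
    · exact (hG.comp (by fun_prop)).continuousAt
    · exact (hG.comp (by fun_prop)).continuousAt
  refine (hc.tendsto.mono_left nhdsWithin_le_nhds).congr' ?_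
  filter_upwards [self_mem_nhdsWithin] with k' hk'
  exact (cTilde_rho hn hk').symm

theorem cTildeRho_zero (hn : 2 ≤ n) (ks kl : ℂ) :
    cTildeRho n (ks, 0, kl) = cRatio ks kl ^ n * n.factorial := by
  rw [cTildeRho_eq hn (by simpa using notPole_nat_add_one 0), cTildeRhoFormula]
  simp only [mul_zero, add_zero, zero_add, Complex.Gamma_one, inv_one, mul_one]
  rw [Finset.prod_mul_distrib, Finset.prod_const, Finset.card_range, ← div_eq_mul_inv]
  congr 1
  rw [← Finset.prod_range_add_one_eq_factorial]
  push_cast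
  rfl

/-- The value of `cRatio ^ n / c̃(ρ(k), k)` at `k_m = 1`. -/
def constB (n : ℕ) (α : ℂ) : ℂ :=
  ∏ a ∈ Finset.range n, (4 ^ a * (a.factorial : ℂ) * ∏ i ∈ Finset.range a, (α + (i + 1 : ℕ)))

theorem gamma_add_nat {s : ℂ} (hs : NotPole s) (a : ℕ) :
    Complex.Gamma (s + a) = Complex.Gamma s * ∏ i ∈ Finset.range a, (s + i) := by
  induction a with
  | zero => simp
  | succ a ih =>
    rw [Finset.prod_range_succ, ← mul_assoc, ← ih, Nat.cast_add, Nat.cast_one, ← add_assoc,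
      Complex.Gamma_add_one _ (hs.add_ne a), mul_comm]

theorem cTildeRho_one (hn : 2 ≤ n) {ks kl : ℂ} (hC : NotPole (ks + kl + 1 / 2)) :
    cTildeRho n (ks, 1, kl) * constB n (ks + kl - 1 / 2) = cRatio ks kl ^ n := by
  rw [cTildeRho_eq hn (by simpa using notPole_nat_add_one 1), cTildeRhoFormula, constB,
    ← Finset.prod_mul_distrib]
  conv_rhs => rw [← Finset.card_range n, ← Finset.prod_const]
  refine Finset.prod_congr rfl fun a _ => ?_
  simp only [mul_one]
  have h2 : (2 : ℂ) ^ (1 - 2 * (rhoOne ks kl + a) - ks) * 4 ^ a = 2 ^ (1 - 2 * rhoOne ks kl - ks) := by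
    rw [show (4 : ℂ) = 2 ^ 2 by norm_num, ← pow_mul, ← Complex.cpow_natCast,
      ← Complex.cpow_add _ _ two_ne_zero]
    push_cast
    ring_nf
  have h3 : Complex.Gamma ((a : ℂ) + 1 + 1) = (a + 1) * a.factorial := by
    have := Complex.Gamma_nat_eq_factorial (a + 1)
    rw [Nat.factorial_succ] at this
    push_cast at this
    exact this
  have h4 : Complex.Gamma (1 + 1) = 1 := by
    simpa using Complex.Gamma_nat_eq_factorial 1
  have h5 : ∏ i ∈ Finset.range a, (ks + kl - 1 / 2 + ((i + 1 : ℕ) : ℂ)) =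
      ∏ i ∈ Finset.range a, (ks + kl + 1 / 2 + i) :=
    Finset.prod_congr rfl fun i _ => by push_cast; ring
  rw [h3, h4, h5, gamma_add_nat hC, cRatio, ← h2]
  have g1 := hC.gamma_ne_zero
  have g2 : ∏ i ∈ Finset.range a, (ks + kl + 1 / 2 + (i : ℂ)) ≠ 0 :=
    Finset.prod_ne_zero_iff.2 fun i _ => hC.add_ne i
  have g3 : (a.factorial : ℂ) ≠ 0 := by exact_mod_cast a.factorial_ne_zero
  have ha1 : (a : ℂ) + 1 ≠ 0 := by exact_mod_cast Nat.succ_ne_zero a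
  generalize Complex.Gamma (ks + kl + 1 / 2) = X at *
  generalize ∏ i ∈ Finset.range a, (ks + kl + 1 / 2 + (i : ℂ)) = Y at *
  field_simp

end AtRho

section CFun

variable {n : ℕ} {ks kl : ℂ} {l : Fin n → ℂ}

theorem cRatio_ne_zero (hC : NotPole (ks + kl + 1 / 2)) : cRatio ks kl ≠ 0 :=
  div_ne_zero (mul_ne_zero ofReal_sqrt_pi_ne_zero (two_cpow_ne_zero _)) hC.gamma_ne_zero

theorem cFun_zero (hn : 2 ≤ n) (hC : NotPole (ks + kl + 1 / 2)) (h : NoPole (ks, 0, kl) l) :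
    cFun (ks, 0, kl) l = 1 / (n.factorial : ℂ) * ∏ p, cOne ks kl (l p) := by
  rw [cFun, cTilde_zero hC h, cTildeRho_zero hn]
  have := pow_ne_zero n (cRatio_ne_zero hC)
  field_simp

theorem cFun_one (hn : 2 ≤ n) (hC : NotPole (ks + kl + 1 / 2)) (h : NoPole (ks, 1, kl) l) :
    cFun (ks, 1, kl) l = constB n (ks + kl - 1 / 2) * (∏ p, cOne ks kl (l p)) /
      ∏ i, ∏ j ∈ Finset.Ioi i, (l i ^ 2 - l j ^ 2) := by
  have h1 := cTildeRho_one hn hC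
  have h2 : cTildeRho n (ks, 1, kl) ≠ 0 := fun h0 => by
    rw [h0, zero_mul] at h1
    exact pow_ne_zero n (cRatio_ne_zero hC) h1.symm
  rw [cFun, cTilde_one hC h, ← h1]
  field_simp

end CFun

section Weyl

variable {n : ℕ}

theorem units_smul_sq {R : Type*} [CommRing R] (e : ℤˣ) (v : R) :
    (((e : ℤ) : R) * v) ^ 2 = v ^ 2 := by
  rcases Int.units_eq_one_or e with rfl | rfl <;> simp

theorem genericParams_notInt {k : Mult} {l : Fin n → ℂ} (hl : l ∈ genericParams n k) (w : Weyl n)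
    (p : Fin n) : NotInt (2 * act w l p) := by
  obtain ⟨h1, h2⟩ := hl w
  intro m hm
  rcases le_or_gt m 0 with h0 | h0
  · obtain ⟨a, rfl⟩ := Int.exists_eq_neg_ofNat h0
    exact h2.short p a (by rw [hm]; push_cast; rfl)
  · obtain ⟨a, rfl⟩ := Int.eq_ofNat_of_zero_le h0.le
    have hmem : (Pi.single p (a : ℤ) : Fin n → ℤ) ∈ rootCone n := by
      have := (rootCone n).nsmul_mem (posRoot_mem_rootCone (mem_posRoots.2 (Or.inl ⟨p, rfl⟩))) a
      convert! this using 1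
      ext i
      simp [Pi.single_apply]
    refine h1 _ hmem (fun h => ?_) ?_
    · have := congrFun h p
      simp at this
      omega
    · rw [pair_single, pair_self_single]
      push_cast
      push_cast at hm
      linear_combination -(a : ℂ) * hm

theorem toChamber_spec {x : Fin n → ℝ} (hx : x ∈ regularElements n) :
    ∃ w : Weyl n, toChamber x = act w x ∧ act w x ∈ chamber n := by
  refine ⟨_, dif_pos hx, hx.choose_spec⟩

theorem sum_weyl (s : Equiv.Perm (Fin n) → ℂ) (g : ℂ → ℝ → ℂ) (l : Fin n → ℂ) (y : Fin n → ℝ) :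
    ∑ w : Weyl n, s w.2 * ∏ p, g (act w l p) (y p) =
      ∑ σ, s σ * ∏ p, (g (l (σ p)) (y p) + g (-l (σ p)) (y p)) := by
  rw [Fintype.sum_prod_type_right]
  refine Finset.sum_congr rfl fun σ _ => ?_
  dsimp only
  rw [← Finset.mul_sum]
  congr 1
  have h : ∀ p, g (l (σ p)) (y p) + g (-l (σ p)) (y p) =
      ∑ e : ℤˣ, g (((e : ℤ) : ℂ) * l (σ p)) (y p) := fun p => by
    rw [UnitsInt.univ, Finset.sum_pair (by decide)]
    simp
  simp only [h]
  rw [Finset.prod_univ_sum, Fintype.piFinset_univ]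
  rfl

theorem prod_hypOne_act (ks kl : ℂ) (v : Fin n → ℂ) (w : Weyl n) (x : Fin n → ℝ) :
    ∏ p, hypOne ks kl (v p) (act w x p) = ∏ p, hypOne ks kl (v p) (x (w.2 p)) := by
  refine Finset.prod_congr rfl fun p _ => ?_
  rw [act]
  rcases Int.units_eq_one_or (w.1 p) with h | h <;> simp [h, hypOne_neg]

/-- The matrix of rank one hypergeometric functions. -/
def hypMatrix (ks kl : ℂ) (l : Fin n → ℂ) (x : Fin n → ℝ) : Matrix (Fin n) (Fin n) ℂ :=
  Matrix.of fun i j => hypOne ks kl (l i) (x j)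

theorem hypergeometricGeneric_zero (hn : 2 ≤ n) {ks kl : ℂ} (hC : NotPole (ks + kl + 1 / 2))
    {l : Fin n → ℂ} (hl : l ∈ genericParams n (ks, 0, kl)) {x : Fin n → ℝ}
    (hx : x ∈ regularElements n) : hypergeometricGeneric (ks, 0, kl) l x =
      1 / (n.factorial : ℂ) * (hypMatrix ks kl l x).permanent := by
  obtain ⟨w₀, hw, hy⟩ := toChamber_spec hx
  rw [hypergeometricGeneric, hw]
  have h1 : ∀ w : Weyl n, cFun (ks, 0, kl) (act w l) * hcSeries (ks, 0, kl) (act w l) (act w₀ x) =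
      1 / (n.factorial : ℂ) * ∏ p, (cOne ks kl (act w l p) * hcOne ks kl (act w l p) (act w₀ x p)) := by
    intro w
    rw [cFun_zero hn hC (hl w).2, hcSeries_eq (hl w).1
      (isHarishChandraSeries_zero (genericParams_notInt hl w)) hy, Finset.prod_mul_distrib]
    ring
  rw [Finset.sum_congr rfl fun w _ => h1 w,
    sum_weyl (fun _ => 1 / (n.factorial : ℂ)) (fun v t => cOne ks kl v * hcOne ks kl v t),
    ← Finset.mul_sum]
  congr 1
  rw [← Matrix.permanent_permute_rows w₀.2, Matrix.permanent]
  refine Finset.sum_congr rfl fun σ _ => ?_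
  have h2 : ∀ p, cOne ks kl (l (σ p)) * hcOne ks kl (l (σ p)) (act w₀ x p) +
      cOne ks kl (-l (σ p)) * hcOne ks kl (-l (σ p)) (act w₀ x p) =
      hypOne ks kl (l (σ p)) (act w₀ x p) := fun p => by
    have := genericParams_notInt hl (1, σ) p
    rw [hypOne_eq hC (by simpa [act] using this) (chamber_pos hy p)]
  rw [Finset.prod_congr rfl fun p _ => h2 p, prod_hypOne_act ks kl (fun p => l (σ p))]
  rfl

theorem prod_sub_sq_act (w : Weyl n) (l : Fin n → ℂ) :
    ∏ i, ∏ j ∈ Finset.Ioi i, (act w l i ^ 2 - act w l j ^ 2) =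
      ((Equiv.Perm.sign w.2 : ℤ) : ℂ) * ∏ i, ∏ j ∈ Finset.Ioi i, (l i ^ 2 - l j ^ 2) := by
  have h : ∀ v : Fin n → ℂ, ∏ i, ∏ j ∈ Finset.Ioi i, (v i ^ 2 - v j ^ 2) =
      (Matrix.vandermonde fun i => -v i ^ 2).det := fun v => by
    rw [Matrix.det_vandermonde]
    exact Finset.prod_congr rfl fun i _ => Finset.prod_congr rfl fun j _ => by ring
  rw [h, h, ← Matrix.det_permute]
  congr 1
  ext i j
  simp [Matrix.vandermonde_apply, act, units_smul_sq]

theorem vdet_act (w : Weyl n) (x : Fin n → ℝ) :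
    vdet (act w x) = ((Equiv.Perm.sign w.2 : ℤ) : ℂ) * vdet x := by
  rw [vdet, vdet, ← Matrix.det_permute]
  congr 1
  ext i m
  simp only [Matrix.of_apply, Matrix.submatrix_apply, vRow, id, act]
  rcases Int.units_eq_one_or (w.1 i) with h | h <;> simp [h, vCosh]

theorem hypergeometricGeneric_one (hn : 2 ≤ n) {ks kl : ℂ} (hC : NotPole (ks + kl + 1 / 2))
    {l : Fin n → ℂ} (hl : l ∈ genericParams n (ks, 1, kl)) {x : Fin n → ℝ}
    (hx : x ∈ regularElements n) : hypergeometricGeneric (ks, 1, kl) l x =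
      constB n (ks + kl - 1 / 2) * (hypMatrix ks kl l x).det /
        ((∏ i, ∏ j ∈ Finset.Ioi i, (l i ^ 2 - l j ^ 2)) * vdet x) := by
  obtain ⟨w₀, hw, hy⟩ := toChamber_spec hx
  rw [hypergeometricGeneric, hw]
  set D := ∏ i, ∏ j ∈ Finset.Ioi i, (l i ^ 2 - l j ^ 2) with hD
  set B := constB n (ks + kl - 1 / 2) with hB
  have hsign : ∀ (σ : Equiv.Perm (Fin n)) (z : ℂ),
      z / ((Equiv.Perm.sign σ : ℤ) : ℂ) = ((Equiv.Perm.sign σ : ℤ) : ℂ) * z := by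
    intro σ z
    rcases Int.units_eq_one_or (Equiv.Perm.sign σ) with h | h <;> simp [h, div_neg]
  have h1 : ∀ w : Weyl n, cFun (ks, 1, kl) (act w l) * hcSeries (ks, 1, kl) (act w l) (act w₀ x) =
      (B / (D * vdet (act w₀ x)) * ((Equiv.Perm.sign w.2 : ℤ) : ℂ)) *
        ∏ p, (cOne ks kl (act w l p) * hcOne ks kl (act w l p) (act w₀ x p)) := by
    intro w
    rw [cFun_one hn hC (hl w).2, hcSeries_eq (hl w).1
      (isHarishChandraSeries_one (genericParams_notInt hl w)) hy, Finset.prod_mul_distrib,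
      prod_sub_sq_act, ← div_div, hsign]
    ring
  rw [Finset.sum_congr rfl fun w _ => h1 w,
    sum_weyl (fun σ => B / (D * vdet (act w₀ x)) * ((Equiv.Perm.sign σ : ℤ) : ℂ))
      (fun v t => cOne ks kl v * hcOne ks kl v t)]
  have h3 : ((hypMatrix ks kl l x).submatrix id w₀.2).det =
      ∑ σ, ((Equiv.Perm.sign σ : ℤ) : ℂ) * ∏ p, (cOne ks kl (l (σ p)) * hcOne ks kl (l (σ p)) (act w₀ x p) +
      cOne ks kl (-l (σ p)) * hcOne ks kl (-l (σ p)) (act w₀ x p)) := by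
    rw [Matrix.det_apply']
    refine Finset.sum_congr rfl fun σ _ => ?_
    have h2 : ∀ p, cOne ks kl (l (σ p)) * hcOne ks kl (l (σ p)) (act w₀ x p) +
        cOne ks kl (-l (σ p)) * hcOne ks kl (-l (σ p)) (act w₀ x p) =
        hypOne ks kl (l (σ p)) (act w₀ x p) := fun p => by
      have := genericParams_notInt hl (1, σ) p
      rw [hypOne_eq hC (by simpa [act] using this) (chamber_pos hy p)]
    rw [Finset.prod_congr rfl fun p _ => h2 p, prod_hypOne_act ks kl (fun p => l (σ p))]
    rfl
  simp only [mul_assoc]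
  rw [← Finset.mul_sum, ← h3, Matrix.det_permute', vdet_act]
  rcases Int.units_eq_one_or (Equiv.Perm.sign w₀.2) with h | h <;> simp only [h] <;> push_cast <;> ring

end Weyl

section Density

variable {n : ℕ}

theorem dense_genericParams (n : ℕ) (k : Mult) : Dense (genericParams n k) := by
  have hd := dense_forall_ne (K := ℂ) (E := Fin n → ℂ)
    (ι := Weyl n × {μ : Fin n → ℤ // μ ≠ 0} × Option ℕ)
    (fun q => ∑ i, (((q.2.1.1 i : ℤ) : ℂ) * ((q.1.1 i : ℤ) : ℂ)) • ContinuousLinearMap.proj (q.1.2 i))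
    (fun q h0 => by
      obtain ⟨⟨ε, σ⟩, ⟨μ, hμ⟩, m⟩ := q
      obtain ⟨i, hi⟩ := Function.ne_iff.1 hμ
      have h1 := congrArg (fun g : (Fin n → ℂ) →L[ℂ] ℂ => g (Pi.single (σ i) 1)) h0
      simp [Pi.single_apply] at h1
      exact hi h1)
    (fun q => match q.2.2 with
      | none => ((pair q.2.1.1 q.2.1.1 : ℤ) : ℂ) / 2
      | some m => (-(m : ℂ) - halfRootMult k q.2.1.1 / 2) * ((pair q.2.1.1 q.2.1.1 : ℤ) : ℂ) / 2)
  have key : ∀ (w : Weyl n) (μ : Fin n → ℤ) (l : Fin n → ℂ),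
      (∑ i, (((μ i : ℤ) : ℂ) * ((w.1 i : ℤ) : ℂ)) •
        (ContinuousLinearMap.proj (w.2 i) : (Fin n → ℂ) →L[ℂ] ℂ)) l = pair μ (act w l) := by
    intro w μ l
    simp [pair, act, mul_assoc]
  refine hd.mono fun l hl w => ⟨fun μ _ hμ h0 => ?_, fun α hα m h0 => ?_⟩
  · refine hl (w, ⟨μ, hμ⟩, none) ?_
    rw [key]
    linear_combination -(1 / 2 : ℂ) * h0
  · have h1 : pair α α ≠ (0 : ℤ) := by
      rcases mem_posRoots.1 hα with ⟨p, rfl⟩ | ⟨p, rfl⟩ | h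
      · simp [pair_self_single]
      · simp [pair_self_single]
      · simp [pair_self_middle h]
    have hα0 : α ≠ 0 := by
      rintro rfl
      exact h1 (pair_zero_left _)
    refine hl (w, ⟨α, hα0⟩, some m) ?_
    rw [key]
    rw [corootPair] at h0
    have h2 : ((pair α α : ℤ) : ℂ) ≠ 0 := by exact_mod_cast h1
    simp only
    field_simp at h0
    linear_combination (1 / 4 : ℂ) * h0

theorem mem_regularElements {x : Fin n → ℝ} (h : ∀ μ : Fin n → ℤ, μ ≠ 0 → pair μ x ≠ 0) :
    x ∈ regularElements n := by
  have h0 : ∀ i, x i ≠ 0 := fun i => by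
    have := h (Pi.single i 1) (by simp)
    simpa [pair_single] using this
  have h1 : ∀ i j, i ≠ j → |x i| ≠ |x j| := by
    intro i j hij e
    rcases abs_eq_abs.1 e with e | e
    · refine h (Pi.single i 1 - Pi.single j 1) (fun h' => ?_) ?_
      · have := congrFun h' i
        simp [hij] at this
      · simp [pair_sub_left, pair_single, e]
    · refine h (Pi.single i 1 + Pi.single j 1) (fun h' => ?_) ?_
      · have := congrFun h' i
        simp [hij] at this
      · simp [pair_add_left, pair_single, e]
  set σ := Tuple.sort fun i => -|x i| with hσ
  refine ⟨(fun i => if 0 < x (σ i) then 1 else -1, σ), ?_⟩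
  have h2 : ∀ i, act ((fun i => if 0 < x (σ i) then 1 else -1, σ) : Weyl n) x i = |x (σ i)| := by
    intro i
    simp only [act]
    split_ifs with hp
    · rw [abs_of_pos hp]; simp
    · rw [abs_of_nonpos (not_lt.1 hp)]; simp
  refine mem_chamber (fun i => ?_) fun i j hij => ?_
  · rw [h2]; exact abs_pos.2 (h0 _)
  · rw [h2, h2]
    refine lt_of_le_of_ne ?_ (h1 _ _ fun e => hij.ne' (σ.injective e))
    have := Tuple.monotone_sort (fun i => -|x i|) hij.le
    simpa using this

theorem dense_regularElements (n : ℕ) : Dense (regularElements n) := by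
  refine (dense_forall_ne (K := ℝ) (ι := {μ : Fin n → ℤ // μ ≠ 0}) (fun μ => pairL ℝ μ.1)
    (fun μ => pairL_ne_zero μ.2) (fun _ => 0)).mono fun x hx => mem_regularElements fun μ hμ => ?_
  rw [← pairL_apply]
  exact hx ⟨μ, hμ⟩

theorem hypergeometric_eq {k : Mult} {f : (Fin n → ℂ) × (Fin n → ℝ) → ℂ}
    (hf : ∀ l ∈ genericParams n k, ∀ x ∈ regularElements n, hypergeometricGeneric k l x = f (l, x))
    {l : Fin n → ℂ} {x : Fin n → ℝ} (hc : ContinuousAt f (l, x)) :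
    hypergeometric k l x = f (l, x) := by
  refine extendFrom_eq ((dense_genericParams n k).prod (dense_regularElements n) _) ?_
  refine (hc.tendsto.mono_left nhdsWithin_le_nhds).congr' ?_
  filter_upwards [self_mem_nhdsWithin] with p hp
  exact (hf p.1 hp.1 p.2 hp.2).symm

end Density

section Formulas

variable {n : ℕ} {ks kl : ℂ}

theorem continuous_hypMatrix_apply (ks kl : ℂ) (i j : Fin n) :
    Continuous fun p : (Fin n → ℂ) × (Fin n → ℝ) => hypMatrix ks kl p.1 p.2 i j := by
  have h1 : Continuous fun p : (Fin n → ℂ) × (Fin n → ℝ) => p.1 i :=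
    (continuous_apply i).comp continuous_fst
  have h2 : Continuous fun p : (Fin n → ℂ) × (Fin n → ℝ) => p.2 j :=
    (continuous_apply j).comp continuous_snd
  have h3 := (continuous_hypOne ks kl).comp (h1.prodMk h2)
  simpa only [hypMatrix, Matrix.of_apply, Function.comp_def] using h3

theorem hypergeometric_zero (hn : 2 ≤ n) (hC : NotPole (ks + kl + 1 / 2)) (l : Fin n → ℂ)
    (x : Fin n → ℝ) : hypergeometric (ks, 0, kl) l x =
      1 / (n.factorial : ℂ) * (hypMatrix ks kl l x).permanent := by
  refine hypergeometric_eq (f := fun p => 1 / (n.factorial : ℂ) *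
    (hypMatrix ks kl p.1 p.2).permanent) (fun l hl x hx => hypergeometricGeneric_zero hn hC hl hx) ?_
  refine Continuous.continuousAt (continuous_const.mul ?_)
  unfold Matrix.permanent
  exact continuous_finsetSum _ fun σ _ => continuous_finsetProd _ fun i _ =>
    continuous_hypMatrix_apply ks kl _ _

theorem continuous_vdet : Continuous (vdet (n := n)) := contDiff_vdet.continuous

theorem hypergeometric_one (hn : 2 ≤ n) (hC : NotPole (ks + kl + 1 / 2)) {l : Fin n → ℂ}
    {x : Fin n → ℝ} (hl : ∀ i j, i ≠ j → l i ^ 2 ≠ l j ^ 2) (hx : vdet x ≠ 0) :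
    hypergeometric (ks, 1, kl) l x = constB n (ks + kl - 1 / 2) * (hypMatrix ks kl l x).det /
        ((∏ i, ∏ j ∈ Finset.Ioi i, (l i ^ 2 - l j ^ 2)) * vdet x) := by
  refine hypergeometric_eq (f := fun p => constB n (ks + kl - 1 / 2) * (hypMatrix ks kl p.1 p.2).det /
        ((∏ i, ∏ j ∈ Finset.Ioi i, (p.1 i ^ 2 - p.1 j ^ 2)) * vdet p.2))
    (fun l hl x hx => hypergeometricGeneric_one hn hC hl hx) ?_
  have h1 : Continuous fun p : (Fin n → ℂ) × (Fin n → ℝ) => (hypMatrix ks kl p.1 p.2).det :=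
    Continuous.matrix_det (continuous_matrix fun i j => continuous_hypMatrix_apply ks kl i j)
  have h2 : Continuous fun p : (Fin n → ℂ) × (Fin n → ℝ) =>
      (∏ i, ∏ j ∈ Finset.Ioi i, (p.1 i ^ 2 - p.1 j ^ 2)) * vdet p.2 :=
    (continuous_finsetProd _ fun i _ => continuous_finsetProd _ fun j _ => by fun_prop).mul
      (continuous_vdet.comp continuous_snd)
  refine (continuous_const.mul h1).continuousAt.div h2.continuousAt (mul_ne_zero ?_ hx)
  exact Finset.prod_ne_zero_iff.2 fun i _ => Finset.prod_ne_zero_iff.2 fun j hj =>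
    sub_ne_zero.2 (hl i j (Finset.mem_Ioi.1 hj).ne)

end Formulas

section Limits

variable {n : ℕ} {ks kl : ℂ}

theorem tendsto_hypMatrix_apply {α : ℂ} (hα : α = ks + kl - 1 / 2) (hC : NotPole (α + 1))
    {lam : Fin n → ℂ} (hlam : ∀ j, lam j ≠ 0) {t : Fin n → ℝ} (ht : ∀ j, t j ≠ 0) (i j : Fin n) :
    Tendsto (fun ε : ℝ => hypMatrix ks kl (spectralParam fun j => (ε : ℂ)⁻¹ * lam j)
      (logPoint fun j => ε * t j) i j) (𝓝[>] 0) (𝓝 (besselMatrix α lam t i j)) := by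
  have h := tendsto_hypOne ks kl (lam i) (t j)
  have e : besselMatrix α lam t i j = besselSum (ks + kl + 1 / 2) ((lam i * t j / 2) ^ 2) := by
    rw [besselMatrix, Matrix.of_apply, normBessel_eq hC
      (mul_ne_zero (mul_ne_zero Complex.I_ne_zero (hlam i)) (by exact_mod_cast ht j))]
    congr 1
    · rw [hα]; ring
    · linear_combination (-(lam i * t j / 2) ^ 2) * Complex.I_sq
  rw [e]
  exact h

theorem tendsto_cosh_sub_one (t : ℝ) :
    Tendsto (fun ε : ℝ => (2 * Real.cosh (2 * (ε * t)) - 2) / ε ^ 2) (𝓝[>] 0) (𝓝 (4 * t ^ 2)) := by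
  have h1 : Tendsto (fun ε : ℝ => Real.sinh (ε * t) / ε) (𝓝[>] 0) (𝓝 t) := by
    have hd : HasDerivAt (fun ε : ℝ => Real.sinh (ε * t)) t 0 := by
      have := ((hasDerivAt_id (0 : ℝ)).mul_const t).sinh
      simpa using this
    have := hd.tendsto_slope_zero_right
    refine this.congr fun ε => ?_
    simp [div_eq_inv_mul]
  refine ((h1.pow 2).const_mul 4).congr fun ε => ?_
  rw [Real.cosh_two_mul, Real.cosh_sq, div_pow]
  ring

theorem vdet_logPoint_ne_zero {t : Fin n → ℝ} (ht : ∀ i j, i ≠ j → t i ^ 2 ≠ t j ^ 2) {ε : ℝ}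
    (hε : 0 < ε) : vdet (logPoint fun j => ε * t j) ≠ 0 := by
  rw [vdet_eq]
  refine Finset.prod_ne_zero_iff.2 fun i _ => Finset.prod_ne_zero_iff.2 fun j hj => sub_ne_zero.2 ?_
  intro h
  simp only [vCosh, logPoint] at h
  have h1 : Real.cosh (2 * (ε * t j)) = Real.cosh (2 * (ε * t i)) := by
    have := Complex.ofReal_injective h
    linarith
  have h2 : |2 * (ε * t j)| = |2 * (ε * t i)| :=
    le_antisymm (Real.cosh_le_cosh.1 h1.le) (Real.cosh_le_cosh.1 h1.ge)
  have h3 := sq_abs (2 * (ε * t j))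
  rw [h2, sq_abs] at h3
  refine ht i j (Finset.mem_Ioi.1 hj).ne ?_
  have h4 : (2 * ε) ^ 2 * t i ^ 2 = (2 * ε) ^ 2 * t j ^ 2 := by linear_combination h3
  exact mul_left_cancel₀ (by positivity) h4

theorem tendsto_prod_mul_vdet (lam : Fin n → ℂ) (t : Fin n → ℝ) :
    Tendsto (fun ε : ℝ => (∏ i, ∏ j ∈ Finset.Ioi i,
      ((spectralParam (fun j => (ε : ℂ)⁻¹ * lam j) i) ^ 2 -
        (spectralParam (fun j => (ε : ℂ)⁻¹ * lam j) j) ^ 2)) * vdet (logPoint fun j => ε * t j))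
      (𝓝[>] 0) (𝓝 (∏ i, ∏ j ∈ Finset.Ioi i,
        ((lam i ^ 2 - lam j ^ 2) * ((t i ^ 2 - t j ^ 2 : ℝ) : ℂ)))) := by
  simp only [vdet_eq, ← Finset.prod_mul_distrib]
  refine tendsto_finsetProd _ fun i _ => tendsto_finsetProd _ fun j _ => ?_
  have h := ((tendsto_cosh_sub_one (t i)).sub (tendsto_cosh_sub_one (t j))).const_mul (1 / 4)
  have h2 := ((Complex.continuous_ofReal.tendsto _).comp h).const_mul (lam i ^ 2 - lam j ^ 2)
  convert! h2 using 2 with ε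
  · simp only [spectralParam, logPoint, vCosh, Function.comp_apply]
    push_cast
    ring
  · congr 2
    ring

theorem prod_Ioi_four (n : ℕ) : ∏ i : Fin n, ∏ _j ∈ Finset.Ioi i, (4 : ℂ) = 2 ^ (n * (n - 1)) := by
  have := prod_fin_Ioi (n := n) fun _ _ => (4 : ℂ)
  rw [this]
  simp only [Finset.prod_const, Finset.card_range]
  rw [Finset.prod_pow_eq_pow_sum, ← Finset.sum_range_id_mul_two, mul_comm, pow_mul]
  norm_num

theorem deltaRat_eq (t : Fin n → ℝ) : (deltaRat t : ℂ) =
    2 ^ (n * (n - 1)) * ∏ i, ∏ j ∈ Finset.Ioi i, ((t i ^ 2 - t j ^ 2 : ℝ) : ℂ) := by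
  rw [← prod_Ioi_four, deltaRat, prod_middleRoots, ← Finset.prod_mul_distrib]
  push_cast
  refine Finset.prod_congr rfl fun i _ => ?_
  rw [← Finset.prod_mul_distrib]
  refine Finset.prod_congr rfl fun j _ => ?_
  simp only [pair_sub_left, pair_add_left, pair_single, logPoint]
  push_cast
  ring

theorem constA_eq (n : ℕ) (α : ℂ) : constA n α = 2 ^ (n * (n - 1)) * constB n α := by
  have h1 : ∏ a ∈ Finset.range n, (4 : ℂ) ^ a = 2 ^ (n * (n - 1)) := by
    rw [Finset.prod_pow_eq_pow_sum, ← Finset.sum_range_id_mul_two, mul_comm, pow_mul]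
    norm_num
  have h2 : ∀ m : ℕ, (∏ a ∈ Finset.range (m + 1),
      ((a.factorial : ℂ) * ∏ i ∈ Finset.range a, (α + (i + 1 : ℕ)))) =
      ∏ i ∈ Finset.Icc 1 m, ((α + i) ^ (m + 1 - i) * (i.factorial : ℂ)) := by
    intro m
    induction m with
    | zero => simp
    | succ m ih =>
      rw [Finset.prod_range_succ, ih, Finset.prod_Icc_succ_top (by omega)]
      have h3 : ∏ i ∈ Finset.Icc 1 m, ((α + i) ^ (m + 1 + 1 - i) * (i.factorial : ℂ)) =
          (∏ i ∈ Finset.Icc 1 m, ((α + i) ^ (m + 1 - i) * (i.factorial : ℂ))) *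
            ∏ i ∈ Finset.Icc 1 m, (α + i) := by
        rw [← Finset.prod_mul_distrib]
        refine Finset.prod_congr rfl fun i hi => ?_
        rw [show m + 1 + 1 - i = (m + 1 - i) + 1 by have := Finset.mem_Icc.1 hi; omega, pow_succ]
        ring
      have h4 : ∏ i ∈ Finset.range m, (α + ((i + 1 : ℕ) : ℂ)) = ∏ i ∈ Finset.Icc 1 m, (α + i) := by
        rw [Finset.range_eq_Ico, Finset.prod_Ico_add' (fun i : ℕ => α + (i : ℂ)) 0 m 1]
        rfl
      rw [h3, Finset.prod_range_succ, h4, show m + 1 + 1 - (m + 1) = 1 by omega]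
      ring
  rcases n with _ | m
  · simp [constA, constB]
  · rw [constA, constB, ← h1]
    simp only [mul_assoc, Finset.prod_mul_distrib (f := fun a => (4 : ℂ) ^ a)]
    rw [h2, h1, Nat.add_sub_cancel, two_mul, pow_add]
    exact mul_assoc _ _ _

end Limits

end BC

end

theorem mainTheorem4 (n : ℕ) (hn : 2 ≤ n) (ks kl α : ℂ) (hα : α = ks + kl - 1 / 2)
    (hα0 : ∀ m : ℕ, α ≠ -(m : ℂ))
    (lam : Fin n → ℂ) (hlam : ∀ j, lam j ≠ 0) (t : Fin n → ℝ) (ht : ∀ j, t j ≠ 0) :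
    ((∀ i j, i ≠ j → lam i ^ 2 ≠ lam j ^ 2) → (∀ i j, i ≠ j → t i ^ 2 ≠ t j ^ 2) →
      Tendsto
        (fun ε : ℝ => BC.hypergeometric (ks, 1, kl)
          (BC.spectralParam fun j => (ε : ℂ)⁻¹ * lam j) (BC.logPoint fun j => ε * t j))
        (𝓝[>] 0)
        (𝓝 (BC.constA n α / (∏ i, ∏ j ∈ Finset.Ioi i, (lam i ^ 2 - lam j ^ 2)) *
          ((BC.besselMatrix α lam t).det / (BC.deltaRat t : ℂ))))) ∧
    Tendsto
      (fun ε : ℝ => BC.hypergeometric (ks, 0, kl)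
        (BC.spectralParam fun j => (ε : ℂ)⁻¹ * lam j) (BC.logPoint fun j => ε * t j))
      (𝓝[>] 0)
      (𝓝 (1 / (n.factorial : ℂ) * (BC.besselMatrix α lam t).permanent)) := by
  have hC1 : BC.NotPole (α + 1) := fun m h => hα0 (m + 1) (by push_cast; linear_combination h)
  have hC : BC.NotPole (ks + kl + 1 / 2) := by
    rw [show ks + kl + 1 / 2 = α + 1 by rw [hα]; ring]
    exact hC1
  have hM := BC.tendsto_hypMatrix_apply hα hC1 hlam ht
  refine ⟨fun hl htt => ?_, ?_⟩
  · have hdet : Tendsto (fun ε : ℝ => (BC.hypMatrix ks kl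
        (BC.spectralParam fun j => (ε : ℂ)⁻¹ * lam j) (BC.logPoint fun j => ε * t j)).det)
        (𝓝[>] 0) (𝓝 (BC.besselMatrix α lam t).det) := by
      simp only [Matrix.det_apply']
      exact tendsto_finsetSum _ fun σ _ =>
        (tendsto_finsetProd _ fun i _ => hM (σ i) i).const_mul _
    have hne : ∏ i, ∏ j ∈ Finset.Ioi i, ((lam i ^ 2 - lam j ^ 2) * ((t i ^ 2 - t j ^ 2 : ℝ) : ℂ)) ≠ 0 :=
      Finset.prod_ne_zero_iff.2 fun i _ => Finset.prod_ne_zero_iff.2 fun j hj =>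
        mul_ne_zero (sub_ne_zero.2 (hl i j (Finset.mem_Ioi.1 hj).ne))
          (by exact_mod_cast sub_ne_zero.2 (htt i j (Finset.mem_Ioi.1 hj).ne))
    have hlim := (hdet.const_mul (BC.constB n (ks + kl - 1 / 2))).div
      (BC.tendsto_prod_mul_vdet lam t) hne
    have hval : BC.constB n (ks + kl - 1 / 2) * (BC.besselMatrix α lam t).det /
        (∏ i, ∏ j ∈ Finset.Ioi i, ((lam i ^ 2 - lam j ^ 2) * ((t i ^ 2 - t j ^ 2 : ℝ) : ℂ))) =
        BC.constA n α / (∏ i, ∏ j ∈ Finset.Ioi i, (lam i ^ 2 - lam j ^ 2)) *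
          ((BC.besselMatrix α lam t).det / (BC.deltaRat t : ℂ)) := by
      simp only [Finset.prod_mul_distrib] at hne ⊢
      have h1 := left_ne_zero_of_mul hne
      have h2 := right_ne_zero_of_mul hne
      rw [BC.deltaRat_eq, BC.constA_eq, ← hα]
      have h3 : (2 : ℂ) ^ (n * (n - 1)) ≠ 0 := pow_ne_zero _ two_ne_zero
      generalize (2 : ℂ) ^ (n * (n - 1)) = P at *
      generalize ∏ i, ∏ j ∈ Finset.Ioi i, ((t i ^ 2 - t j ^ 2 : ℝ) : ℂ) = T at *
      field_simp
    rw [← hval]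
    refine hlim.congr' ?_
    filter_upwards [self_mem_nhdsWithin] with ε hε
    have hε0 : (ε : ℂ) ≠ 0 := by exact_mod_cast (show (0 : ℝ) < ε from hε).ne'
    refine (BC.hypergeometric_one hn hC (fun i j hij h => hl i j hij ?_)
      (BC.vdet_logPoint_ne_zero htt hε)).symm
    simp only [BC.spectralParam] at h
    field_simp at h
    exact h
  · simp only [BC.hypergeometric_zero hn hC]
    refine Tendsto.const_mul _ ?_
    unfold Matrix.permanent
    exact tendsto_finsetSum _ fun σ _ => tendsto_finsetProd _ fun i _ => hM (σ i) i
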